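/- **Setting.** Let $(I,\cdot)$ be a finite anisotropic super Cartan datum (parity $p:I\to\{0,1\}$, $d_i=\frac{i\cdot i}{2}\in\mathbb Z_{>0}$, $a_{ij}=\frac{2\,i\cdot j}{i\cdot i}\in\mathbb Z_{\le 0}$ for $i\ne j$, $a_{ij}$ even if $p(i)=1$), which is bar-consistent ($d_i\equiv p(i)$ mod $2$) and has at least one odd index. Let $(Y,X,\langle\cdot,\cdot\rangle)$ be an $X$- and $Y$-regular root datum of this type, with simple roots $i'\in X$ and $i\in Y$. Let $\mathbf t^2=-1$, $\pi^2=1$, and write $R=\mathbb Q(\mathbf t)(v)[\pi]/(\pi^2-1)$, $v_i=v^{d_i}$, $\pi_i=\pi^{d_i}$, $\mathbf t_i=\mathbf t^{d_i}$. Let $\phi:\mathbb Z[I]\times X\to\mathbb Z$ be an enhancer: modulo $4$, $\phi(\nu+\mu,\lambda)\equiv\phi(\nu,\lambda)+\phi(\mu,\lambda)$ and $\phi(\nu,\lambda+\mu')\equiv\phi(\nu,\lambda)+\phi(\nu,\mu')$ for $\nu,\mu\in\mathbb Z[I]$, $\lambda\in X$; $\phi(i,i')\equiv d_i$; and for $i\neq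 j$, $\phi(i,j')$ is even and $\phi(i,j')-\phi(j,i')\equiv i\cdot j+2p(i)p(j)$. Let $\widehat{\mathbf U}$ be the enhanced quantum covering group: the $R$-algebra generated by $E_i,F_i$ ($i\in I$), $K_\mu,J_\mu,T_\mu$ ($\mu\in Y$) and $\Upsilon_\nu$ ($\nu\in\mathbb Z[I]$), where $K,J,T,\Upsilon$ are additive in the index and commute with each other, $J_\mu^2=T_\mu^4=\Upsilon_\nu^4=1$; $K_\mu,J_\mu,T_\mu,\Upsilon_\nu$ commute with $E_i$ (resp. $F_i$) up to the factors $v^{c},\pi^{c},\mathbf t^{c},\mathbf t^{\phi(\nu,i')}$ with $c=\langle\mu,i'\rangle$ (resp. their inverses); $$E_iF_j-\pi^{p(i)p(j)}F_jE_i=\delta_{ij}\frac{\tilde J_i\tilde K_i-\tilde K_{-i}}{\pi_iv_i-v_i^{-1}};$$ and, for $i\ne j$ and $b=1-a_{ij}$, both $x=E$ and $x=F$ satisfy $$\sum_{k=0}^{b}(-1)^k\pi^{\binom k2p(i)+kp(i)p(j)}\genfrac{[}{]}{0pt}{}{b}{k}_{v_i,\pi_i}x_i^{b-k}x_jx_i^k=0,\qquad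 \genfrac{[}{]}{0pt}{}{n}{k}_{v,\pi}=\frac{\prod_{l=n-k+1}^n((\pi v)^l-v^{-l})}{\prod_{m=1}^k((\pi v)^m-v^{-m})}.$$ Here $\tilde K_{\pm i}=K_{\pm d_ii}$, $\tilde J_i=J_{d_ii}$, $\tilde T_i=T_{d_ii}$. The algebra is $\mathbb Z/2$-graded by $p(E_i)=p(F_i)=p(i)$, the other generators being even. Let $\omega$ be the $R$-algebra automorphism of $\widehat{\mathbf U}$ with $E_i\mapsto F_i$, $F_i\mapsto\pi_i\tilde J_iE_i$, $K_\mu\mapsto K_{-\mu}$, $J_\mu\mapsto J_\mu$, $T_\mu\mapsto T_{-\mu}$, $\Upsilon_\nu\mapsto\Upsilon_{-\nu}$. For dominant $\lambda\in X$, let $V(\lambda)[\mathbf t]$ be the quotient of the Verma module over $\widehat{\mathbf U}$ of highest weight $\lambda$ by the submodule generated by $F_i^{\langle i,\lambda\rangle+1}\cdot 1$ ($i\in I$), with highest weight vector $\eta_\lambda$, and let ${}^\omega V(\lambda)[\mathbf t]$ be the same space with $E_i,F_i,K_\mu,J_\mu$ acting through $\omega$, with $\xi_{-\lambda}=\eta_\lambda$.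 In both modules $K_\mu,J_\mu,T_\mu,\Upsilon_\nu$ act on the space of weight $\zeta$ by $v^{\langle\mu,\zeta\rangle},\pi^{\langle\mu,\zeta\rangle},\mathbf t^{\langle\mu,\zeta\rangle},\mathbf t^{\phi(\nu,\zeta)}$. Write $|w|$ for the weight of $w$, and $p(w)=p(\nu)=\sum_k\nu_kp(k)$ for $w\in V(\lambda)[\mathbf t]$ of weight $\lambda-\nu'$, where $\nu=\sum_k\nu_kk\in\mathbb N[I]$ and $\nu'=\sum_k\nu_kk'$. Fix dominant $\lambda,\lambda'$ and put $N(\lambda,\lambda')[\mathbf t]=V(\lambda)[\mathbf t]\otimes_R{}^\omega V(\lambda')[\mathbf t]$. Products in $\widehat{\mathbf U}\otimes_R\widehat{\mathbf U}$ and its action on $N(\lambda,\lambda')[\mathbf t]$ follow the rules $(x\otimes y)(z\otimes z')=\pi^{p(y)p(z)}xz\otimes yz'$ and $(x\otimes y)(w\otimes w')=\pi^{p(y)p(w)}xw\otimes yw'$. **Proposition.** 1. There is a unique homomorphism $\Delta:\widehat{\mathbf U}\to\widehat{\mathbf U}\otimes_R\widehat{\mathbf U}$ of $R$-algebras with $\Delta(E_i)=E_i\otimes\tilde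 K_{-i}+1\otimes E_i$, $\Delta(F_i)=F_i\otimes1+\tilde J_i\tilde K_i\otimes F_i$ and $\Delta(g)=g\otimes g$ for $g=K_\mu,J_\mu,T_\mu,\Upsilon_\nu$. There is a unique $\mathbb Q(\mathbf t)$-algebra automorphism $\mathfrak X$ of $\widehat{\mathbf U}$ with $$\mathfrak X(E_i)=\mathbf t_i^2E_i\tilde T_i\Upsilon_i,\quad \mathfrak X(F_i)=F_i\Upsilon_{-i},\quad \mathfrak X(K_\mu)=T_{-\mu}K_\mu,\quad \mathfrak X(J_\mu)=T_{2\mu}J_\mu,$$ $$\mathfrak X(T_\mu)=T_\mu,\quad \mathfrak X(\Upsilon_\nu)=\Upsilon_\nu,\quad\mathfrak X(v)=\mathbf t^{-1}v,\quad\mathfrak X(\pi)=-\pi.$$ Put $\mathfrak X'=\omega^{-1}\circ\mathfrak X\circ\omega$. 2. There are unique $\mathbb Q(\mathbf t)$-linear maps $\mathfrak X_\lambda$ on $V(\lambda)[\mathbf t]$ and $\mathfrak X_{-\lambda'}$ on ${}^\omega V(\lambda')[\mathbf t]$ such that $\mathfrak X_\lambda(\eta_\lambda)=\eta_\lambda$,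 $\mathfrak X_\lambda(um)=\mathfrak X(u)\mathfrak X_\lambda(m)$, and $\mathfrak X_{-\lambda'}(\xi_{-\lambda'})=\xi_{-\lambda'}$, $\mathfrak X_{-\lambda'}(um)=\mathfrak X'(u)\mathfrak X_{-\lambda'}(m)$, for all $u\in\widehat{\mathbf U}$ and all $m$. 3. There is an integer-valued function $\varkappa$ on pairs $(\zeta,\zeta')=(\lambda-\nu',\mu'-\lambda')$ with $\nu,\mu\in\mathbb N[I]$ such that, modulo $4$ and for all $i\in I$, $\varkappa(\lambda,-\lambda')\equiv0$, $\varkappa(\zeta-i',\zeta')\equiv\varkappa(\zeta,\zeta')-\phi(i,\zeta')$ and $$\varkappa(\zeta,\zeta'+i')\equiv\varkappa(\zeta,\zeta')+\phi(i,\zeta)+2d_i+d_i\langle i,\zeta+\zeta'\rangle+2p(\nu)p(i).$$ 4. For every such $\varkappa$ there is a unique $\mathbb Q(\mathbf t)$-linear map $\mathfrak X_{\lambda,\lambda'}$ on $N(\lambda,\lambda')[\mathbf t]$ with $$\mathfrak X_{\lambda,\lambda'}(w\otimes w')=\mathbf t^{\varkappa(|w|,|w'|)}\,\mathfrak X_\lambda(w)\otimes\mathfrak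 X_{-\lambda'}(w')$$ for all $w,w'$ of weights $|w|=\lambda-\nu'$, $|w'|=\mu'-\lambda'$ with $\nu,\mu\in\mathbb N[I]$, and $$\mathfrak X_{\lambda,\lambda'}(\Delta(u)\,n)=\Delta(\mathfrak X(u))\,\mathfrak X_{\lambda,\lambda'}(n)\qquad\text{for all }u\in\widehat{\mathbf U},\ n\in N(\lambda,\lambda')[\mathbf t].$$ -/

import Mathlib

namespace QCov

open Polynomial TensorProduct
open scoped IntermediateField

noncomputable section

/-! ## Coefficients: `ℚ(t)` with `t² = -1`, and `ℚ^π(v,t) = ℚ(t)(v)[π]/(π² - 1)` -/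

/-- The field `ℚ(t)`, where `t` is a square root of `-1`. -/
def GaussQ : Type := ℚ⟮Complex.I⟯

instance : Field GaussQ := inferInstanceAs (Field ℚ⟮Complex.I⟯)

instance : CharZero GaussQ := inferInstanceAs (CharZero ℚ⟮Complex.I⟯)

/-- The chosen square root `t` of `-1`. -/
def tt : GaussQ := IntermediateField.AdjoinSimple.gen ℚ Complex.I

theorem tt_sq : tt ^ 2 = -1 := by
  apply Subtype.ext
  change (Complex.I) ^ 2 = -1
  exact Complex.I_sq

theorem tt_ne_zero : tt ≠ 0 := by
  intro h
  have := tt_sq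
  rw [h] at this
  norm_num at this

theorem tt_pow_four : tt ^ (4 : ℤ) = 1 := by
  have : tt ^ (4 : ℕ) = 1 := by
    rw [show (4 : ℕ) = 2 * 2 from rfl, pow_mul, tt_sq]; norm_num
  exact_mod_cast this

/-- `t ^ a` depends only on `a` modulo `4`. -/
theorem tt_zpow_congr {a b : ℤ} (h : a ≡ b [ZMOD 4]) : tt ^ a = tt ^ b := by
  obtain ⟨c, hc⟩ := h.dvd
  have : b = a + 4 * c := by omega
  rw [this, zpow_add₀ tt_ne_zero, zpow_mul, tt_pow_four, one_zpow, mul_one]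

/-- The ring `ℚ^π(v,t) = ℚ(t)(v)[π]/(π² - 1)`. -/
def Coeff : Type := AdjoinRoot (X ^ 2 - 1 : (RatFunc GaussQ)[X])

instance : CommRing Coeff :=
  inferInstanceAs (CommRing (AdjoinRoot (X ^ 2 - 1 : (RatFunc GaussQ)[X])))

instance : Algebra (RatFunc GaussQ) Coeff :=
  inferInstanceAs (Algebra (RatFunc GaussQ) (AdjoinRoot (X ^ 2 - 1 : (RatFunc GaussQ)[X])))

instance : Algebra GaussQ Coeff :=
  inferInstanceAs (Algebra GaussQ (AdjoinRoot (X ^ 2 - 1 : (RatFunc GaussQ)[X])))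

/-- The element `π`. -/
def piElt : Coeff := AdjoinRoot.root (X ^ 2 - 1 : (RatFunc GaussQ)[X])

theorem piElt_mul_self : piElt * piElt = 1 := by
  have h := AdjoinRoot.eval₂_root (X ^ 2 - 1 : (RatFunc GaussQ)[X])
  simp only [eval₂_sub, eval₂_X_pow, eval₂_one] at h
  rw [← pow_two]
  exact sub_eq_zero.mp h

/-- `π` as a unit. -/
def piU : Coeffˣ := ⟨piElt, piElt, piElt_mul_self, piElt_mul_self⟩

/-- `v` as a unit. -/
def vU : Coeffˣ :=
  Units.map (algebraMap (RatFunc GaussQ) Coeff).toMonoidHom (Units.mk0 RatFunc.X RatFunc.X_ne_zero)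

/-- `π ^ n`, for an integer `n`. -/
def piPow (n : ℤ) : Coeff := ((piU ^ n : Coeffˣ) : Coeff)

/-- `v ^ n`, for an integer `n`. -/
def vPow (n : ℤ) : Coeff := ((vU ^ n : Coeffˣ) : Coeff)

/-- `t ^ n`, for an integer `n`. -/
def tPow (n : ℤ) : Coeff := algebraMap GaussQ Coeff (tt ^ n)

theorem tPow_congr {a b : ℤ} (h : a ≡ b [ZMOD 4]) : tPow a = tPow b := by
  simp only [tPow, tt_zpow_congr h]

theorem tPow_add (a b : ℤ) : tPow (a + b) = tPow a * tPow b := by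
  simp only [tPow, zpow_add₀ tt_ne_zero, map_mul]

theorem tPow_zero : tPow 0 = 1 := by simp [tPow]

theorem piPow_add (a b : ℤ) : piPow (a + b) = piPow a * piPow b := by
  simp [piPow, zpow_add]

theorem piPow_even {a : ℤ} (h : Even a) : piPow a = 1 := by
  obtain ⟨b, rfl⟩ := h
  have h2 : piU * piU = 1 := Units.ext piElt_mul_self
  simp only [piPow, zpow_add, ← mul_zpow, h2, one_zpow, Units.val_one]

/-! ## Cartan data, root data, enhancers -/

/-- A bar-consistent anisotropic super Cartan datum with at least one odd index. The symmetric
bilinear form on `ℤ[I]` is given by its values `i · j` on the basis `I`. -/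
structure SuperCartanDatum (I : Type*) where
  form : I → I → ℤ
  form_symm : ∀ i j, form i j = form j i
  form_even : ∀ i, 2 ∣ form i i
  form_pos : ∀ i, 0 < form i i
  form_dvd : ∀ i j, i ≠ j → form i i ∣ 2 * form i j
  form_nonpos : ∀ i j, i ≠ j → 2 * form i j / form i i ≤ 0
  /-- the parity `p(i) ∈ {0, 1}` -/
  p : I → ℕ
  p_le : ∀ i, p i ≤ 1
  anisotropic : ∀ i j, p i = 1 → 2 ∣ 2 * form i j / form i i
  bar_consistent : ∀ i, form i i / 2 ≡ (p i : ℤ) [ZMOD 2]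
  exists_odd : ∃ i, p i = 1

namespace SuperCartanDatum

variable {I : Type*} (C : SuperCartanDatum I)

/-- `d_i = (i · i) / 2`. -/
def d (i : I) : ℤ := C.form i i / 2

/-- `a_{ij} = 2 (i · j) / (i · i)`. -/
def a (i j : I) : ℤ := 2 * C.form i j / C.form i i

/-- `b_{ij} = 1 - a_{ij}`. -/
def b (i j : I) : ℕ := (1 - C.a i j).toNat

/-- The parity of `ν = ∑ ν_i i ∈ ℕ[I]` (relevant only modulo `2`). -/
def parity (ν : I →₀ ℕ) : ℕ := ν.sum fun i n => n * C.p i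

theorem two_d (i : I) : 2 * C.d i = C.form i i := Int.mul_ediv_cancel' (C.form_even i)

theorem d_mul_a (i j : I) (h : i ≠ j) : C.d i * C.a i j = C.form i j := by
  have h1 : C.form i i * C.a i j = 2 * C.form i j := Int.mul_ediv_cancel' (C.form_dvd i j h)
  rw [← C.two_d i] at h1
  have : 2 * (C.d i * C.a i j) = 2 * C.form i j := by rw [← h1]; ring
  omega

theorem d_mul_a_self (i : I) : C.d i * C.a i i = 2 * C.d i := by
  have : C.a i i = 2 := Int.mul_ediv_cancel _ (C.form_pos i).ne'
  rw [this, mul_comm]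

/-- `i · j` is even. -/
theorem even_d_mul_a (i j : I) : Even (C.d i * C.a i j) := by
  have hd := C.bar_consistent i
  rcases Nat.le_one_iff_eq_zero_or_eq_one.mp (C.p_le i) with h | h
  · rw [h] at hd
    exact (Int.even_iff.mpr hd : Even (C.d i)).mul_right _
  · exact (even_iff_two_dvd.mpr (C.anisotropic i j h) : Even (C.a i j)).mul_left _

/-- The quantity `(π_i v_i)^l - v_i^{-l}`. -/
def qnum (i : I) (l : ℤ) : Coeff :=
  (((piU * vU) ^ (C.d i * l) : Coeffˣ) : Coeff) - ((vU ^ (-(C.d i * l)) : Coeffˣ) : Coeff)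

/-- The `(v,π)`-binomial coefficient `[n choose k]_{v_i,π_i}`. The denominator is a unit, by
`isUnit_qnum`. -/
def qbinom (i : I) (n k : ℕ) : Coeff :=
  (∏ s ∈ Finset.range k, C.qnum i ((n : ℤ) - s)) *
    Ring.inverse (∏ s ∈ Finset.range k, C.qnum i ((s : ℤ) + 1))

/-- The coefficient of the `k`-th term in the Serre relation for `i ≠ j`. -/
def serreCoeff (i j : I) (k : ℕ) : Coeff :=
  (-1) ^ k * piPow ((k.choose 2 * C.p i + k * C.p i * C.p j : ℕ) : ℤ) * C.qbinom i (C.b i j) k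

theorem isUnit_qnum (i : I) {l : ℤ} (hl : l ≠ 0) : IsUnit (C.qnum i l) := by
  set n : ℤ := C.d i * l with hn
  have hd : 0 < C.d i := by have := C.two_d i; have := C.form_pos i; omega
  have hn0 : n ≠ 0 := mul_ne_zero hd.ne' hl
  have h2 : piU * piU = 1 := Units.ext piElt_mul_self
  have key : C.qnum i l *
      ((((piU * vU) ^ n : Coeffˣ) : Coeff) + ((vU ^ (-n) : Coeffˣ) : Coeff)) =
      algebraMap (RatFunc GaussQ) Coeff (RatFunc.X ^ (2 * n) - RatFunc.X ^ (-(2 * n))) := by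
    have hv : ∀ m : ℤ, ((vU ^ m : Coeffˣ) : Coeff) =
        algebraMap (RatFunc GaussQ) Coeff (RatFunc.X ^ m) := by
      intro m
      simp only [vU, ← map_zpow, Units.coe_map]
      rw [Units.val_zpow_eq_zpow_val]
      rfl
    have e1 : (((piU * vU) ^ n : Coeffˣ) : Coeff) * (((piU * vU) ^ n : Coeffˣ) : Coeff) =
        ((vU ^ (2 * n) : Coeffˣ) : Coeff) := by
      rw [← Units.val_mul, ← mul_zpow, show piU * vU * (piU * vU) = vU * vU by
        rw [mul_mul_mul_comm, h2, one_mul], mul_zpow, ← zpow_add, two_mul]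
    have e2 : ((vU ^ (-n) : Coeffˣ) : Coeff) * ((vU ^ (-n) : Coeffˣ) : Coeff) =
        ((vU ^ (-(2 * n)) : Coeffˣ) : Coeff) := by
      rw [← Units.val_mul, ← zpow_add]; congr 2; ring
    rw [map_sub, ← hv, ← hv, ← e1, ← e2, qnum]
    ring
  have hne : (RatFunc.X ^ (2 * n) - RatFunc.X ^ (-(2 * n)) : RatFunc GaussQ) ≠ 0 := by
    intro h
    have h3 : (RatFunc.X : RatFunc GaussQ) ^ (2 * n) * RatFunc.X ^ (2 * n) = 1 := by
      calc (RatFunc.X : RatFunc GaussQ) ^ (2 * n) * RatFunc.X ^ (2 * n)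
          = RatFunc.X ^ (2 * n) * RatFunc.X ^ (-(2 * n)) := by rw [← sub_eq_zero.mp h]
        _ = 1 := by rw [← zpow_add₀ RatFunc.X_ne_zero]; simp
    rw [← zpow_add₀ RatFunc.X_ne_zero] at h3
    have h' := congrArg RatFunc.intDegree h3
    have hpow : ∀ m : ℕ, RatFunc.intDegree ((RatFunc.X : RatFunc GaussQ) ^ m) = m := by
      intro m
      rw [← RatFunc.algebraMap_X, ← map_pow, RatFunc.intDegree_polynomial]
      simp
    rcases Int.eq_nat_or_neg (2 * n + 2 * n) with ⟨m, hm | hm⟩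
    · rw [hm, zpow_natCast, hpow, RatFunc.intDegree_one] at h'
      omega
    · rw [hm, zpow_neg, zpow_natCast, RatFunc.intDegree_inv, hpow, RatFunc.intDegree_one] at h'
      omega
  exact isUnit_of_mul_isUnit_left (key ▸ (IsUnit.mk0 _ hne).map (algebraMap _ Coeff))

end SuperCartanDatum

/-- A root datum of the given type which is both `X`-regular and `Y`-regular. -/
structure RootDatum {I : Type*} (C : SuperCartanDatum I) (Y X : Type*)
    [AddCommGroup Y] [AddCommGroup X] where
  /-- the pairing `⟨·,·⟩ : Y × X → ℤ` -/
  pairing : Y →ₗ[ℤ] X →ₗ[ℤ] ℤ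
  perfect : pairing.IsPerfPair
  /-- the embedding `i ↦ i` of `I` in `Y` -/
  coroot : I → Y
  /-- the embedding `i ↦ i'` of `I` in `X` -/
  root : I → X
  pairing_eq : ∀ i j, pairing (coroot i) (root j) = C.a i j
  regularY : LinearIndependent ℤ coroot
  regularX : LinearIndependent ℤ root

namespace RootDatum

variable {I Y X : Type*} [AddCommGroup Y] [AddCommGroup X] {C : SuperCartanDatum I}
  (D : RootDatum C Y X)

/-- `ν ↦ ν'` on `ℤ[I]`. -/
def wt (ν : I →₀ ℤ) : X := Finsupp.linearCombination ℤ D.root ν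

/-- `ν ↦ ν'` on `ℕ[I]`. -/
def wtN (ν : I →₀ ℕ) : X := Finsupp.linearCombination ℕ D.root ν

/-- `n · ĩ = n d_i i ∈ Y`. -/
def til (n : ℤ) (i : I) : Y := (n * C.d i) • D.coroot i

/-- `λ ∈ X⁺`. -/
def IsDominant (l : X) : Prop := ∀ i, 0 ≤ D.pairing (D.coroot i) l

end RootDatum

/-- An enhancer `φ : ℤ[I] × X → ℤ`. -/
structure Enhancer {I Y X : Type*} [AddCommGroup Y] [AddCommGroup X] {C : SuperCartanDatum I}
    (D : RootDatum C Y X) where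
  phi : (I →₀ ℤ) → X → ℤ
  add_right : ∀ ν l μ, phi ν (l + D.wt μ) ≡ phi ν (D.wt μ) + phi ν l [ZMOD 4]
  add_left : ∀ ν μ l, phi (ν + μ) l ≡ phi ν l + phi μ l [ZMOD 4]
  even_root : ∀ i j, i ≠ j → 2 ∣ phi (Finsupp.single i 1) (D.root j)
  skew : ∀ i j, i ≠ j → phi (Finsupp.single i 1) (D.root j) - phi (Finsupp.single j 1) (D.root i) ≡
    C.form i j + 2 * C.p i * C.p j [ZMOD 4]
  self : ∀ i, phi (Finsupp.single i 1) (D.root i) ≡ C.d i [ZMOD 4]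

/-! ## The enhanced quantum covering group -/

/-- The generators `E_i`, `F_i`, `K_μ`, `J_μ`, `T_μ` (`μ ∈ Y`) and `Υ_ν` (`ν ∈ ℤ[I]`). -/
inductive Gen (I Y : Type*)
  | E (i : I)
  | F (i : I)
  | K (μ : Y)
  | J (μ : Y)
  | T (μ : Y)
  | Ups (ν : I →₀ ℤ)

section Algebra

variable {I Y X : Type*} [AddCommGroup Y] [AddCommGroup X] {C : SuperCartanDatum I}
  {D : RootDatum C Y X} (φ : Enhancer D)

/-- A generator in the free algebra. -/
abbrev fg {I Y : Type*} (g : Gen I Y) : FreeAlgebra Coeff (Gen I Y) := FreeAlgebra.ι Coeff g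

open Gen in
/-- The defining relations of the enhanced quantum covering group. -/
inductive Rel : FreeAlgebra Coeff (Gen I Y) → FreeAlgebra Coeff (Gen I Y) → Prop
  | J_add (μ ν : Y) : Rel (fg (J μ) * fg (J ν)) (fg (J (μ + ν)))
  | K_add (μ ν : Y) : Rel (fg (K μ) * fg (K ν)) (fg (K (μ + ν)))
  | K_zero : Rel (fg (K 0)) 1
  | J_zero : Rel (fg (J 0)) 1
  | J_sq (μ : Y) : Rel (fg (J μ) ^ 2) 1
  | J_K (μ ν : Y) : Rel (fg (J μ) * fg (K ν)) (fg (K ν) * fg (J μ))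
  | J_E (μ : Y) (i : I) : Rel (fg (J μ) * fg (E i))
      (piPow (D.pairing μ (D.root i)) • (fg (E i) * fg (J μ)))
  | J_F (μ : Y) (i : I) : Rel (fg (J μ) * fg (F i))
      (piPow (-D.pairing μ (D.root i)) • (fg (F i) * fg (J μ)))
  | K_E (μ : Y) (i : I) : Rel (fg (K μ) * fg (E i))
      (vPow (D.pairing μ (D.root i)) • (fg (E i) * fg (K μ)))
  | K_F (μ : Y) (i : I) : Rel (fg (K μ) * fg (F i))
      (vPow (-D.pairing μ (D.root i)) • (fg (F i) * fg (K μ)))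
  | E_F_self (i : I) : Rel (fg (E i) * fg (F i) - piPow (C.p i * C.p i) • (fg (F i) * fg (E i)))
      (Ring.inverse (C.qnum i 1) •
        (fg (J (D.til 1 i)) * fg (K (D.til 1 i)) - fg (K (D.til (-1) i))))
  | E_F (i j : I) : i ≠ j →
      Rel (fg (E i) * fg (F j) - piPow (C.p i * C.p j) • (fg (F j) * fg (E i))) 0
  | E_serre (i j : I) : i ≠ j →
      Rel (∑ k ∈ Finset.range (C.b i j + 1),
        C.serreCoeff i j k • (fg (E i) ^ (C.b i j - k) * fg (E j) * fg (E i) ^ k)) 0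
  | F_serre (i j : I) : i ≠ j →
      Rel (∑ k ∈ Finset.range (C.b i j + 1),
        C.serreCoeff i j k • (fg (F i) ^ (C.b i j - k) * fg (F j) * fg (F i) ^ k)) 0
  | T_add (μ ν : Y) : Rel (fg (T μ) * fg (T ν)) (fg (T (μ + ν)))
  | Ups_add (μ ν : I →₀ ℤ) : Rel (fg (Ups μ) * fg (Ups ν)) (fg (Ups (μ + ν)))
  | T_zero : Rel (fg (T 0)) 1
  | Ups_zero : Rel (fg (Ups 0)) 1
  | T_four (μ : Y) : Rel (fg (T μ) ^ 4) 1
  | Ups_four (ν : I →₀ ℤ) : Rel (fg (Ups ν) ^ 4) 1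
  | T_Ups (μ : Y) (ν : I →₀ ℤ) : Rel (fg (T μ) * fg (Ups ν)) (fg (Ups ν) * fg (T μ))
  | T_K (μ ν : Y) : Rel (fg (T μ) * fg (K ν)) (fg (K ν) * fg (T μ))
  | T_J (μ ν : Y) : Rel (fg (T μ) * fg (J ν)) (fg (J ν) * fg (T μ))
  | Ups_K (μ : I →₀ ℤ) (ν : Y) : Rel (fg (Ups μ) * fg (K ν)) (fg (K ν) * fg (Ups μ))
  | Ups_J (μ : I →₀ ℤ) (ν : Y) : Rel (fg (Ups μ) * fg (J ν)) (fg (J ν) * fg (Ups μ))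
  | T_E (μ : Y) (i : I) : Rel (fg (T μ) * fg (E i))
      (tPow (D.pairing μ (D.root i)) • (fg (E i) * fg (T μ)))
  | T_F (μ : Y) (i : I) : Rel (fg (T μ) * fg (F i))
      (tPow (-D.pairing μ (D.root i)) • (fg (F i) * fg (T μ)))
  | Ups_E (ν : I →₀ ℤ) (i : I) : Rel (fg (Ups ν) * fg (E i))
      (tPow (φ.phi ν (D.root i)) • (fg (E i) * fg (Ups ν)))
  | Ups_F (ν : I →₀ ℤ) (i : I) : Rel (fg (Ups ν) * fg (F i))
      (tPow (-φ.phi ν (D.root i)) • (fg (F i) * fg (Ups ν)))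

/-- The `φ`-enhanced quantum covering group `Û`, an algebra over `ℚ^π(v,t)`. -/
def EnhU : Type _ := RingQuot (Rel φ)

instance : Ring (EnhU φ) := inferInstanceAs (Ring (RingQuot (Rel φ)))

instance : Algebra Coeff (EnhU φ) := inferInstanceAs (Algebra Coeff (RingQuot (Rel φ)))

instance : Algebra GaussQ (EnhU φ) := inferInstanceAs (Algebra GaussQ (RingQuot (Rel φ)))

instance : IsScalarTower GaussQ Coeff (EnhU φ) :=
  inferInstanceAs (IsScalarTower GaussQ Coeff (RingQuot (Rel φ)))

/-- The quotient map from the free algebra. -/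
def toU : FreeAlgebra Coeff (Gen I Y) →ₐ[Coeff] EnhU φ := RingQuot.mkAlgHom Coeff (Rel φ)

theorem toU_rel {x y : FreeAlgebra Coeff (Gen I Y)} (h : Rel φ x y) : toU φ x = toU φ y :=
  RingQuot.mkAlgHom_rel Coeff h

/-- The class of a generator. -/
def gen (g : Gen I Y) : EnhU φ := toU φ (fg g)

/-- An algebra map out of `Û` from values on generators which respect the relations. -/
def liftU {A : Type*} [Ring A] [Algebra Coeff A] (f : Gen I Y → A)
    (h : ∀ ⦃x y⦄, Rel φ x y → FreeAlgebra.lift Coeff f x = FreeAlgebra.lift Coeff f y) :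
    EnhU φ →ₐ[Coeff] A :=
  RingQuot.liftAlgHom Coeff ⟨FreeAlgebra.lift Coeff f, h⟩

theorem liftU_gen {A : Type*} [Ring A] [Algebra Coeff A] (f : Gen I Y → A)
    (h : ∀ ⦃x y⦄, Rel φ x y → FreeAlgebra.lift Coeff f x = FreeAlgebra.lift Coeff f y)
    (g : Gen I Y) : liftU φ f h (gen φ g) = f g := by
  have := RingQuot.liftAlgHom_mkAlgHom_apply Coeff (FreeAlgebra.lift Coeff f) h (fg g)
  rw [FreeAlgebra.lift_ι_apply] at this
  exact this

theorem algHom_ext {A : Type*} [Ring A] [Algebra Coeff A] {f g : EnhU φ →ₐ[Coeff] A}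
    (h : ∀ x, f (gen φ x) = g (gen φ x)) : f = g := by
  apply RingQuot.ringQuot_ext' Coeff
  apply FreeAlgebra.hom_ext
  funext x
  exact h x

/-! Names for the generators of `Û` and the elements `K̃`, `J̃`, `T̃`, `Υ_i`. -/

abbrev uE (i : I) : EnhU φ := gen φ (Gen.E i)
abbrev uF (i : I) : EnhU φ := gen φ (Gen.F i)
abbrev uK (μ : Y) : EnhU φ := gen φ (Gen.K μ)
abbrev uJ (μ : Y) : EnhU φ := gen φ (Gen.J μ)
abbrev uT (μ : Y) : EnhU φ := gen φ (Gen.T μ)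
abbrev uUps (ν : I →₀ ℤ) : EnhU φ := gen φ (Gen.Ups ν)

/-- `K̃_{n i}`, `J̃_{n i}`, `T̃_{n i}`, `Υ_{n i}` for an integer `n` and `i ∈ I`. -/
abbrev uKt (n : ℤ) (i : I) : EnhU φ := uK φ (D.til n i)
abbrev uJt (n : ℤ) (i : I) : EnhU φ := uJ φ (D.til n i)
abbrev uTt (n : ℤ) (i : I) : EnhU φ := uT φ (D.til n i)
abbrev uUpsi (n : ℤ) (i : I) : EnhU φ := uUps φ (Finsupp.single i n)

section Relations

theorem J_add (μ ν : Y) : uJ φ μ * uJ φ ν = uJ φ (μ + ν) := by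
  simpa [gen] using toU_rel φ (Rel.J_add μ ν)

theorem K_add (μ ν : Y) : uK φ μ * uK φ ν = uK φ (μ + ν) := by
  simpa [gen] using toU_rel φ (Rel.K_add μ ν)

theorem K_zero : uK φ 0 = 1 := by simpa [gen] using toU_rel φ Rel.K_zero

theorem J_zero : uJ φ 0 = 1 := by simpa [gen] using toU_rel φ Rel.J_zero

theorem J_sq (μ : Y) : uJ φ μ ^ 2 = 1 := by simpa [gen] using toU_rel φ (Rel.J_sq μ)

theorem J_K (μ ν : Y) : uJ φ μ * uK φ ν = uK φ ν * uJ φ μ := by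
  simpa [gen] using toU_rel φ (Rel.J_K μ ν)

theorem J_E (μ : Y) (i : I) :
    uJ φ μ * uE φ i = piPow (D.pairing μ (D.root i)) • (uE φ i * uJ φ μ) := by
  simpa [gen] using toU_rel φ (Rel.J_E μ i)

theorem J_F (μ : Y) (i : I) :
    uJ φ μ * uF φ i = piPow (-D.pairing μ (D.root i)) • (uF φ i * uJ φ μ) := by
  simpa [gen] using toU_rel φ (Rel.J_F μ i)

theorem K_E (μ : Y) (i : I) :
    uK φ μ * uE φ i = vPow (D.pairing μ (D.root i)) • (uE φ i * uK φ μ) := by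
  simpa [gen] using toU_rel φ (Rel.K_E μ i)

theorem K_F (μ : Y) (i : I) :
    uK φ μ * uF φ i = vPow (-D.pairing μ (D.root i)) • (uF φ i * uK φ μ) := by
  simpa [gen] using toU_rel φ (Rel.K_F μ i)

theorem E_F_self (i : I) :
    uE φ i * uF φ i - piPow (C.p i * C.p i) • (uF φ i * uE φ i) =
      Ring.inverse (C.qnum i 1) • (uJt φ 1 i * uKt φ 1 i - uKt φ (-1) i) := by
  simpa [gen] using toU_rel φ (Rel.E_F_self i)

theorem E_F (i j : I) (h : i ≠ j) :
    uE φ i * uF φ j - piPow (C.p i * C.p j) • (uF φ j * uE φ i) = 0 := by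
  simpa [gen] using toU_rel φ (Rel.E_F i j h)

theorem E_serre (i j : I) (h : i ≠ j) :
    ∑ k ∈ Finset.range (C.b i j + 1),
      C.serreCoeff i j k • (uE φ i ^ (C.b i j - k) * uE φ j * uE φ i ^ k) = 0 := by
  simpa [gen] using toU_rel φ (Rel.E_serre i j h)

theorem F_serre (i j : I) (h : i ≠ j) :
    ∑ k ∈ Finset.range (C.b i j + 1),
      C.serreCoeff i j k • (uF φ i ^ (C.b i j - k) * uF φ j * uF φ i ^ k) = 0 := by
  simpa [gen] using toU_rel φ (Rel.F_serre i j h)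

theorem T_add (μ ν : Y) : uT φ μ * uT φ ν = uT φ (μ + ν) := by
  simpa [gen] using toU_rel φ (Rel.T_add μ ν)

theorem Ups_add (μ ν : I →₀ ℤ) : uUps φ μ * uUps φ ν = uUps φ (μ + ν) := by
  simpa [gen] using toU_rel φ (Rel.Ups_add μ ν)

theorem T_zero : uT φ 0 = 1 := by simpa [gen] using toU_rel φ Rel.T_zero

theorem Ups_zero : uUps φ 0 = 1 := by simpa [gen] using toU_rel φ Rel.Ups_zero

theorem T_four (μ : Y) : uT φ μ ^ 4 = 1 := by simpa [gen] using toU_rel φ (Rel.T_four μ)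

theorem Ups_four (ν : I →₀ ℤ) : uUps φ ν ^ 4 = 1 := by
  simpa [gen] using toU_rel φ (Rel.Ups_four ν)

theorem T_Ups (μ : Y) (ν : I →₀ ℤ) : uT φ μ * uUps φ ν = uUps φ ν * uT φ μ := by
  simpa [gen] using toU_rel φ (Rel.T_Ups μ ν)

theorem T_K (μ ν : Y) : uT φ μ * uK φ ν = uK φ ν * uT φ μ := by
  simpa [gen] using toU_rel φ (Rel.T_K μ ν)

theorem T_J (μ ν : Y) : uT φ μ * uJ φ ν = uJ φ ν * uT φ μ := by
  simpa [gen] using toU_rel φ (Rel.T_J μ ν)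

theorem Ups_K (μ : I →₀ ℤ) (ν : Y) : uUps φ μ * uK φ ν = uK φ ν * uUps φ μ := by
  simpa [gen] using toU_rel φ (Rel.Ups_K μ ν)

theorem Ups_J (μ : I →₀ ℤ) (ν : Y) : uUps φ μ * uJ φ ν = uJ φ ν * uUps φ μ := by
  simpa [gen] using toU_rel φ (Rel.Ups_J μ ν)

theorem T_E (μ : Y) (i : I) :
    uT φ μ * uE φ i = tPow (D.pairing μ (D.root i)) • (uE φ i * uT φ μ) := by
  simpa [gen] using toU_rel φ (Rel.T_E μ i)

theorem T_F (μ : Y) (i : I) :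
    uT φ μ * uF φ i = tPow (-D.pairing μ (D.root i)) • (uF φ i * uT φ μ) := by
  simpa [gen] using toU_rel φ (Rel.T_F μ i)

theorem Ups_E (ν : I →₀ ℤ) (i : I) :
    uUps φ ν * uE φ i = tPow (φ.phi ν (D.root i)) • (uE φ i * uUps φ ν) := by
  simpa [gen] using toU_rel φ (Rel.Ups_E ν i)

theorem Ups_F (ν : I →₀ ℤ) (i : I) :
    uUps φ ν * uF φ i = tPow (-φ.phi ν (D.root i)) • (uF φ i * uUps φ ν) := by
  simpa [gen] using toU_rel φ (Rel.Ups_F ν i)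

end Relations

section Phi

theorem phi_zero (l : X) : φ.phi 0 l ≡ 0 [ZMOD 4] := by
  have h := φ.add_left 0 0 l
  rw [add_zero] at h
  have h2 := Int.ModEq.sub_right (φ.phi 0 l) h
  simpa using h2.symm

theorem phi_neg (ν : I →₀ ℤ) (l : X) : φ.phi (-ν) l ≡ -φ.phi ν l [ZMOD 4] := by
  have h := φ.add_left ν (-ν) l
  rw [add_neg_cancel] at h
  have h2 := Int.ModEq.sub_right (φ.phi ν l) (h.symm.trans (phi_zero φ l))
  simpa using h2

end Phi

/-! ## The automorphism `ω` and its extension to `Û` -/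

theorem pairing_til (n : ℤ) (i j : I) :
    D.pairing (D.til n i) (D.root j) = n * (C.d i * C.a i j) := by
  simp [RootDatum.til, D.pairing_eq, mul_assoc]

theorem til_neg (n : ℤ) (i : I) : D.til (-n) i = -D.til n i := by
  simp [RootDatum.til]

theorem Jt_E (n : ℤ) (i j : I) : Commute (uJt φ n i) (uE φ j) := by
  have h := J_E φ (D.til n i) j
  rw [pairing_til, piPow_even ((C.even_d_mul_a i j).mul_left n), one_smul] at h
  exact h

theorem Jt_F (n : ℤ) (i j : I) : Commute (uJt φ n i) (uF φ j) := by
  have h := J_F φ (D.til n i) j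
  rw [pairing_til, piPow_even ((C.even_d_mul_a i j).mul_left n).neg, one_smul] at h
  exact h

theorem J_J (μ ν : Y) : Commute (uJ φ μ) (uJ φ ν) := by
  rw [Commute, SemiconjBy, J_add, J_add, add_comm]

/-- The element `π_i J̃_i`. -/
def cElt (i : I) : EnhU φ := piPow (C.d i) • uJt φ 1 i

theorem cElt_E (i j : I) : Commute (cElt φ i) (uE φ j) := (Jt_E φ 1 i j).smul_left _

theorem cElt_F (i j : I) : Commute (cElt φ i) (uF φ j) := (Jt_F φ 1 i j).smul_left _

theorem cElt_cElt (i j : I) : Commute (cElt φ i) (cElt φ j) :=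
  ((J_J φ _ _).smul_left _).smul_right _

theorem piPow_self (a : ℤ) : piPow a * piPow a = 1 := by
  rw [← piPow_add, piPow_even ⟨a, rfl⟩]

theorem cElt_sq (i : I) : cElt φ i * cElt φ i = 1 := by
  rw [cElt, smul_mul_smul_comm, piPow_self, ← pow_two, J_sq, one_smul]

open Gen in
/-- The values of `ω` on generators. -/
def omegaGen : Gen I Y → EnhU φ
  | E i => uF φ i
  | F i => piPow (C.d i) • (uJt φ 1 i * uE φ i)
  | K μ => uK φ (-μ)
  | J μ => uJ φ μ
  | T μ => uT φ (-μ)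
  | Ups ν => uUps φ (-ν)

theorem omegaGen_F (i : I) : omegaGen φ (Gen.F i) = cElt φ i * uE φ i := by
  simp [omegaGen, cElt]

theorem comm_helper {c g e : EnhU φ} {s : Coeff} (hc : Commute g c) (h : g * e = s • (e * g)) :
    g * (c * e) = s • (c * e * g) := by
  rw [← mul_assoc, hc.eq, mul_assoc, h, mul_smul_comm, mul_assoc]

theorem pi_parity (i : I) : piPow (C.d i) * piPow ((C.p i : ℤ) * C.p i) = 1 := by
  rw [← piPow_add]
  apply piPow_even
  have hd : C.d i ≡ (C.p i : ℤ) [ZMOD 2] := C.bar_consistent i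
  have hd' : C.d i % 2 = (C.p i : ℤ) % 2 := hd
  rw [Int.even_iff]
  rcases Nat.le_one_iff_eq_zero_or_eq_one.mp (C.p_le i) with h | h <;> rw [h] at hd' ⊢ <;>
    simp at hd' ⊢ <;> omega

theorem omega_rel ⦃x y : FreeAlgebra Coeff (Gen I Y)⦄ (h : Rel φ x y) :
    FreeAlgebra.lift Coeff (omegaGen φ) x = FreeAlgebra.lift Coeff (omegaGen φ) y := by
  have hF := omegaGen_F φ
  induction h with
  | J_add μ ν => simp only [map_mul, FreeAlgebra.lift_ι_apply, omegaGen, J_add]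
  | K_add μ ν => simp only [map_mul, FreeAlgebra.lift_ι_apply, omegaGen, K_add, neg_add]
  | K_zero => simp only [map_one, FreeAlgebra.lift_ι_apply, omegaGen, neg_zero, K_zero]
  | J_zero => simp only [map_one, FreeAlgebra.lift_ι_apply, omegaGen, J_zero]
  | J_sq μ => simp only [map_pow, map_one, FreeAlgebra.lift_ι_apply, omegaGen, J_sq]
  | J_K μ ν => simp only [map_mul, FreeAlgebra.lift_ι_apply, omegaGen, J_K]
  | J_E μ i =>
    simp only [map_mul, map_smul, FreeAlgebra.lift_ι_apply, omegaGen, J_F]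
    rw [show piPow (-D.pairing μ (D.root i)) = piPow (D.pairing μ (D.root i)) by
      rw [← one_mul (piPow (-_)), ← piPow_self (D.pairing μ (D.root i)), mul_assoc, ← piPow_add,
        add_neg_cancel, piPow_even Even.zero, mul_one]]
  | J_F μ i =>
    simp only [map_mul, map_smul, FreeAlgebra.lift_ι_apply, hF]
    rw [show piPow (-D.pairing μ (D.root i)) = piPow (D.pairing μ (D.root i)) by
      rw [← one_mul (piPow (-_)), ← piPow_self (D.pairing μ (D.root i)), mul_assoc, ← piPow_add,
        add_neg_cancel, piPow_even Even.zero, mul_one]]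
    exact comm_helper φ ((J_J φ _ _).smul_right _) (J_E φ μ i)
  | K_E μ i =>
    simp only [map_mul, map_smul, FreeAlgebra.lift_ι_apply, omegaGen, K_F, map_neg,
      LinearMap.neg_apply, neg_neg]
  | K_F μ i =>
    simp only [map_mul, map_smul, FreeAlgebra.lift_ι_apply, hF]
    refine comm_helper φ (Commute.smul_right (J_K φ _ _).symm _) ?_
    have := K_E φ (-μ) i
    simp only [map_neg, LinearMap.neg_apply] at this
    exact this
  | E_F_self i =>
    simp only [map_mul, map_smul, map_sub, FreeAlgebra.lift_ι_apply, hF]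
    simp only [omegaGen]
    have h1 : uF φ i * (cElt φ i * uE φ i) = cElt φ i * (uF φ i * uE φ i) := by
      rw [← mul_assoc, ← (cElt_F φ i i).eq, mul_assoc]
    rw [h1, mul_assoc, ← mul_smul_comm, ← mul_sub]
    have h2 : uF φ i * uE φ i - piPow (C.p i * C.p i) • (uE φ i * uF φ i) =
        -(piPow (C.p i * C.p i) • (Ring.inverse (C.qnum i 1) •
          (uJt φ 1 i * uKt φ 1 i - uKt φ (-1) i))) := by
      rw [← E_F_self, smul_sub, smul_smul, piPow_self, one_smul]
      abel
    rw [h2, cElt, mul_neg, smul_mul_smul_comm, pi_parity, one_smul, mul_smul_comm, ← smul_neg,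
      mul_sub, ← mul_assoc, ← pow_two, J_sq, one_mul, neg_sub]
    simp only [uKt, uJt, til_neg, neg_neg]
  | E_F i j hij =>
    simp only [map_mul, map_smul, map_sub, map_zero, FreeAlgebra.lift_ι_apply, hF]
    simp only [omegaGen]
    have h1 : uF φ i * (cElt φ j * uE φ j) = cElt φ j * (uF φ i * uE φ j) := by
      rw [← mul_assoc, ← (cElt_F φ j i).eq, mul_assoc]
    rw [h1, mul_assoc, ← mul_smul_comm, ← mul_sub]
    have h2 : uF φ i * uE φ j - piPow (C.p i * C.p j) • (uE φ j * uF φ i) =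
        -(piPow (C.p i * C.p j) • (uE φ j * uF φ i - piPow (C.p j * C.p i) • (uF φ i * uE φ j))) := by
      rw [smul_sub, smul_smul, mul_comm (C.p j : ℤ), piPow_self, one_smul]
      abel
    rw [h2, E_F φ j i hij.symm, smul_zero, neg_zero, mul_zero]
  | E_serre i j hij =>
    simp only [map_mul, map_smul, map_sum, map_pow, map_zero, FreeAlgebra.lift_ι_apply]
    exact F_serre φ i j hij
  | F_serre i j hij =>
    simp only [map_mul, map_smul, map_sum, map_pow, map_zero, FreeAlgebra.lift_ι_apply, hF]
    have key : ∀ k ∈ Finset.range (C.b i j + 1),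
        C.serreCoeff i j k • ((cElt φ i * uE φ i) ^ (C.b i j - k) * (cElt φ j * uE φ j) *
          (cElt φ i * uE φ i) ^ k) =
        (cElt φ i ^ C.b i j * cElt φ j) *
          (C.serreCoeff i j k • (uE φ i ^ (C.b i j - k) * uE φ j * uE φ i ^ k)) := by
      intro k hk
      have hk' : C.b i j = (C.b i j - k) + k := by
        have := Finset.mem_range.mp hk; omega
      rw [mul_smul_comm]
      congr 1
      rw [(cElt_E φ i i).mul_pow, (cElt_E φ i i).mul_pow]
      conv_rhs => rw [hk', pow_add]
      have c1 := ((cElt_E φ i i).pow_left k).pow_right (C.b i j - k)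
      have c2 := ((cElt_E φ i j).pow_left k)
      have c3 := (cElt_cElt φ i j).pow_left k
      have c4 := (cElt_E φ j i).pow_right (C.b i j - k)
      simp only [Nat.add_sub_cancel]
      generalize cElt φ i ^ (C.b i j - k) = A at *
      generalize cElt φ i ^ k = B at *
      generalize uE φ i ^ (C.b i j - k) = P at *
      generalize uE φ i ^ k = Q at *
      calc A * P * (cElt φ j * uE φ j) * (B * Q)
          = A * (P * cElt φ j) * (uE φ j * B) * Q := by simp only [mul_assoc]
        _ = A * (cElt φ j * P) * (B * uE φ j) * Q := by rw [c4.eq, c2.eq]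
        _ = A * cElt φ j * (P * B) * uE φ j * Q := by simp only [mul_assoc]
        _ = A * (cElt φ j * B) * P * uE φ j * Q := by rw [← c1.eq]; simp only [mul_assoc]
        _ = A * B * cElt φ j * (P * uE φ j * Q) := by rw [← c3.eq]; simp only [mul_assoc]
    rw [Finset.sum_congr rfl key, ← Finset.mul_sum, E_serre φ i j hij, mul_zero]
  | T_add μ ν => simp only [map_mul, FreeAlgebra.lift_ι_apply, omegaGen, T_add, neg_add]
  | Ups_add μ ν => simp only [map_mul, FreeAlgebra.lift_ι_apply, omegaGen, Ups_add, neg_add]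
  | T_zero => simp only [map_one, FreeAlgebra.lift_ι_apply, omegaGen, neg_zero, T_zero]
  | Ups_zero => simp only [map_one, FreeAlgebra.lift_ι_apply, omegaGen, neg_zero, Ups_zero]
  | T_four μ => simp only [map_pow, map_one, FreeAlgebra.lift_ι_apply, omegaGen, T_four]
  | Ups_four μ => simp only [map_pow, map_one, FreeAlgebra.lift_ι_apply, omegaGen, Ups_four]
  | T_Ups μ ν => simp only [map_mul, FreeAlgebra.lift_ι_apply, omegaGen, T_Ups]
  | T_K μ ν => simp only [map_mul, FreeAlgebra.lift_ι_apply, omegaGen, T_K]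
  | T_J μ ν => simp only [map_mul, FreeAlgebra.lift_ι_apply, omegaGen, T_J]
  | Ups_K μ ν => simp only [map_mul, FreeAlgebra.lift_ι_apply, omegaGen, Ups_K]
  | Ups_J μ ν => simp only [map_mul, FreeAlgebra.lift_ι_apply, omegaGen, Ups_J]
  | T_E μ i =>
    simp only [map_mul, map_smul, FreeAlgebra.lift_ι_apply, omegaGen, T_F, map_neg,
      LinearMap.neg_apply, neg_neg]
  | T_F μ i =>
    simp only [map_mul, map_smul, FreeAlgebra.lift_ι_apply, hF]
    refine comm_helper φ (Commute.smul_right (T_J φ _ _) _) ?_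
    have := T_E φ (-μ) i
    simp only [map_neg, LinearMap.neg_apply] at this
    exact this
  | Ups_E ν i =>
    simp only [map_mul, map_smul, FreeAlgebra.lift_ι_apply, omegaGen, Ups_F]
    rw [tPow_congr (by simpa using (phi_neg φ ν (D.root i)).neg)]
  | Ups_F ν i =>
    simp only [map_mul, map_smul, FreeAlgebra.lift_ι_apply, hF]
    refine comm_helper φ (Commute.smul_right (Ups_J φ _ _) _) ?_
    have := Ups_E φ (-ν) i
    rwa [tPow_congr (phi_neg φ ν (D.root i))] at this

/-- `ω` as an algebra endomorphism. -/
def omegaHom : EnhU φ →ₐ[Coeff] EnhU φ := liftU φ (omegaGen φ) (omega_rel φ)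

theorem omegaHom_gen (g : Gen I Y) : omegaHom φ (gen φ g) = omegaGen φ g := liftU_gen φ _ _ g

theorem omegaHom_cElt (i : I) : omegaHom φ (cElt φ i) = cElt φ i := by
  simp only [cElt, map_smul, omegaHom_gen, omegaGen]

theorem omegaHom_four :
    (omegaHom φ).comp ((omegaHom φ).comp ((omegaHom φ).comp (omegaHom φ))) = AlgHom.id _ _ := by
  apply algHom_ext
  intro x
  have hF : ∀ i, omegaHom φ (uF φ i) = cElt φ i * uE φ i := fun i => by
    rw [omegaHom_gen, omegaGen_F]
  have hE : ∀ i, omegaHom φ (uE φ i) = uF φ i := fun i => by rw [omegaHom_gen]; rfl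
  have hc := cElt_sq φ
  simp only [AlgHom.comp_apply, AlgHom.id_apply]
  cases x with
  | E i => rw [hE, hF, map_mul, omegaHom_cElt, hE, map_mul, omegaHom_cElt, hF, ← mul_assoc, hc,
      one_mul]
  | F i => rw [hF, map_mul, omegaHom_cElt, hE, map_mul, omegaHom_cElt, hF, ← mul_assoc, hc,
      one_mul, hE]
  | K μ => simp only [omegaHom_gen, omegaGen, neg_neg]
  | J μ => simp only [omegaHom_gen, omegaGen]
  | T μ => simp only [omegaHom_gen, omegaGen, neg_neg]
  | Ups μ => simp only [omegaHom_gen, omegaGen, neg_neg]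

/-- The automorphism `ω` of `Û`: `ω(E_i) = F_i`, `ω(F_i) = π_i J̃_i E_i`, `ω(K_ν) = K_{-ν}`,
`ω(J_ν) = J_ν`, extended by `ω(T_ν) = T_{-ν}` and `ω(Υ_ν) = Υ_{-ν}`. -/
def omega : EnhU φ ≃ₐ[Coeff] EnhU φ :=
  AlgEquiv.ofAlgHom (omegaHom φ) ((omegaHom φ).comp ((omegaHom φ).comp (omegaHom φ)))
    (omegaHom_four φ) (by
      rw [AlgHom.comp_assoc, AlgHom.comp_assoc]
      exact omegaHom_four φ)

theorem omega_gen (g : Gen I Y) : omega φ (gen φ g) = omegaGen φ g := omegaHom_gen φ g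

/-! ## The `ℤ/2`-grading -/

/-- The values on generators of the automorphism `x ↦ (-1)^{p(x)} x`. -/
def signGen : Gen I Y → EnhU φ
  | Gen.E i => (-1 : Coeff) ^ C.p i • uE φ i
  | Gen.F i => (-1 : Coeff) ^ C.p i • uF φ i
  | g => gen φ g

theorem sign_helper {g e : EnhU φ} {s c : Coeff} (h : g * e = s • (e * g)) :
    g * (c • e) = s • (c • e * g) := by
  rw [mul_smul_comm, h, smul_mul_assoc, smul_comm]

theorem sign_serre (e f : EnhU φ) (x y : Coeff) (n : ℕ) (w : ℕ → Coeff)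
    (h : ∑ k ∈ Finset.range (n + 1), w k • (e ^ (n - k) * f * e ^ k) = 0) :
    ∑ k ∈ Finset.range (n + 1), w k • ((x • e) ^ (n - k) * (y • f) * (x • e) ^ k) = 0 := by
  have key : ∀ k ∈ Finset.range (n + 1),
      w k • ((x • e) ^ (n - k) * (y • f) * (x • e) ^ k) =
      (x ^ n * y) • (w k • (e ^ (n - k) * f * e ^ k)) := by
    intro k hk
    have hk' : n = (n - k) + k := by have := Finset.mem_range.mp hk; omega
    rw [smul_comm _ (w k)]
    congr 1
    rw [_root_.smul_pow, _root_.smul_pow, smul_mul_smul_comm, smul_mul_smul_comm]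
    congr 1
    conv_rhs => rw [hk', pow_add]
    ring
  rw [Finset.sum_congr rfl key, ← Finset.smul_sum, h, smul_zero]

theorem sign_rel ⦃x y : FreeAlgebra Coeff (Gen I Y)⦄ (h : Rel φ x y) :
    FreeAlgebra.lift Coeff (signGen φ) x = FreeAlgebra.lift Coeff (signGen φ) y := by
  induction h with
  | E_serre i j hij =>
    simp only [map_mul, map_smul, map_sum, map_pow, map_zero, FreeAlgebra.lift_ι_apply, signGen]
    exact sign_serre φ _ _ _ _ _ _ (E_serre φ i j hij)
  | F_serre i j hij =>
    simp only [map_mul, map_smul, map_sum, map_pow, map_zero, FreeAlgebra.lift_ι_apply, signGen]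
    exact sign_serre φ _ _ _ _ _ _ (F_serre φ i j hij)
  | E_F_self i =>
    simp only [map_mul, map_smul, map_sub, FreeAlgebra.lift_ι_apply, signGen]
    rw [smul_mul_smul_comm, smul_mul_smul_comm, ← mul_pow, neg_one_mul, neg_neg, one_pow, one_smul,
      one_smul]
    exact E_F_self φ i
  | E_F i j hij =>
    simp only [map_mul, map_smul, map_sub, map_zero, FreeAlgebra.lift_ι_apply, signGen]
    rw [smul_mul_smul_comm, smul_mul_smul_comm, smul_comm, mul_comm ((-1 : Coeff) ^ C.p j),
      ← smul_sub, E_F φ i j hij, smul_zero]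
  | J_E μ i =>
    simp only [map_mul, map_smul, FreeAlgebra.lift_ι_apply, signGen]
    exact sign_helper φ (J_E φ μ i)
  | J_F μ i =>
    simp only [map_mul, map_smul, FreeAlgebra.lift_ι_apply, signGen]
    exact sign_helper φ (J_F φ μ i)
  | K_E μ i =>
    simp only [map_mul, map_smul, FreeAlgebra.lift_ι_apply, signGen]
    exact sign_helper φ (K_E φ μ i)
  | K_F μ i =>
    simp only [map_mul, map_smul, FreeAlgebra.lift_ι_apply, signGen]
    exact sign_helper φ (K_F φ μ i)
  | T_E μ i =>
    simp only [map_mul, map_smul, FreeAlgebra.lift_ι_apply, signGen]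
    exact sign_helper φ (T_E φ μ i)
  | T_F μ i =>
    simp only [map_mul, map_smul, FreeAlgebra.lift_ι_apply, signGen]
    exact sign_helper φ (T_F φ μ i)
  | Ups_E μ i =>
    simp only [map_mul, map_smul, FreeAlgebra.lift_ι_apply, signGen]
    exact sign_helper φ (Ups_E φ μ i)
  | Ups_F μ i =>
    simp only [map_mul, map_smul, FreeAlgebra.lift_ι_apply, signGen]
    exact sign_helper φ (Ups_F φ μ i)
  | _ =>
    simp only [map_mul, map_pow, map_one, FreeAlgebra.lift_ι_apply, signGen, J_add, K_add, K_zero,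
      J_zero, J_sq, J_K, T_add, Ups_add, T_zero, Ups_zero, T_four, Ups_four, T_Ups, T_K, T_J,
      Ups_K, Ups_J]

/-- The automorphism `x ↦ (-1)^{p(x)} x` of `Û`, which encodes its `ℤ/2`-grading
`p(E_i) = p(F_i) = p(i)`, all other generators being even. -/
def signU : EnhU φ →ₐ[Coeff] EnhU φ := liftU φ (signGen φ) (sign_rel φ)

theorem signU_gen (g : Gen I Y) : signU φ (gen φ g) = signGen φ g := liftU_gen φ _ _ g

/-- The scalar `1/2`. -/
def halfC : Coeff := algebraMap GaussQ Coeff 2⁻¹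

section Parts

variable {M : Type*} [AddCommGroup M] [Module Coeff M] (s : M →ₗ[Coeff] M)

/-- The even component of `m`, when `s` is `m ↦ (-1)^{p(m)} m`. -/
def evenPart : M →ₗ[Coeff] M := halfC • (LinearMap.id + s)

/-- The odd component of `m`, when `s` is `m ↦ (-1)^{p(m)} m`. -/
def oddPart : M →ₗ[Coeff] M := halfC • (LinearMap.id - s)

/-- The map `m ↦ π^{p(m)} m`, when `s` is `m ↦ (-1)^{p(m)} m`. -/
def piParity : M →ₗ[Coeff] M := evenPart s + piElt • oddPart s

end Parts

/-! ## The coproduct -/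

/-- The product on `Û ⊗ Û` with
`(x ⊗ y) (z ⊗ w) = π^{p(y) p(z)} xz ⊗ yw` for homogeneous `y`, `z`.
The multiplication on the right-hand side is the usual one, without signs. -/
def covMul (a b : EnhU φ ⊗[Coeff] EnhU φ) : EnhU φ ⊗[Coeff] EnhU φ :=
  (evenPart (signU φ).toLinearMap).lTensor (EnhU φ) a * b +
    (oddPart (signU φ).toLinearMap).lTensor (EnhU φ) a *
      (piParity (signU φ).toLinearMap).rTensor (EnhU φ) b

/-- `Δ : Û → Û ⊗ Û` is the coproduct: the homomorphism to the twisted tensor product algebra with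
the given values on generators. -/
structure IsCoproduct (Δ : EnhU φ →ₗ[Coeff] EnhU φ ⊗[Coeff] EnhU φ) : Prop where
  map_one : Δ 1 = 1 ⊗ₜ 1
  map_mul : ∀ x y, Δ (x * y) = covMul φ (Δ x) (Δ y)
  map_E : ∀ i, Δ (uE φ i) = uE φ i ⊗ₜ uKt φ (-1) i + 1 ⊗ₜ uE φ i
  map_F : ∀ i, Δ (uF φ i) = uF φ i ⊗ₜ 1 + (uJt φ 1 i * uKt φ 1 i) ⊗ₜ uF φ i
  map_K : ∀ μ, Δ (uK φ μ) = uK φ μ ⊗ₜ uK φ μ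
  map_J : ∀ μ, Δ (uJ φ μ) = uJ φ μ ⊗ₜ uJ φ μ
  map_T : ∀ μ, Δ (uT φ μ) = uT φ μ ⊗ₜ uT φ μ
  map_Ups : ∀ ν, Δ (uUps φ ν) = uUps φ ν ⊗ₜ uUps φ ν

/-! ## The twistor on `Û` -/

/-- `𝔛` is the twistor on `Û`: the `ℚ(t)`-linear automorphism with the given values on generators
and with `𝔛(v) = t⁻¹ v`, `𝔛(π) = -π`. -/
structure IsTwistor (𝔛 : EnhU φ ≃ₐ[GaussQ] EnhU φ) : Prop where
  map_E : ∀ i, 𝔛 (uE φ i) = tPow (2 * C.d i) • (uE φ i * uTt φ 1 i * uUpsi φ 1 i)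
  map_F : ∀ i, 𝔛 (uF φ i) = uF φ i * uUpsi φ (-1) i
  map_K : ∀ μ, 𝔛 (uK φ μ) = uT φ (-μ) * uK φ μ
  map_J : ∀ μ, 𝔛 (uJ φ μ) = uT φ (2 • μ) * uJ φ μ
  map_T : ∀ μ, 𝔛 (uT φ μ) = uT φ μ
  map_Ups : ∀ ν, 𝔛 (uUps φ ν) = uUps φ ν
  map_v : 𝔛 (algebraMap Coeff (EnhU φ) (vPow 1)) =
    algebraMap Coeff (EnhU φ) (tPow (-1) * vPow 1)
  map_pi : 𝔛 (algebraMap Coeff (EnhU φ) piElt) = algebraMap Coeff (EnhU φ) (-piElt)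

/-- `𝔛' = ω⁻¹ ∘ 𝔛 ∘ ω`. -/
def twistorPrime (𝔛 : EnhU φ ≃ₐ[GaussQ] EnhU φ) : EnhU φ ≃ₐ[GaussQ] EnhU φ :=
  (((omega φ).restrictScalars GaussQ).trans 𝔛).trans ((omega φ).restrictScalars GaussQ).symm

/-! ## The modules `V(λ)[t]`, `^ωV(λ)[t]`, `N(λ,λ')[t]` -/

/-- The relations imposed on the highest weight vector of `V(λ)[t]`. -/
def highestRels (l : X) : Set (EnhU φ) :=
  (Set.range fun i : I => uE φ i) ∪
  (Set.range fun i : I => uF φ i ^ ((D.pairing (D.coroot i) l).toNat + 1)) ∪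
  (Set.range fun μ : Y => uK φ μ - algebraMap Coeff _ (vPow (D.pairing μ l))) ∪
  (Set.range fun μ : Y => uJ φ μ - algebraMap Coeff _ (piPow (D.pairing μ l))) ∪
  (Set.range fun μ : Y => uT φ μ - algebraMap Coeff _ (tPow (D.pairing μ l))) ∪
  (Set.range fun ν : I →₀ ℤ => uUps φ ν - algebraMap Coeff _ (tPow (φ.phi ν l)))

/-- The left ideal of `Û` generated by `highestRels`. -/
def highestIdeal (l : X) : Submodule (EnhU φ) (EnhU φ) :=
  Submodule.span (EnhU φ) (highestRels φ l)

/-- The module `V(λ)[t]`: the quotient of the Verma module of highest weight `λ` (the `Û`-module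
generated by a vector killed by all `E_i`, on which `K_μ`, `J_μ`, `T_μ`, `Υ_ν` act by
`v^⟨μ,λ⟩`, `π^⟨μ,λ⟩`, `t^⟨μ,λ⟩`, `t^φ(ν,λ)`) by the submodule generated by the vectors
`F_i^{⟨i,λ⟩+1} · 1`, `i ∈ I`. -/
def HighV (l : X) : Type _ := EnhU φ ⧸ highestIdeal φ l

instance (l : X) : AddCommGroup (HighV φ l) :=
  inferInstanceAs (AddCommGroup (EnhU φ ⧸ highestIdeal φ l))

instance (l : X) : Module (EnhU φ) (HighV φ l) :=
  inferInstanceAs (Module (EnhU φ) (EnhU φ ⧸ highestIdeal φ l))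

instance (l : X) : Module Coeff (HighV φ l) :=
  inferInstanceAs (Module Coeff (EnhU φ ⧸ highestIdeal φ l))

instance (l : X) : Module GaussQ (HighV φ l) :=
  inferInstanceAs (Module GaussQ (EnhU φ ⧸ highestIdeal φ l))

instance (l : X) : IsScalarTower Coeff (EnhU φ) (HighV φ l) :=
  inferInstanceAs (IsScalarTower Coeff (EnhU φ) (EnhU φ ⧸ highestIdeal φ l))

instance (l : X) : IsScalarTower GaussQ Coeff (HighV φ l) :=
  inferInstanceAs (IsScalarTower GaussQ Coeff (EnhU φ ⧸ highestIdeal φ l))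

instance (l : X) : SMulCommClass Coeff GaussQ (HighV φ l) :=
  IsScalarTower.to_smulCommClass' ..

/-- The highest weight vector `η_λ`. -/
def eta (l : X) : HighV φ l := Submodule.Quotient.mk (1 : EnhU φ)

theorem signU_mem (l : X) {u : EnhU φ} (hu : u ∈ highestIdeal φ l) :
    signU φ u ∈ highestIdeal φ l := by
  have hsub : highestRels φ l ⊆ highestIdeal φ l := Submodule.subset_span
  have hsc : ∀ (c : Coeff) (x : EnhU φ), x ∈ highestIdeal φ l → c • x ∈ highestIdeal φ l := by
    intro c x hx
    rw [← algebraMap_smul (EnhU φ) c x]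
    exact Submodule.smul_mem _ _ hx
  induction hu using Submodule.span_induction with
  | zero => rw [map_zero]; exact Submodule.zero_mem _
  | add x y _ _ hx hy => rw [map_add]; exact Submodule.add_mem _ hx hy
  | smul a x _ hx => rw [smul_eq_mul, map_mul]; exact Submodule.smul_mem _ _ hx
  | mem x hx =>
    have hx0 := hsub hx
    rcases hx with ((((⟨i, rfl⟩ | ⟨i, rfl⟩) | ⟨μ, rfl⟩) | ⟨μ, rfl⟩) | ⟨μ, rfl⟩) | ⟨μ, rfl⟩
    · simp only [signU_gen, signGen]; exact hsc _ _ hx0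
    · simp only [map_pow, signU_gen, signGen, _root_.smul_pow]; exact hsc _ _ hx0
    all_goals
      simp only [map_sub, signU_gen, signGen, AlgHom.commutes]
      exact hx0

/-- The map `m ↦ (-1)^{p(m)} m` on `V(λ)[t]`, where `p(u η_λ) = p(u)`. -/
def signV (l : X) : HighV φ l →ₗ[Coeff] HighV φ l :=
  (Submodule.Quotient.restrictScalarsEquiv Coeff (highestIdeal φ l)).toLinearMap ∘ₗ
    Submodule.mapQ ((highestIdeal φ l).restrictScalars Coeff)
      ((highestIdeal φ l).restrictScalars Coeff) (signU φ).toLinearMap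
      (fun _ hu => signU_mem φ l hu) ∘ₗ
    (Submodule.Quotient.restrictScalarsEquiv Coeff (highestIdeal φ l)).symm.toLinearMap

theorem signV_smul_eta (l : X) (u : EnhU φ) : signV φ l (u • eta φ l) = signU φ u • eta φ l := by
  have h : ∀ u : EnhU φ, u • eta φ l = (Submodule.Quotient.mk u : EnhU φ ⧸ highestIdeal φ l) := by
    intro u
    change Submodule.Quotient.mk (u • (1 : EnhU φ)) = _
    rw [smul_eq_mul, mul_one]
  rw [h, h]
  rfl

/-- The exponent `φ(ν,λ) + φ(ν,-λ)`. -/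
def shiftExp (l : X) (ν : I →₀ ℤ) : ℤ := φ.phi ν l + φ.phi ν (-l)

theorem shiftExp_add (l : X) (μ ν : I →₀ ℤ) :
    shiftExp φ l (μ + ν) ≡ shiftExp φ l μ + shiftExp φ l ν [ZMOD 4] := by
  have := (φ.add_left μ ν l).add (φ.add_left μ ν (-l))
  rwa [add_add_add_comm] at this

theorem shiftExp_zero (l : X) : shiftExp φ l 0 ≡ 0 [ZMOD 4] := by
  simpa [shiftExp] using (phi_zero φ l).add (phi_zero φ (-l))

/-- The values on generators of the map rescaling `Υ_ν` by `t^{φ(ν,λ) + φ(ν,-λ)}`. -/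
def rescaleGen (l : X) : Gen I Y → EnhU φ
  | Gen.Ups ν => tPow (shiftExp φ l ν) • uUps φ ν
  | g => gen φ g

theorem rescale_rel (l : X) ⦃x y : FreeAlgebra Coeff (Gen I Y)⦄ (h : Rel φ x y) :
    FreeAlgebra.lift Coeff (rescaleGen φ l) x = FreeAlgebra.lift Coeff (rescaleGen φ l) y := by
  induction h with
  | E_serre i j hij =>
    simp only [map_mul, map_smul, map_sum, map_pow, map_zero, FreeAlgebra.lift_ι_apply, rescaleGen]
    exact E_serre φ i j hij
  | F_serre i j hij =>
    simp only [map_mul, map_smul, map_sum, map_pow, map_zero, FreeAlgebra.lift_ι_apply, rescaleGen]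
    exact F_serre φ i j hij
  | E_F_self i =>
    simp only [map_mul, map_smul, map_sub, FreeAlgebra.lift_ι_apply, rescaleGen]
    exact E_F_self φ i
  | E_F i j hij =>
    simp only [map_mul, map_smul, map_sub, map_zero, FreeAlgebra.lift_ι_apply, rescaleGen]
    exact E_F φ i j hij
  | Ups_add μ ν =>
    simp only [map_mul, FreeAlgebra.lift_ι_apply, rescaleGen]
    rw [smul_mul_smul_comm, Ups_add, ← tPow_add, tPow_congr (shiftExp_add φ l μ ν)]
  | Ups_zero =>
    simp only [map_one, FreeAlgebra.lift_ι_apply, rescaleGen]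
    rw [Ups_zero, tPow_congr (shiftExp_zero φ l), tPow_zero, one_smul]
  | Ups_four ν =>
    simp only [map_pow, map_one, FreeAlgebra.lift_ι_apply, rescaleGen]
    rw [_root_.smul_pow, Ups_four]
    rw [show tPow (shiftExp φ l ν) ^ 4 = 1 by
      rw [tPow, ← map_pow, ← zpow_natCast, zpow_comm, Nat.cast_ofNat, tt_pow_four, one_zpow, map_one],
      one_smul]
  | _ =>
    simp only [map_mul, map_pow, map_one, map_smul, FreeAlgebra.lift_ι_apply, rescaleGen, J_add,
      K_add, K_zero, J_zero, J_sq, J_K, T_add, T_zero, T_four, T_Ups, T_K, T_J,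
      Ups_K, Ups_J, mul_smul_comm, smul_mul_assoc, J_E, J_F, K_E, K_F, T_E, T_F, Ups_E, Ups_F]
    try rw [smul_comm]

/-- The endomorphism of `Û` which multiplies `Υ_ν` by `t^{φ(ν,λ) + φ(ν,-λ)}` and fixes the other
generators. -/
def rescale (l : X) : EnhU φ →ₐ[Coeff] EnhU φ := liftU φ (rescaleGen φ l) (rescale_rel φ l)

theorem rescale_gen (l : X) (g : Gen I Y) : rescale φ l (gen φ g) = rescaleGen φ l g :=
  liftU_gen φ _ _ g

/-- The module `^ωV(λ)[t]`: the space `V(λ)[t]`, on which the generators `E_i`, `F_i`, `K_μ`, `J_μ`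
act through `ω`, while `T_μ` and `Υ_ν` act on the subspace of weight `ζ` by `t^⟨μ,ζ⟩` and
`t^φ(ν,ζ)`. The weights are `ζ = μ' - λ` with `μ ∈ ℕ[I]`; since `φ` need not be additive on `X`,
`φ(ν, μ' - λ)` agrees with `-φ(ν, λ - μ')` modulo `4` only after adding the constant
`φ(ν,λ) + φ(ν,-λ)`, and this is what `rescale` does. -/
def LowV (l : X) : Type _ := HighV φ l

instance (l : X) : AddCommGroup (LowV φ l) := inferInstanceAs (AddCommGroup (HighV φ l))

instance (l : X) : Module Coeff (LowV φ l) := inferInstanceAs (Module Coeff (HighV φ l))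

instance (l : X) : Module GaussQ (LowV φ l) := inferInstanceAs (Module GaussQ (HighV φ l))

instance (l : X) : IsScalarTower GaussQ Coeff (LowV φ l) :=
  inferInstanceAs (IsScalarTower GaussQ Coeff (HighV φ l))

/-- The identity map from `V(λ)[t]` to `^ωV(λ)[t]`. -/
def toLow (l : X) : HighV φ l ≃ₗ[Coeff] LowV φ l := LinearEquiv.refl Coeff (HighV φ l)

instance (l : X) : Module (EnhU φ) (LowV φ l) :=
  Module.compHom (HighV φ l) (((omega φ).toAlgHom.comp (rescale φ l)).toRingHom)

theorem low_smul (l : X) (u : EnhU φ) (m : HighV φ l) :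
    u • toLow φ l m = toLow φ l (omega φ (rescale φ l u) • m) := rfl

instance (l : X) : IsScalarTower Coeff (EnhU φ) (LowV φ l) where
  smul_assoc c u m := by
    obtain ⟨m, rfl⟩ := (toLow φ l).surjective m
    rw [low_smul, low_smul, map_smul (rescale φ l), map_smul (omega φ), smul_assoc,
      map_smul (toLow φ l)]

/-- The lowest weight vector `ξ_{-λ}`. -/
def xi (l : X) : LowV φ l := toLow φ l (eta φ l)

theorem Ups_xi (l : X) (ν : I →₀ ℤ) : uUps φ ν • xi φ l = tPow (φ.phi ν (-l)) • xi φ l := by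
  have h : uUps φ (-ν) • eta φ l = tPow (φ.phi (-ν) l) • eta φ l := by
    have hm : uUps φ (-ν) - algebraMap Coeff _ (tPow (φ.phi (-ν) l)) ∈ highestIdeal φ l :=
      Submodule.subset_span (Or.inr ⟨-ν, rfl⟩)
    have h0 : (uUps φ (-ν) - algebraMap Coeff _ (tPow (φ.phi (-ν) l))) • eta φ l = 0 := by
      have : (uUps φ (-ν) - algebraMap Coeff _ (tPow (φ.phi (-ν) l))) • eta φ l =
          (Submodule.Quotient.mk ((uUps φ (-ν) - algebraMap Coeff _ (tPow (φ.phi (-ν) l))) • 1) :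
            EnhU φ ⧸ highestIdeal φ l) := rfl
      rw [this, smul_eq_mul, mul_one]
      exact (Submodule.Quotient.mk_eq_zero _).mpr hm
    rwa [sub_smul, algebraMap_smul, sub_eq_zero] at h0
  rw [xi, low_smul, rescale_gen, rescaleGen, map_smul (omega φ), omega_gen, omegaGen, smul_assoc, h,
    smul_smul, ← tPow_add, ← map_smul (toLow φ l)]
  congr 2
  apply tPow_congr
  have := (phi_neg φ ν l).add_left (shiftExp φ l ν)
  refine this.trans ?_
  rw [shiftExp]
  ring_nf
  rfl

/-- The space `N(λ,λ')[t] = V(λ)[t] ⊗ ^ωV(λ')[t]`. -/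
abbrev TensN (l l' : X) : Type _ := HighV φ l ⊗[Coeff] LowV φ l'

/-- The action of `x ⊗ y` on `V(λ)[t] ⊗ ^ωV(λ')[t]` without signs: `w ⊗ w' ↦ xw ⊗ yw'`. -/
def plainAct (l l' : X) :
    (EnhU φ ⊗[Coeff] EnhU φ) →ₗ[Coeff] TensN φ l l' →ₗ[Coeff] TensN φ l l' :=
  TensorProduct.lift <| (TensorProduct.mapBilinear (RingHom.id Coeff)
    (HighV φ l) (LowV φ l') (HighV φ l) (LowV φ l')).compl₁₂
    (Algebra.lsmul Coeff Coeff (HighV φ l)).toLinearMap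
    (Algebra.lsmul Coeff Coeff (LowV φ l')).toLinearMap

theorem plainAct_tmul (l l' : X) (x y : EnhU φ) (w : HighV φ l) (w' : LowV φ l') :
    plainAct φ l l' (x ⊗ₜ y) (w ⊗ₜ w') = (x • w) ⊗ₜ (y • w') := rfl

/-- The action of `Û ⊗ Û` on `N(λ,λ')[t]`:
`(x ⊗ y) (w ⊗ w') = π^{p(y) p(w)} xw ⊗ yw'` for homogeneous `y`, `w`. -/
def covAct (l l' : X) (a : EnhU φ ⊗[Coeff] EnhU φ) (n : TensN φ l l') : TensN φ l l' :=
  plainAct φ l l' ((evenPart (signU φ).toLinearMap).lTensor (EnhU φ) a) n +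
    plainAct φ l l' ((oddPart (signU φ).toLinearMap).lTensor (EnhU φ) a)
      ((piParity (signV φ l)).rTensor (LowV φ l') n)

/-- `m` has weight `ζ`: `J_μ K_ν m = π^⟨μ,ζ⟩ v^⟨ν,ζ⟩ m` for all `μ, ν ∈ Y`. -/
def HasWeight {M : Type*} [AddCommGroup M] [Module (EnhU φ) M] (m : M) (z : X) : Prop :=
  ∀ μ ν : Y, (uJ φ μ * uK φ ν) • m =
    algebraMap Coeff (EnhU φ) (piPow (D.pairing μ z) * vPow (D.pairing ν z)) • m

/-! ## Module twistors and the phase -/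

/-- `f` is the module twistor on `V(λ)[t]`: it is `ℚ(t)`-linear, fixes `η_λ`, and satisfies
`f(um) = 𝔛(u) f(m)`. -/
structure IsHighTwistor (𝔛 : EnhU φ ≃ₐ[GaussQ] EnhU φ) (l : X)
    (f : HighV φ l →ₗ[GaussQ] HighV φ l) : Prop where
  map_eta : f (eta φ l) = eta φ l
  map_smul : ∀ (u : EnhU φ) (m : HighV φ l), f (u • m) = 𝔛 u • f m

/-- `f` is the module twistor on `^ωV(λ)[t]`: it is `ℚ(t)`-linear, fixes `ξ_{-λ}`, and satisfies
`f(um) = 𝔛'(u) f(m)`, where `𝔛' = ω⁻¹ ∘ 𝔛 ∘ ω`. -/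
structure IsLowTwistor (𝔛 : EnhU φ ≃ₐ[GaussQ] EnhU φ) (l : X)
    (f : LowV φ l →ₗ[GaussQ] LowV φ l) : Prop where
  map_xi : f (xi φ l) = xi φ l
  map_smul : ∀ (u : EnhU φ) (m : LowV φ l), f (u • m) = twistorPrime φ 𝔛 u • f m

/-- The conditions on the phase function `ϰ`, at pairs `(ζ, ζ') = (λ - ν', μ' - λ')` with
`ν, μ ∈ ℕ[I]`; the values of `ϰ` elsewhere play no role. -/
structure IsPhase (l l' : X) (κ : X → X → ℤ) : Prop where
  sub_root : ∀ (ν μ : I →₀ ℕ) (i : I),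
    κ (l - D.wtN ν - D.root i) (D.wtN μ - l') ≡
      κ (l - D.wtN ν) (D.wtN μ - l') - φ.phi (Finsupp.single i 1) (D.wtN μ - l') [ZMOD 4]
  add_root : ∀ (ν μ : I →₀ ℕ) (i : I),
    κ (l - D.wtN ν) (D.wtN μ - l' + D.root i) ≡
      κ (l - D.wtN ν) (D.wtN μ - l') + φ.phi (Finsupp.single i 1) (l - D.wtN ν) + 2 * C.d i +
        D.pairing (D.til 1 i) (l - D.wtN ν + (D.wtN μ - l')) + 2 * C.parity ν * C.p i [ZMOD 4]
  base : κ l (-l') ≡ 0 [ZMOD 4]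

/-- `f` is given on weight vectors by
`f(w ⊗ w') = t^{ϰ(|w|,|w'|)} 𝔛_λ(w) ⊗ 𝔛_{-λ'}(w')`. -/
def IsTensorTwistor (l l' : X) (κ : X → X → ℤ) (f₁ : HighV φ l →ₗ[GaussQ] HighV φ l)
    (f₂ : LowV φ l' →ₗ[GaussQ] LowV φ l') (f : TensN φ l l' →ₗ[GaussQ] TensN φ l l') : Prop :=
  ∀ (ν μ : I →₀ ℕ) (w : HighV φ l) (w' : LowV φ l'),
    HasWeight φ w (l - D.wtN ν) → HasWeight φ w' (D.wtN μ - l') →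
    f (w ⊗ₜ w') = tPow (κ (l - D.wtN ν) (D.wtN μ - l')) • (f₁ w ⊗ₜ[Coeff] f₂ w')

end Algebra

end

end QCov

/-! Every map is obtained from a presentation, so the work is to check relations and to count powers
of $\mathbf t$ modulo $4$.

Coproduct. Put $q_{ij}=\pi^{p(i)p(j)}v^{i\cdot j}$. The Serre polynomial in $x,z$ is an iterated
$q$-commutator: it applies the operators $L_x-q_{ii}^sq_{ij}R_x$, $0\le s<b$, to $z$
(`serreSum_eq_left`), and it has the same form with all $q$'s inverted (`serreSum_eq_right`). If $y$
commutes with $x$ and $z$ up to $q_{ii}$ and $q_{ij}$, replacing $x$ by $x+y$ does not change the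
result (`serreIter_add_left`). The two summands of $\Delta(E_i)$, or of $\Delta(F_i)$, separately
satisfy Serre relations and $q$-commute, so their sum satisfies them too (`serreSum_add`). No
expansion of $\Delta(E_i)^n$ is needed.

Twistor. It is semilinear over `sigma`, which multiplies $\pi^av^b$ by $\mathbf t^{2a-b}$ because
$-1=\mathbf t^2$. Bar-consistency makes `sigma` fix $q_{ii}$, hence the Gaussian binomials in
$q_{ii}$; the $k$-th Serre coefficient only gains a power of $\mathbf t$ linear in $k$. The torus
factors attached to $E_i$ and $F_i$ produce the opposite power, by the skew condition on the
enhancer (`twistor_serre`, `twistor_E_F`). The fourth power of the twistor is the identity, which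
provides its inverse.

Module twistors. $V(\lambda)[\mathbf t]$ is the algebra modulo a left ideal, and any endomorphism
resembling the twistor preserves that ideal (`TwistorLike.mem_highestIdeal`). On the lowest weight
side the action goes through $\omega$ and a rescaling of $\Upsilon$, so the map needed there is
induced by a conjugate of the twistor (`twistorConj_omega`).

Tensor product. Monomials in the $F_i$ identify the weight spaces (`contentSpace_eq_weightSpace`),
so a scalar may be prescribed on each product of weight spaces. The two recursions for $\varkappa$
state that both summands of $\Delta(E_i)$, and of $\Delta(F_i)$, pick up the same power of $\mathbf
t$ (`IsTensorTwistor.map_coAct`). The recursions are compatible because moving an index from one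
argument of $\phi$ to the other costs exactly $d_i\langle i,\nu'\rangle+2p(\nu)p(i)$
(`phi_natInt_root`). -/

namespace QCov

open Polynomial TensorProduct
open scoped IntermediateField

noncomputable section

/-! ## Gaussian binomials and the Serre relations -/

/-- The Gaussian binomial coefficient, defined by the Pascal recursion. -/
def gauss {R : Type*} [CommRing R] (q : R) : ℕ → ℕ → R
  | _, 0 => 1
  | 0, _ + 1 => 0
  | n + 1, k + 1 => gauss q n (k + 1) + q ^ (n - k) * gauss q n k

section Gauss

variable {R : Type*} [CommRing R]

theorem gauss_zero_right (q : R) (n : ℕ) : gauss q n 0 = 1 := by cases n <;> rfl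

theorem gauss_succ (q : R) (n k : ℕ) :
    gauss q (n + 1) (k + 1) = gauss q n (k + 1) + q ^ (n - k) * gauss q n k := rfl

theorem gauss_eq_zero (q : R) : ∀ (n k : ℕ), n < k → gauss q n k = 0
  | 0, k + 1, _ => rfl
  | n + 1, k + 1, h => by
    rw [gauss_succ, gauss_eq_zero q n (k + 1) (by omega), gauss_eq_zero q n k (by omega),
      mul_zero, add_zero]

/-- The product formula in division-free form, so that it holds in any commutative ring. Truncated
subtraction is harmless: for $n<k$ both sides are zero. -/
theorem gauss_mul (q : R) : ∀ (n k : ℕ),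
    gauss q n k * ∏ s ∈ Finset.range k, (q ^ (s + 1) - 1) =
      ∏ s ∈ Finset.range k, (q ^ (n - s) - 1)
  | n, 0 => by simp [gauss_zero_right]
  | 0, k + 1 => by simp [gauss]
  | n + 1, k + 1 => by
    rw [Finset.prod_range_succ' (fun s => q ^ (n + 1 - s) - 1)]
    simp only [Nat.add_sub_add_right, Nat.sub_zero]
    rcases lt_or_ge n k with h | h
    · rw [gauss_eq_zero q (n + 1) (k + 1) (by omega), zero_mul]
      -- The factor with $s=n$ is $q^0-1$.
      rw [Finset.prod_eq_zero (Finset.mem_range.mpr h) (by simp), zero_mul]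
    · have h1 := gauss_mul q n (k + 1)
      have h2 := gauss_mul q n k
      rw [Finset.prod_range_succ, Finset.prod_range_succ] at h1
      rw [gauss_succ, Finset.prod_range_succ]
      have h3 : q ^ (n + 1) = q ^ (n - k) * q ^ (k + 1) := by rw [← pow_add]; congr 1; omega
      rw [h3]
      linear_combination h1 + q ^ (n - k) * (q ^ (k + 1) - 1) * h2

end Gauss

/-! ### Iterated $q$-commutators -/

/-- The sequence `z_0 = z`, `z_{s+1} = x z_s - q^s c z_s x`. -/
def serreIter {R A : Type*} [CommRing R] [Ring A] [Algebra R A] (q c : R) (x z : A) : ℕ → A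
  | 0 => z
  | s + 1 => x * serreIter q c x z s - (q ^ s * c) • (serreIter q c x z s * x)

section Iter

variable {R A : Type*} [CommRing R] [Ring A] [Algebra R A]

/-- The $q$-binomial theorem for $\prod_{s<n}(L-q^scR)$, where the left and right multiplications
$L,R$ by $x$ commute. -/
theorem serreIter_eq_sum (q c : R) (x z : A) (n : ℕ) :
    serreIter q c x z n = ∑ k ∈ Finset.range (n + 1),
      ((-1) ^ k * q ^ k.choose 2 * c ^ k * gauss q n k) • (x ^ (n - k) * z * x ^ k) := by
  induction n with
  | zero => simp [serreIter, gauss]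
  | succ n ih =>
    rw [serreIter, ih, Finset.mul_sum, Finset.sum_mul, Finset.smul_sum]
    have h1 : ∑ k ∈ Finset.range (n + 1),
        x * ((-1) ^ k * q ^ k.choose 2 * c ^ k * gauss q n k) • (x ^ (n - k) * z * x ^ k) =
        ∑ k ∈ Finset.range (n + 2),
          ((-1) ^ k * q ^ k.choose 2 * c ^ k * gauss q n k) • (x ^ (n + 1 - k) * z * x ^ k) := by
      rw [Finset.sum_range_succ _ (n + 1), gauss_eq_zero q n (n + 1) (by omega), mul_zero, zero_smul,
        add_zero]
      refine Finset.sum_congr rfl fun k hk => ?_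
      have hk' : n + 1 - k = (n - k) + 1 := by have := Finset.mem_range.mp hk; omega
      rw [hk', pow_succ', mul_smul_comm]
      simp only [mul_assoc]
    rw [h1, Finset.sum_range_succ' _ (n + 1), Finset.sum_range_succ' _ (n + 1), add_sub_right_comm,
      ← Finset.sum_sub_distrib]
    congr 1
    · refine Finset.sum_congr rfl fun k hk => ?_
      rw [smul_mul_assoc, smul_smul, Nat.add_sub_add_right, mul_assoc (x ^ (n - k) * z), ← pow_succ,
        ← sub_smul]
      congr 1
      have h3 : q ^ n = q ^ (n - k) * q ^ k := by
        rw [← pow_add]; congr 1; have := Finset.mem_range.mp hk; omega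
      rw [gauss_succ, Nat.choose_succ_succ' k 1, Nat.choose_one_right, h3]
      ring
    · simp [gauss_zero_right]

theorem serreIter_add_right (q c : R) (x z w : A) (n : ℕ) :
    serreIter q c x (z + w) n = serreIter q c x z n + serreIter q c x w n := by
  induction n with
  | zero => rfl
  | succ n ih => simp only [serreIter, ih, mul_add, add_mul, smul_add]; abel

/-- Passing $y$ through $xz_n$ or through $z_nx$ costs the same factor $q\cdot q^nc$, so the
commutation rule survives each step of the iteration. -/
theorem mul_serreIter {q c : R} {x y z : A} (hx : y * x = q • (x * y)) (hz : y * z = c • (z * y))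
    (n : ℕ) : y * serreIter q c x z n = (q ^ n * c) • (serreIter q c x z n * y) := by
  induction n with
  | zero => simpa [serreIter] using hz
  | succ n ih =>
    simp only [serreIter]
    generalize serreIter q c x z n = s at ih
    have h1 : y * (x * s) = (q * (q ^ n * c)) • (x * s * y) := by
      rw [← mul_assoc, hx, smul_mul_assoc, mul_assoc, ih, mul_smul_comm, smul_smul, mul_assoc]
    have h2 : y * (s * x) = (q * (q ^ n * c)) • (s * x * y) := by
      rw [← mul_assoc, ih, smul_mul_assoc, mul_assoc, hx, mul_smul_comm, smul_smul, ← mul_assoc s,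
        mul_comm q]
    rw [mul_sub, mul_smul_comm, h1, h2, sub_mul, smul_sub, smul_mul_assoc, smul_comm (q ^ n * c),
      pow_succ', mul_assoc q]

/-- The extra contribution of $y$ at step $s$ is $yz_s-q^scz_sy$, which is zero by `mul_serreIter`.
-/
theorem serreIter_add_left {q c : R} {x y z : A} (hx : y * x = q • (x * y))
    (hz : y * z = c • (z * y)) (n : ℕ) : serreIter q c (x + y) z n = serreIter q c x z n := by
  induction n with
  | zero => rfl
  | succ n ih =>
    rw [serreIter, ih, add_mul, mul_add, mul_serreIter hx hz n, smul_add, serreIter]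
    abel

end Iter

/-! ### Serre coefficients in terms of Gaussian binomials -/

namespace SuperCartanDatum

variable {I : Type*} (C : SuperCartanDatum I)

theorem d_mul_a_symm (i j : I) : C.d i * C.a i j = C.d j * C.a j i := by
  rcases eq_or_ne i j with rfl | h
  · rfl
  · rw [C.d_mul_a i j h, C.d_mul_a j i h.symm, C.form_symm]

theorem b_cast (i j : I) (h : i ≠ j) : (C.b i j : ℤ) = 1 - C.a i j := by
  have := C.form_nonpos i j h
  rw [b, Int.toNat_of_nonneg]
  rw [a]; omega

/-- The scalar `π^{p(i)p(j)} v^{i · j}`. -/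
def qc (i j : I) : Coeffˣ := piU ^ ((C.p i : ℤ) * C.p j) * vU ^ (C.d i * C.a i j)

theorem qc_symm (i j : I) : C.qc i j = C.qc j i := by
  rw [qc, qc, C.d_mul_a_symm, mul_comm (C.p i : ℤ)]

theorem d_emod_two (i : I) : C.d i % 2 = (C.p i : ℤ) % 2 := C.bar_consistent i

end SuperCartanDatum

theorem piU_zpow_even {a : ℤ} (h : Even a) : piU ^ a = 1 := Units.ext (piPow_even h)

theorem piU_zpow_congr {a b : ℤ} (h : a % 2 = b % 2) : piU ^ a = piU ^ b := by
  have : a = b + (a - b) := by ring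
  rw [this, zpow_add, piU_zpow_even (a := a - b) (by rw [Int.even_iff]; omega), mul_one]

theorem piPow_congr {a b : ℤ} (h : a % 2 = b % 2) : piPow a = piPow b := by
  rw [piPow, piPow, piU_zpow_congr h]

namespace SuperCartanDatum

variable {I : Type*} (C : SuperCartanDatum I)

/-- Bar-consistency and $p(i)^2=p(i)$ identify $\pi^{p(i)^2}$ with $\pi_i$, which turns this scalar
into the parameter $\pi_iv_i^2$ of the binomials. -/
theorem qc_self (i : I) : C.qc i i = piU ^ C.d i * vU ^ (2 * C.d i) := by
  rw [qc, d_mul_a_self]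
  congr 1
  apply piU_zpow_congr
  have h := C.d_emod_two i
  rcases Nat.le_one_iff_eq_zero_or_eq_one.mp (C.p_le i) with h' | h' <;> rw [h'] at h ⊢ <;>
    simp at h ⊢ <;> omega

/-- Stated for an arbitrary factorisation of the quantum integers, because it is applied both to
$q_{ii}$ and to its inverse. The constant $e$ occurs $k$ times in numerator and denominator and
cancels. -/
theorem qbinom_eq (i : I) (e u q : Coeffˣ)
    (h : ∀ l : ℕ, C.qnum i l = e * u ^ l * (q ^ l - 1)) {n k : ℕ} (hk : k ≤ n) :
    C.qbinom i n k = u ^ (k * (n - k)) * gauss (q : Coeff) n k := by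
  have hD : IsUnit (∏ s ∈ Finset.range k, C.qnum i ((s : ℤ) + 1)) := by
    apply Finset.prod_induction _ IsUnit (fun _ _ => IsUnit.mul) isUnit_one
    intro s _
    exact C.isUnit_qnum i (by omega)
  rw [qbinom, ← hD.mul_left_inj, mul_assoc, Ring.inverse_mul_cancel _ hD, mul_one]
  have h1 : ∀ s ∈ Finset.range k, C.qnum i ((s : ℤ) + 1) =
      (e * u ^ (s + 1)) * ((q : Coeff) ^ (s + 1) - 1) := fun s _ => by
    rw [← h]; rfl
  have h2 : ∀ s ∈ Finset.range k, C.qnum i ((n : ℤ) - s) =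
      (e * u ^ (n - s)) * ((q : Coeff) ^ (n - s) - 1) := fun s hs => by
    have := Finset.mem_range.mp hs
    rw [← h]; push_cast [show s ≤ n by omega]; rfl
  rw [Finset.prod_congr rfl h1, Finset.prod_congr rfl h2,
    Finset.prod_mul_distrib (f := fun s => (e : Coeff) * (u : Coeff) ^ (s + 1)),
    Finset.prod_mul_distrib (f := fun s => (e : Coeff) * (u : Coeff) ^ (n - s)), ← gauss_mul]
  -- After reversing the first product, matching factors differ by $u^{n-k}$; there are $k$ of them.
  have h3 : ∏ s ∈ Finset.range k, ((e : Coeff) * (u : Coeff) ^ (n - s)) =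
      (u : Coeff) ^ (k * (n - k)) * ∏ s ∈ Finset.range k, ((e : Coeff) * (u : Coeff) ^ (s + 1)) := by
    rw [← Finset.prod_range_reflect, pow_mul', ← Finset.card_range k, ← Finset.prod_const,
      Finset.card_range, ← Finset.prod_mul_distrib]
    refine Finset.prod_congr rfl fun s hs => ?_
    have := Finset.mem_range.mp hs
    rw [show n - (k - 1 - s) = (n - k) + (s + 1) by omega, pow_add]
    ring
  rw [h3]
  ring

/-- Factor $v_i^{-l}$ out of the quantum integer; the remaining ratio is $(\pi_iv_i^2)^l$. -/
theorem qnum_eq_left (i : I) (l : ℕ) : C.qnum i l =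
    ((1 : Coeffˣ) : Coeff) * ((vU ^ (-C.d i) : Coeffˣ) : Coeff) ^ l * ((C.qc i i : Coeff) ^ l - 1) := by
  rw [qnum, Units.val_one, one_mul, mul_sub, mul_one, ← Units.val_pow_eq_pow_val,
    ← Units.val_pow_eq_pow_val, ← Units.val_mul]
  congr 2
  · rw [qc_self, ← mul_pow, ← zpow_natCast, mul_left_comm, ← zpow_add, mul_zpow, mul_zpow,
      ← zpow_mul, ← zpow_mul]
    congr 2
    ring
  · rw [← zpow_natCast, ← zpow_mul, neg_mul]

/-- Factor out the other term $(\pi_iv_i)^l$ instead, which leaves the inverse parameter and a sign.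
-/
theorem qnum_eq_right (i : I) (l : ℕ) : C.qnum i l =
    ((-1 : Coeffˣ) : Coeff) * (((piU * vU) ^ C.d i : Coeffˣ) : Coeff) ^ l *
      ((((C.qc i i)⁻¹ : Coeffˣ) : Coeff) ^ l - 1) := by
  rw [qnum, Units.val_neg, Units.val_one, ← Units.val_pow_eq_pow_val, ← Units.val_pow_eq_pow_val,
    mul_sub, mul_one, mul_assoc, ← Units.val_mul, ← mul_pow]
  have h1 : (piU * vU) ^ C.d i * (C.qc i i)⁻¹ = vU ^ (-C.d i) := by
    rw [mul_inv_eq_iff_eq_mul, qc_self, mul_left_comm, ← zpow_add, mul_zpow]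
    congr 2
    ring
  rw [h1, ← zpow_natCast, ← zpow_natCast, ← zpow_mul, ← zpow_mul]
  ring_nf

theorem p_mul_self (i : I) : (C.p i : ℤ) * C.p i = C.p i := by
  rcases Nat.le_one_iff_eq_zero_or_eq_one.mp (C.p_le i) with h | h <;> simp [h]

theorem two_mul_choose_two (k : ℕ) : 2 * (k.choose 2 : ℤ) = k * (k - 1) := by
  rw [Nat.choose_two_right]
  have h : 2 ∣ k * (k - 1) := (Nat.even_mul_pred_self k).two_dvd
  rcases k with _ | k
  · simp
  · push_cast [h]
    rw [Int.mul_ediv_cancel']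
    · ring
    · have := Int.natCast_dvd_natCast.mpr h; push_cast at this; simpa using this

/-- The power $v_i^{-k(b-k)}$ from the normalisation of the binomial equals
$v_i^{k(k-1)}v_i^{ka_{ij}}$, since $a_{ij}=1-b$. -/
theorem serreCoeff_eq_left {i j : I} (h : i ≠ j) {k : ℕ} (hk : k ≤ C.b i j) :
    C.serreCoeff i j k = (-1) ^ k * (C.qc i i : Coeff) ^ k.choose 2 * (C.qc i j : Coeff) ^ k *
      gauss (C.qc i i : Coeff) (C.b i j) k := by
  rw [serreCoeff, C.qbinom_eq i _ _ _ (C.qnum_eq_left i) hk, ← mul_assoc]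
  congr 1
  rw [mul_assoc ((-1 : Coeff) ^ k), mul_assoc ((-1 : Coeff) ^ k), piPow, ← Units.val_pow_eq_pow_val, ← Units.val_pow_eq_pow_val,
    ← Units.val_pow_eq_pow_val, ← Units.val_mul, ← Units.val_mul]
  congr 2
  simp only [qc, C.d_mul_a_self, mul_zpow, ← zpow_natCast, ← zpow_mul]
  rw [mul_mul_mul_comm, ← zpow_add, ← zpow_add, C.p_mul_self]
  congr 2
  · push_cast; ring
  · push_cast [hk]
    have hb := C.b_cast i j h
    have h2 := two_mul_choose_two k
    have : C.a i j = 1 - C.b i j := by omega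
    rw [this]
    linear_combination - C.d i * h2

/-- The Serre polynomial is unchanged when its parameters are inverted. On the $v$-part this is the
symmetry of binomials; on the $\pi$-part it needs the parity condition of an anisotropic datum. -/
theorem serreCoeff_eq_right {i j : I} (h : i ≠ j) {k : ℕ} (hk : k ≤ C.b i j) :
    C.serreCoeff i j k = (-1) ^ k * (((C.qc i i)⁻¹ : Coeffˣ) : Coeff) ^ k.choose 2 *
      (((C.qc i j)⁻¹ : Coeffˣ) : Coeff) ^ k *
      gauss (((C.qc i i)⁻¹ : Coeffˣ) : Coeff) (C.b i j) k := by
  rw [serreCoeff, C.qbinom_eq i _ _ _ (C.qnum_eq_right i) hk, ← mul_assoc]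
  congr 1
  rw [mul_assoc ((-1 : Coeff) ^ k), mul_assoc ((-1 : Coeff) ^ k), piPow, ← Units.val_pow_eq_pow_val, ← Units.val_pow_eq_pow_val,
    ← Units.val_pow_eq_pow_val, ← Units.val_mul, ← Units.val_mul]
  congr 2
  simp only [qc, C.d_mul_a_self, mul_zpow, ← zpow_natCast, ← zpow_mul, mul_inv,
    ← zpow_neg]
  rw [mul_mul_mul_comm, ← zpow_add, ← zpow_add, ← mul_assoc, ← zpow_add, C.p_mul_self]
  congr 1
  · apply piU_zpow_congr
    have hb := C.b_cast i j h
    have hd := C.d_emod_two i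
    -- The leftover $\pi$-exponent. If $i$ is even then $d_i$ is even; if $i$ is odd then $a_{ij}$
    -- is even, so $b$ is odd and one of $k$, $b-k$ is even.
    have key : Even (C.d i * (↑(k * (C.b i j - k)) : ℤ)) := by
      push_cast [hk]
      rcases Nat.le_one_iff_eq_zero_or_eq_one.mp (C.p_le i) with hp | hp
      · rw [hp] at hd
        exact (Int.even_iff.mpr (by simpa using hd)).mul_right _
      · apply Even.mul_left
        have ha : (2 : ℤ) ∣ C.a i j := C.anisotropic i j hp
        rw [Int.even_mul, Int.even_sub]
        have hb' : ¬ Even (C.b i j : ℤ) := by rw [hb, Int.even_sub]; simp [even_iff_two_dvd, ha]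
        tauto
    rw [Int.even_iff] at key
    push_cast at key ⊢
    ring_nf at key ⊢
    omega
  · congr 1
    push_cast [hk]
    have hb := C.b_cast i j h
    have h2 := two_mul_choose_two k
    have : C.a i j = 1 - C.b i j := by omega
    rw [this]
    linear_combination C.d i * h2

end SuperCartanDatum

/-! ### Serre relations for sums of $q$-commuting solutions -/

section SerreSum

variable {I A : Type*} (C : SuperCartanDatum I) [Ring A] [Algebra Coeff A]

/-- The left-hand side of the Serre relation. -/
def serreSum (i j : I) (x z : A) : A :=
  ∑ k ∈ Finset.range (C.b i j + 1), C.serreCoeff i j k • (x ^ (C.b i j - k) * z * x ^ k)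

variable {C}

theorem serreSum_eq_left {i j : I} (h : i ≠ j) (x z : A) :
    serreSum C i j x z = serreIter (C.qc i i : Coeff) (C.qc i j : Coeff) x z (C.b i j) := by
  rw [serreIter_eq_sum]
  refine Finset.sum_congr rfl fun k hk => ?_
  rw [C.serreCoeff_eq_left h (by have := Finset.mem_range.mp hk; omega)]

theorem serreSum_eq_right {i j : I} (h : i ≠ j) (x z : A) :
    serreSum C i j x z = serreIter (((C.qc i i)⁻¹ : Coeffˣ) : Coeff)
      (((C.qc i j)⁻¹ : Coeffˣ) : Coeff) x z (C.b i j) := by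
  rw [serreIter_eq_sum]
  refine Finset.sum_congr rfl fun k hk => ?_
  rw [C.serreCoeff_eq_right h (by have := Finset.mem_range.mp hk; omega)]

theorem smul_swap {u : Coeffˣ} {x y : A} (h : y * x = (u : Coeff) • (x * y)) :
    x * y = ((u⁻¹ : Coeffˣ) : Coeff) • (y * x) := by
  rw [h, smul_smul, ← Units.val_mul, inv_mul_cancel, Units.val_one, one_smul]

/-- Sums of two `q`-commuting solutions of the Serre relation are solutions. -/
theorem serreSum_add {i j : I} (h : i ≠ j) {x y z w : A}
    (hyx : y * x = (C.qc i i : Coeff) • (x * y)) (hyz : y * z = (C.qc i j : Coeff) • (z * y))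
    (hwx : w * x = (C.qc i j : Coeff) • (x * w)) (hxz : serreSum C i j x z = 0)
    (hyw : serreSum C i j y w = 0) : serreSum C i j (x + y) (z + w) = 0 := by
  -- Against $z$ the summand $y$ is the invisible one, with the parameters themselves.
  have h1 : serreSum C i j (x + y) z = 0 := by
    rw [serreSum_eq_left h, serreIter_add_left hyx hyz, ← serreSum_eq_left h, hxz]
  -- Against $w$ the roles are exchanged: $x$ commutes past $y$ and $w$ with inverse scalars, so the
  -- inverted form of the polynomial is used.
  have h2 : serreSum C i j (x + y) w = 0 := by
    rw [serreSum_eq_right h, add_comm, serreIter_add_left (smul_swap hyx) (smul_swap hwx),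
      ← serreSum_eq_right h, hyw]
  rw [serreSum_eq_left h, serreIter_add_right, ← serreSum_eq_left h, ← serreSum_eq_left h, h1, h2,
    add_zero]

end SerreSum

/-! ### Serre monomials with torus factors attached -/

section Monomials

variable {R A : Type*} [CommRing R] [Ring A] [Algebra R A]

theorem pow_mul_smul {g x : A} {a : R} (h : g * x = a • (x * g)) (m n : ℕ) :
    g ^ m * x ^ n = a ^ (m * n) • (x ^ n * g ^ m) := by
  have h1 : ∀ m : ℕ, g ^ m * x = a ^ m • (x * g ^ m) := by
    intro m
    induction m with
    | zero => simp
    | succ m ih =>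
      rw [pow_succ', mul_assoc, ih, mul_smul_comm, ← mul_assoc, h, smul_mul_assoc, smul_smul,
        mul_assoc, ← pow_succ]
  induction n with
  | zero => simp
  | succ n ih =>
    rw [pow_succ, ← mul_assoc, ih, smul_mul_assoc, mul_assoc, h1, mul_smul_comm, smul_smul,
      ← mul_assoc, ← pow_add, Nat.mul_succ]

theorem mul_pow_smul {g x : A} {a : R} (h : g * x = a • (x * g)) (n : ℕ) :
    (x * g) ^ n = a ^ n.choose 2 • (x ^ n * g ^ n) := by
  induction n with
  | zero => simp
  | succ n ih =>
    have h1 := pow_mul_smul h n 1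
    rw [pow_one, mul_one] at h1
    rw [pow_succ, ih, smul_mul_assoc, mul_assoc, ← mul_assoc _ x, h1, smul_mul_assoc,
      mul_smul_comm, smul_smul, ← pow_add, Nat.choose_succ_succ' n 1, Nat.choose_one_right,
      add_comm n, pow_succ x, pow_succ g]
    simp only [mul_assoc]

/-- Collecting all torus factors on the right leaves a scalar that depends on $k$ only through
$b^{n-k}c^k$; the self-commutation factor $a^{\binom n2}$ and the torus element $g^nh$ come out of a
Serre sum. -/
theorem serre_monomial {g h x z : A} {a b c : R} (hgx : g * x = a • (x * g))
    (hgz : g * z = b • (z * g)) (hhx : h * x = c • (x * h)) (hgh : g * h = h * g) {n k : ℕ}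
    (hk : k ≤ n) : (x * g) ^ (n - k) * (z * h) * (x * g) ^ k =
      (a ^ n.choose 2 * b ^ (n - k) * c ^ k) • (x ^ (n - k) * z * x ^ k * (g ^ n * h)) := by
  obtain ⟨m, rfl⟩ := Nat.exists_eq_add_of_le' hk
  rw [Nat.add_sub_cancel, mul_pow_smul hgx, mul_pow_smul hgx]
  have h1 := pow_mul_smul hgz m 1
  have h2 := pow_mul_smul hhx 1 k
  have h3 := pow_mul_smul hgx m k
  have h4 : h * g ^ k = g ^ k * h := (Commute.pow_right (show Commute h g from hgh.symm) k).eq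
  rw [pow_one, mul_one] at h1
  rw [pow_one, one_mul] at h2
  -- The self-commutations inside the two powers of $xg$ and those across them add up to a quantity
  -- that depends on $m+k$ alone.
  have h5 : (m + k).choose 2 = m.choose 2 + k.choose 2 + m * k := by
    have e1 := SuperCartanDatum.two_mul_choose_two (m + k)
    have e2 := SuperCartanDatum.two_mul_choose_two m
    have e3 := SuperCartanDatum.two_mul_choose_two k
    zify
    push_cast at e1
    have e4 : 2 * ((m + k).choose 2 : ℤ) = 2 * (m.choose 2 + k.choose 2 + m * k) := by
      linear_combination e1 - e2 - e3
    linarith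
  have h6 : x ^ m * g ^ m * (z * h) * (x ^ k * g ^ k) =
      (b ^ m * c ^ k * a ^ (m * k)) • (x ^ m * z * x ^ k * (g ^ (m + k) * h)) := by
    calc x ^ m * g ^ m * (z * h) * (x ^ k * g ^ k)
        = x ^ m * (g ^ m * z) * (h * x ^ k) * g ^ k := by simp only [mul_assoc]
      _ = (b ^ m * c ^ k) • (x ^ m * z * (g ^ m * x ^ k) * (h * g ^ k)) := by
          rw [h1, h2]
          simp only [mul_smul_comm, smul_mul_assoc, smul_smul, mul_assoc]
          rw [mul_comm (c ^ k)]
      _ = _ := by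
          rw [h3, h4]
          simp only [mul_smul_comm, smul_mul_assoc, smul_smul, mul_assoc, pow_add]
  rw [smul_mul_assoc, smul_mul_assoc, mul_smul_comm, h6, smul_smul, smul_smul, h5]
  congr 1
  ring

end Monomials

/-! ## Parity -/

theorem halfC_add_halfC : halfC + halfC = 1 := by
  rw [halfC, ← map_add, ← two_mul, mul_inv_cancel₀ two_ne_zero, map_one]

section Parity

variable {M : Type*} [AddCommGroup M] [Module Coeff M] (s : M →ₗ[Coeff] M)

/-- `m` is homogeneous of parity `a`, when `s` is `m ↦ (-1)^{p(m)} m`. -/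
def HasParity (a : ℕ) (m : M) : Prop := s m = (-1 : Coeff) ^ a • m

variable {s}

theorem evenPart_add_oddPart (m : M) : evenPart s m + oddPart s m = m := by
  simp only [evenPart, oddPart, LinearMap.smul_apply, LinearMap.add_apply, LinearMap.sub_apply,
    LinearMap.id_apply]
  rw [← smul_add, add_add_sub_cancel, smul_add, ← add_smul, halfC_add_halfC, one_smul]

theorem HasParity.evenPart_of_even {a : ℕ} {m : M} (h : HasParity s a m) (ha : Even a) :
    evenPart s m = m := by
  rw [HasParity, ha.neg_one_pow, one_smul] at h
  simp only [evenPart, LinearMap.smul_apply, LinearMap.add_apply, LinearMap.id_apply, h]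
  rw [smul_add, ← add_smul, halfC_add_halfC, one_smul]

theorem HasParity.oddPart_of_even {a : ℕ} {m : M} (h : HasParity s a m) (ha : Even a) :
    oddPart s m = 0 := by
  have := evenPart_add_oddPart (s := s) m
  rwa [h.evenPart_of_even ha, add_eq_left] at this

theorem HasParity.oddPart_of_odd {a : ℕ} {m : M} (h : HasParity s a m) (ha : Odd a) :
    oddPart s m = m := by
  rw [HasParity, ha.neg_one_pow, neg_one_smul] at h
  simp only [oddPart, LinearMap.smul_apply, LinearMap.sub_apply, LinearMap.id_apply, h]
  rw [sub_neg_eq_add, smul_add, ← add_smul, halfC_add_halfC, one_smul]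

theorem HasParity.evenPart_of_odd {a : ℕ} {m : M} (h : HasParity s a m) (ha : Odd a) :
    evenPart s m = 0 := by
  have := evenPart_add_oddPart (s := s) m
  rwa [h.oddPart_of_odd ha, add_eq_right] at this

theorem HasParity.piParity_eq {a : ℕ} {m : M} (h : HasParity s a m) :
    piParity s m = piPow a • m := by
  rw [piParity, LinearMap.add_apply, LinearMap.smul_apply]
  rcases Nat.even_or_odd a with ha | ha
  · rw [h.evenPart_of_even ha, h.oddPart_of_even ha, piPow_even (by exact_mod_cast ha), one_smul,
      smul_zero, add_zero]
  · have : piPow a = piPow 1 := piPow_congr (by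
      have := Nat.odd_iff.mp ha; omega)
    rw [h.evenPart_of_odd ha, h.oddPart_of_odd ha, zero_add, this]
    simp [piPow, piU]

theorem HasParity.smul {a : ℕ} {m : M} (h : HasParity s a m) (c : Coeff) : HasParity s a (c • m) := by
  rw [HasParity, map_smul, h, smul_comm]

/-- Since $s$ is an involution and $2$ is invertible, each vector is the sum of its two
eigencomponents. -/
theorem parity_induction (hs : ∀ m, s (s m) = m) {P : M → Prop}
    (hom : ∀ a m, HasParity s a m → P m) (add : ∀ m n, P m → P n → P (m + n)) (m : M) : P m := by
  rw [← evenPart_add_oddPart (s := s) m]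
  refine add _ _ (hom 0 _ ?_) (hom 1 _ ?_)
  · simp [HasParity, evenPart, hs, add_comm]
  · simp only [HasParity, oddPart, LinearMap.smul_apply, LinearMap.sub_apply, LinearMap.id_apply,
      map_smul, map_sub, hs, pow_one, neg_one_smul, ← smul_neg, neg_sub]

/-- The common shape of the twisted product and of the twisted action. -/
theorem twisted_apply {M₁ M₂ N : Type*} [AddCommGroup M₁] [Module Coeff M₁] [AddCommGroup M₂]
    [Module Coeff M₂] [AddCommGroup N] [Module Coeff N] {s₁ : M₁ →ₗ[Coeff] M₁}
    {s₂ : M₂ →ₗ[Coeff] M₂} {a b : ℕ} {y : M₁} {z : M₂} (hy : HasParity s₁ a y)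
    (hz : HasParity s₂ b z) (B : M₁ →ₗ[Coeff] M₂ →ₗ[Coeff] N) :
    B (evenPart s₁ y) z + B (oddPart s₁ y) (piParity s₂ z) = piPow (a * b) • B y z := by
  rcases Nat.even_or_odd a with ha | ha
  · rw [hy.evenPart_of_even ha, hy.oddPart_of_even ha, map_zero, LinearMap.zero_apply, add_zero,
      piPow_even ((show Even (a : ℤ) by exact_mod_cast ha).mul_right _), one_smul]
  · rw [hy.evenPart_of_odd ha, hy.oddPart_of_odd ha, map_zero, LinearMap.zero_apply, zero_add,
      hz.piParity_eq, map_smul]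
    congr 1
    apply piPow_congr
    have := Nat.odd_iff.mp ha
    rw [Int.mul_emod, show (a : ℤ) % 2 = 1 by omega, one_mul, Int.emod_emod_of_dvd _ (dvd_refl 2)]

end Parity

/-! ### The twisted tensor product algebra -/

section TwistedTensor

variable {I Y X : Type*} [AddCommGroup Y] [AddCommGroup X] {C : SuperCartanDatum I}
  {D : RootDatum C Y X} (φ : Enhancer D)

theorem signU_signU (x : EnhU φ) :
    (signU φ).toLinearMap ((signU φ).toLinearMap x) = x := by
  have : (signU φ).comp (signU φ) = AlgHom.id _ _ := by
    apply algHom_ext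
    intro g
    have h : ∀ n, (-1 : Coeff) ^ n * (-1 : Coeff) ^ n = 1 := fun n => by
      rw [← mul_pow, neg_one_mul, neg_neg, one_pow]
    cases g <;> simp [signU_gen, signGen, smul_smul, h]
  exact DFunLike.congr_fun this x

/-- `x` is homogeneous of parity `a`. -/
abbrev HasParityU (a : ℕ) (x : EnhU φ) : Prop := HasParity (signU φ).toLinearMap a x

/-- The parity of a generator. -/
def genParity (C : SuperCartanDatum I) : Gen I Y → ℕ
  | Gen.E i => C.p i
  | Gen.F i => C.p i
  | _ => 0

theorem hasParityU_gen (g : Gen I Y) : HasParityU φ (genParity C g) (gen φ g) := by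
  cases g <;> simp [HasParity, genParity, signU_gen, signGen]

theorem hasParityU_one : HasParityU φ 0 (1 : EnhU φ) := by simp [HasParity]

variable {φ}

theorem HasParityU.mul {a b : ℕ} {x y : EnhU φ} (hx : HasParityU φ a x) (hy : HasParityU φ b y) :
    HasParityU φ (a + b) (x * y) := by
  simp only [HasParity, AlgHom.toLinearMap_apply] at *
  rw [map_mul, hx, hy, smul_mul_smul_comm, pow_add]

/-- Recovers the sign rule on homogeneous tensors from the definition by even and odd parts. -/
theorem covMul_tmul {a b : ℕ} (x : EnhU φ) {y z : EnhU φ} (w : EnhU φ) (hy : HasParityU φ a y)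
    (hz : HasParityU φ b z) :
    covMul φ (x ⊗ₜ y) (z ⊗ₜ w) = piPow (a * b) • ((x * z) ⊗ₜ (y * w)) := by
  have h := twisted_apply hy hz
    (LinearMap.mk₂ Coeff (fun y z => (x ⊗ₜ[Coeff] y) * (z ⊗ₜ[Coeff] w))
      (fun y y' z => by rw [tmul_add, add_mul]) (fun c y z => by rw [tmul_smul, smul_mul_assoc])
      (fun y z z' => by rw [add_tmul, mul_add])
      (fun c y z => by rw [← smul_tmul', mul_smul_comm]))
  simp only [LinearMap.mk₂_apply, Algebra.TensorProduct.tmul_mul_tmul] at h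
  rw [← h]
  simp only [covMul, LinearMap.lTensor_tmul, LinearMap.rTensor_tmul,
    Algebra.TensorProduct.tmul_mul_tmul]

theorem covMul_add_left (a b c : EnhU φ ⊗[Coeff] EnhU φ) :
    covMul φ (a + b) c = covMul φ a c + covMul φ b c := by
  simp only [covMul, map_add, add_mul]; abel

theorem covMul_add_right (a b c : EnhU φ ⊗[Coeff] EnhU φ) :
    covMul φ a (b + c) = covMul φ a b + covMul φ a c := by
  simp only [covMul, map_add, mul_add]; abel

theorem covMul_smul_left (r : Coeff) (a b : EnhU φ ⊗[Coeff] EnhU φ) :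
    covMul φ (r • a) b = r • covMul φ a b := by
  simp only [covMul, map_smul, smul_mul_assoc, smul_add]

theorem covMul_smul_right (r : Coeff) (a b : EnhU φ ⊗[Coeff] EnhU φ) :
    covMul φ a (r • b) = r • covMul φ a b := by
  simp only [covMul, map_smul, mul_smul_comm, smul_add]

theorem covMul_zero_left (a : EnhU φ ⊗[Coeff] EnhU φ) : covMul φ 0 a = 0 := by simp [covMul]

theorem covMul_zero_right (a : EnhU φ ⊗[Coeff] EnhU φ) : covMul φ a 0 = 0 := by simp [covMul]

theorem tensor_parity_induction {M N : Type*} [AddCommGroup M] [Module Coeff M] [AddCommGroup N]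
    [Module Coeff N] {s : M →ₗ[Coeff] M} {s' : N →ₗ[Coeff] N} (hs : ∀ m, s (s m) = m)
    (hs' : ∀ m, s' (s' m) = m) {P : M ⊗[Coeff] N → Prop} (zero : P 0)
    (hom : ∀ a b m n, HasParity s a m → HasParity s' b n → P (m ⊗ₜ n))
    (add : ∀ m n, P m → P n → P (m + n)) (t : M ⊗[Coeff] N) : P t := by
  induction t with
  | zero => exact zero
  | add x y hx hy => exact add x y hx hy
  | tmul x y =>
    refine parity_induction (P := fun x => P (x ⊗ₜ[Coeff] y)) hs (fun a m hm => ?_)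
      (fun m n hm hn => by rw [add_tmul]; exact add _ _ hm hn) x
    exact parity_induction (P := fun y => P (m ⊗ₜ[Coeff] y)) hs' (fun b n hn => hom a b m n hm hn)
      (fun m n hm hn => by rw [tmul_add]; exact add _ _ hm hn) y

/-- By trilinearity it is enough to take homogeneous pure tensors $x\otimes y$, $z\otimes w$,
$u\otimes v$. Both bracketings then give the $\pi$-exponent $p(y)p(z)+p(y)p(u)+p(w)p(u)$. -/
theorem covMul_assoc (a b c : EnhU φ ⊗[Coeff] EnhU φ) :
    covMul φ (covMul φ a b) c = covMul φ a (covMul φ b c) := by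
  have hs := signU_signU φ
  refine tensor_parity_induction (P := fun a => covMul φ (covMul φ a b) c =
    covMul φ a (covMul φ b c)) hs hs ?_ (fun a₁ a₂ x y hx hy => ?_) ?_ a
  · simp only [covMul_zero_left]
  · refine tensor_parity_induction (P := fun b => covMul φ (covMul φ (x ⊗ₜ y) b) c =
      covMul φ (x ⊗ₜ y) (covMul φ b c)) hs hs ?_ (fun b₁ b₂ z w hz hw => ?_) ?_ b
    · simp only [covMul_zero_left, covMul_zero_right]
    · refine tensor_parity_induction (P := fun c => covMul φ (covMul φ (x ⊗ₜ y) (z ⊗ₜ w)) c =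
        covMul φ (x ⊗ₜ y) (covMul φ (z ⊗ₜ w) c)) hs hs ?_ (fun c₁ c₂ u v hu hv => ?_) ?_ c
      · simp only [covMul_zero_right]
      · rw [covMul_tmul _ _ hy hz, covMul_tmul _ _ hw hu, covMul_smul_left, covMul_smul_right,
          covMul_tmul _ _ (HasParityU.mul hy hw) hu,
          covMul_tmul _ _ hy (HasParityU.mul hz hu), smul_smul, smul_smul,
          ← piPow_add, ← piPow_add, mul_assoc, mul_assoc]
        congr 2
        push_cast
        ring
      · intro m n hm hn; simp only [covMul_add_right, hm, hn]
    · intro m n hm hn; simp only [covMul_add_right, covMul_add_left, hm, hn]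
  · intro m n hm hn; simp only [covMul_add_left, hm, hn]

theorem covMul_one_left (a : EnhU φ ⊗[Coeff] EnhU φ) : covMul φ (1 ⊗ₜ 1) a = a := by
  have hs := signU_signU φ
  refine tensor_parity_induction (P := fun a => covMul φ (1 ⊗ₜ 1) a = a) hs hs
    (covMul_zero_right _) (fun a b x y hx hy => ?_) (fun m n hm hn => ?_) a
  · rw [covMul_tmul _ _ (hasParityU_one φ) hx]; simp [piPow_even]
  · rw [covMul_add_right, hm, hn]

theorem covMul_one_right (a : EnhU φ ⊗[Coeff] EnhU φ) : covMul φ a (1 ⊗ₜ 1) = a := by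
  have hs := signU_signU φ
  refine tensor_parity_induction (P := fun a => covMul φ a (1 ⊗ₜ 1) = a) hs hs
    (covMul_zero_left _) (fun a b x y hx hy => ?_) (fun m n hm hn => ?_) a
  · rw [covMul_tmul _ _ hy (hasParityU_one φ)]; simp [piPow_even]
  · rw [covMul_add_left, hm, hn]

variable (φ)

/-- The space `Û ⊗ Û` with its twisted product. -/
def CovTensor : Type _ := EnhU φ ⊗[Coeff] EnhU φ

instance : AddCommGroup (CovTensor φ) := inferInstanceAs (AddCommGroup (EnhU φ ⊗[Coeff] EnhU φ))

instance : Module Coeff (CovTensor φ) := inferInstanceAs (Module Coeff (EnhU φ ⊗[Coeff] EnhU φ))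

instance : Ring (CovTensor φ) :=
  { (inferInstance : AddCommGroup (CovTensor φ)) with
    mul := covMul φ
    one := (1 : EnhU φ) ⊗ₜ[Coeff] (1 : EnhU φ)
    left_distrib := covMul_add_right
    right_distrib := covMul_add_left
    zero_mul := covMul_zero_left
    mul_zero := covMul_zero_right
    mul_assoc := covMul_assoc
    one_mul := covMul_one_left
    mul_one := covMul_one_right }

instance : Algebra Coeff (CovTensor φ) := Algebra.ofModule covMul_smul_left
  (fun r x y => covMul_smul_right r x y)

/-- The pure tensor `x ⊗ y` as an element of the twisted tensor product. -/
def ctmul (x y : EnhU φ) : CovTensor φ := x ⊗ₜ[Coeff] y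

variable {φ}

theorem ctmul_mul {a b : ℕ} (x : EnhU φ) {y z : EnhU φ} (w : EnhU φ) (hy : HasParityU φ a y)
    (hz : HasParityU φ b z) :
    ctmul φ x y * ctmul φ z w = piPow (a * b) • ctmul φ (x * z) (y * w) :=
  covMul_tmul x w hy hz

theorem ctmul_mul_of_even_left {b : ℕ} (x : EnhU φ) {y z : EnhU φ} (w : EnhU φ)
    (hy : HasParityU φ 0 y) (hz : HasParityU φ b z) :
    ctmul φ x y * ctmul φ z w = ctmul φ (x * z) (y * w) := by
  rw [ctmul_mul x w hy hz]; simp [piPow_even]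

theorem ctmul_mul_of_even_right {a : ℕ} (x : EnhU φ) {y z : EnhU φ} (w : EnhU φ)
    (hy : HasParityU φ a y) (hz : HasParityU φ 0 z) :
    ctmul φ x y * ctmul φ z w = ctmul φ (x * z) (y * w) := by
  rw [ctmul_mul x w hy hz]; simp [piPow_even]

theorem ctmul_smul_left (r : Coeff) (x y : EnhU φ) : ctmul φ (r • x) y = r • ctmul φ x y := rfl

theorem ctmul_smul_right (r : Coeff) (x y : EnhU φ) : ctmul φ x (r • y) = r • ctmul φ x y :=
  tmul_smul r x y

theorem ctmul_sub_left (x x' y : EnhU φ) : ctmul φ (x - x') y = ctmul φ x y - ctmul φ x' y :=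
  sub_tmul x x' y

theorem ctmul_sub_right (x y y' : EnhU φ) : ctmul φ x (y - y') = ctmul φ x y - ctmul φ x y' :=
  tmul_sub x y y'

theorem ctmul_zero_left (y : EnhU φ) : ctmul φ 0 y = 0 := zero_tmul _ y

theorem ctmul_zero_right (x : EnhU φ) : ctmul φ x 0 = 0 := tmul_zero _ x

theorem ctmul_one_one : ctmul φ 1 1 = 1 := rfl

variable (φ)

/-- The algebra map `x ↦ x ⊗ 1`. -/
def inl : EnhU φ →ₐ[Coeff] CovTensor φ :=
  AlgHom.ofLinearMap ((TensorProduct.mk Coeff (EnhU φ) (EnhU φ)).flip 1) rfl fun x y => by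
    change ctmul φ (x * y) 1 = ctmul φ x 1 * ctmul φ y 1
    refine parity_induction (P := fun y => ctmul φ (x * y) 1 = ctmul φ x 1 * ctmul φ y 1)
      (signU_signU φ) (fun a m hm => ?_) (fun m n hm hn => ?_) y
    · rw [ctmul_mul_of_even_left _ _ (hasParityU_one φ) hm, mul_one]
    · have h : ∀ u v : EnhU φ, ctmul φ (u + v) 1 = ctmul φ u 1 + ctmul φ v 1 := fun u v =>
        add_tmul u v 1
      rw [mul_add, h, hm, hn, ← mul_add, ← h]

/-- The algebra map `y ↦ 1 ⊗ y`. -/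
def inr : EnhU φ →ₐ[Coeff] CovTensor φ :=
  AlgHom.ofLinearMap (TensorProduct.mk Coeff (EnhU φ) (EnhU φ) 1) rfl fun x y => by
    change ctmul φ 1 (x * y) = ctmul φ 1 x * ctmul φ 1 y
    refine parity_induction (P := fun x => ctmul φ 1 (x * y) = ctmul φ 1 x * ctmul φ 1 y)
      (signU_signU φ) (fun a m hm => ?_) (fun m n hm hn => ?_) x
    · rw [ctmul_mul_of_even_right _ _ hm (hasParityU_one φ), mul_one]
    · have h : ∀ u v : EnhU φ, ctmul φ 1 (u + v) = ctmul φ 1 u + ctmul φ 1 v := fun u v =>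
        tmul_add 1 u v
      rw [add_mul, h, hm, hn, ← add_mul, ← h]

theorem inl_apply (x : EnhU φ) : inl φ x = ctmul φ x 1 := rfl

theorem inr_apply (x : EnhU φ) : inr φ x = ctmul φ 1 x := rfl

variable {φ}

theorem inl_mul_inr (x y : EnhU φ) : inl φ x * inr φ y = ctmul φ x y := by
  rw [inl_apply, inr_apply, ctmul_mul_of_even_right _ _ (hasParityU_one φ) (hasParityU_one φ),
    mul_one, one_mul]

/-- With `inl_mul_inr` this lets relations in the twisted algebra be checked by commuting two
ordinary copies of $\widehat{\mathbf U}$ past each other. -/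
theorem inr_mul_inl {a b : ℕ} {x y : EnhU φ} (hy : HasParityU φ a y) (hx : HasParityU φ b x) :
    inr φ y * inl φ x = piPow (a * b) • (inl φ x * inr φ y) := by
  rw [inl_mul_inr, inl_apply, inr_apply, ctmul_mul _ _ hy hx, mul_one, one_mul]

end TwistedTensor

/-! ## The coproduct -/

section Coproduct

variable {I Y X : Type*} [AddCommGroup Y] [AddCommGroup X] {C : SuperCartanDatum I}
  {D : RootDatum C Y X} (φ : Enhancer D)

theorem hasParity_E (i : I) : HasParityU φ (C.p i) (uE φ i) := hasParityU_gen φ (Gen.E i)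
theorem hasParity_F (i : I) : HasParityU φ (C.p i) (uF φ i) := hasParityU_gen φ (Gen.F i)
theorem hasParity_K (μ : Y) : HasParityU φ 0 (uK φ μ) := hasParityU_gen φ (Gen.K μ)
theorem hasParity_J (μ : Y) : HasParityU φ 0 (uJ φ μ) := hasParityU_gen φ (Gen.J μ)
theorem hasParity_T (μ : Y) : HasParityU φ 0 (uT φ μ) := hasParityU_gen φ (Gen.T μ)
theorem hasParity_Ups (ν : I →₀ ℤ) : HasParityU φ 0 (uUps φ ν) := hasParityU_gen φ (Gen.Ups ν)

theorem hasParity_JK (i : I) : HasParityU φ 0 (uJt φ 1 i * uKt φ 1 i) :=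
  HasParityU.mul (hasParity_J φ _) (hasParity_K φ _)

theorem K_K (μ ν : Y) : uK φ μ * uK φ ν = uK φ ν * uK φ μ := by
  rw [K_add, K_add, add_comm]

theorem Kt_E (n : ℤ) (i j : I) :
    uKt φ n i * uE φ j = vPow (n * (C.d i * C.a i j)) • (uE φ j * uKt φ n i) := by
  rw [uKt, K_E, pairing_til]

theorem Kt_F (n : ℤ) (i j : I) :
    uKt φ n i * uF φ j = vPow (-(n * (C.d i * C.a i j))) • (uF φ j * uKt φ n i) := by
  rw [uKt, K_F, pairing_til]

/-- $\tilde J_i$ commutes with every $E_j$ because $d_ia_{ij}$ is even, so only $\tilde K_i$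
contributes. -/
theorem JK_E (i j : I) : uJt φ 1 i * uKt φ 1 i * uE φ j =
    vPow (C.d i * C.a i j) • (uE φ j * (uJt φ 1 i * uKt φ 1 i)) := by
  rw [mul_assoc, Kt_E, mul_smul_comm, ← mul_assoc (uJt φ 1 i), (Jt_E φ 1 i j).eq, mul_assoc (uE φ j), one_mul]

theorem JK_F (i j : I) : uJt φ 1 i * uKt φ 1 i * uF φ j =
    vPow (-(C.d i * C.a i j)) • (uF φ j * (uJt φ 1 i * uKt φ 1 i)) := by
  rw [mul_assoc, Kt_F, mul_smul_comm, ← mul_assoc (uJt φ 1 i), (Jt_F φ 1 i j).eq, mul_assoc (uF φ j), one_mul]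

theorem commute_JK_K (i : I) (μ : Y) : Commute (uK φ μ) (uJt φ 1 i * uKt φ 1 i) :=
  Commute.mul_right (J_K φ _ _).symm (K_K φ _ _)

theorem commute_JK_J (i : I) (μ : Y) : Commute (uJ φ μ) (uJt φ 1 i * uKt φ 1 i) :=
  Commute.mul_right (J_J φ _ _) (J_K φ _ _)

theorem commute_JK_JK (i j : I) :
    Commute (uJt φ 1 i * uKt φ 1 i) (uJt φ 1 j * uKt φ 1 j) :=
  Commute.mul_left (commute_JK_J φ _ _) (commute_JK_K φ _ _)

open Gen in
/-- The values of the coproduct on generators. -/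
def coprodGen : Gen I Y → CovTensor φ
  | E i => ctmul φ (uE φ i) (uKt φ (-1) i) + ctmul φ 1 (uE φ i)
  | F i => ctmul φ (uF φ i) 1 + ctmul φ (uJt φ 1 i * uKt φ 1 i) (uF φ i)
  | g => ctmul φ (gen φ g) (gen φ g)

variable {φ}

theorem ctmul_even {g h : EnhU φ} (hg : HasParityU φ 0 g) (hh : HasParityU φ 0 h) :
    ctmul φ g g * ctmul φ h h = ctmul φ (g * h) (g * h) := ctmul_mul_of_even_left _ _ hg hh

theorem ctmul_even_pow {g : EnhU φ} (hg : HasParityU φ 0 g) (n : ℕ) :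
    ctmul φ g g ^ n = ctmul φ (g ^ n) (g ^ n) := by
  have hp : ∀ n, HasParityU φ 0 (g ^ n) := by
    intro n
    induction n with
    | zero => rw [pow_zero]; exact hasParityU_one φ
    | succ n ih => rw [pow_succ]; exact HasParityU.mul ih hg
  induction n with
  | zero => simp [ctmul_one_one]
  | succ n ih => rw [pow_succ, ih, ctmul_even (hp n) hg, pow_succ]

theorem coprod_torus_E {g : EnhU φ} {i : I} {s : Coeff} (hg : HasParityU φ 0 g)
    (hE : g * uE φ i = s • (uE φ i * g)) (hK : g * uKt φ (-1) i = uKt φ (-1) i * g) :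
    ctmul φ g g * coprodGen φ (Gen.E i) = s • (coprodGen φ (Gen.E i) * ctmul φ g g) := by
  simp only [coprodGen]
  rw [mul_add, add_mul, ctmul_mul_of_even_left _ _ hg (hasParity_E φ i),
    ctmul_mul_of_even_left _ _ hg (hasParityU_one φ),
    ctmul_mul_of_even_right _ _ (hasParity_K φ _) hg,
    ctmul_mul_of_even_right _ _ (hasParity_E φ i) hg, hE, hK, ctmul_smul_left, ctmul_smul_right,
    mul_one, one_mul, smul_add]

theorem coprod_torus_F {g : EnhU φ} {i : I} {s : Coeff} (hg : HasParityU φ 0 g)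
    (hF : g * uF φ i = s • (uF φ i * g))
    (hK : g * (uJt φ 1 i * uKt φ 1 i) = uJt φ 1 i * uKt φ 1 i * g) :
    ctmul φ g g * coprodGen φ (Gen.F i) = s • (coprodGen φ (Gen.F i) * ctmul φ g g) := by
  simp only [coprodGen]
  rw [mul_add, add_mul, ctmul_mul_of_even_left _ _ hg (hasParity_F φ i),
    ctmul_mul_of_even_left _ _ hg (hasParity_JK φ i),
    ctmul_mul_of_even_right _ _ (hasParityU_one φ) hg,
    ctmul_mul_of_even_right _ _ (hasParity_F φ i) hg, hF, hK, ctmul_smul_left, ctmul_smul_right,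
    mul_one, one_mul, smul_add]

/-- The mixed terms cancel in pairs: $F_j\otimes E_i$ by the sign rule, and the pair with torus
elements because $\tilde K_{-i}$ past $F_j$ and $\tilde J_j\tilde K_j$ past $E_i$ cost the same
power of $v$, the form being symmetric. -/
theorem coprod_E_F (i j : I) :
    coprodGen φ (Gen.E i) * coprodGen φ (Gen.F j) -
      piPow (C.p i * C.p j) • (coprodGen φ (Gen.F j) * coprodGen φ (Gen.E i)) =
    ctmul φ (uE φ i * uF φ j - piPow (C.p i * C.p j) • (uF φ j * uE φ i)) (uKt φ (-1) i) +
      ctmul φ (uJt φ 1 j * uKt φ 1 j)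
        (uE φ i * uF φ j - piPow (C.p i * C.p j) • (uF φ j * uE φ i)) := by
  simp only [coprodGen]
  simp only [mul_add, add_mul]
  rw [ctmul_mul_of_even_left _ _ (hasParity_K φ _) (hasParity_F φ j),
    ctmul_mul_of_even_right _ _ (hasParity_K φ _) (hasParity_JK φ j),
    ctmul_mul_of_even_right _ _ (hasParity_E φ i) (hasParity_JK φ j),
    ctmul_mul _ _ (hasParity_E φ i) (hasParity_F φ j),
    ctmul_mul_of_even_left _ _ (hasParityU_one φ) (hasParity_E φ i),
    ctmul_mul_of_even_left _ _ (hasParityU_one φ) (hasParityU_one φ),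
    ctmul_mul _ _ (hasParity_F φ j) (hasParity_E φ i),
    ctmul_mul_of_even_right _ _ (hasParity_F φ j) (hasParityU_one φ),
    JK_E, Kt_F, C.d_mul_a_symm j i]
  simp only [ctmul_smul_left, ctmul_smul_right, ctmul_sub_left, ctmul_sub_right, one_mul, mul_one,
    smul_add, smul_smul]
  rw [mul_comm (C.p j : ℤ), ← mul_assoc (piPow _) (piPow _), piPow_self, one_mul, neg_one_mul,
    neg_neg]
  abel

/-- The two tensor legs commute, since the torus leg is even. The torus monomial is therefore a
common right factor of a Serre sum living in the first leg. -/
theorem serreSum_ctmul_E (i j : I) (h : i ≠ j) : serreSum C i j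
    (ctmul φ (uE φ i) (uKt φ (-1) i)) (ctmul φ (uE φ j) (uKt φ (-1) j)) = 0 := by
  have hc : ∀ a b : I, inr φ (uKt φ (-1) a) * inl φ (uE φ b) =
      (1 : Coeff) • (inl φ (uE φ b) * inr φ (uKt φ (-1) a)) := fun a b => by
    rw [inr_mul_inl (hasParity_K φ _) (hasParity_E φ b)]; simp [piPow_even]
  have hg : inr φ (uKt φ (-1) i) * inr φ (uKt φ (-1) j) =
      inr φ (uKt φ (-1) j) * inr φ (uKt φ (-1) i) := by rw [← map_mul, K_K, map_mul]
  rw [← inl_mul_inr, ← inl_mul_inr, serreSum]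
  have key := congrArg (inl φ) (E_serre φ i j h)
  simp only [map_sum, map_smul, map_mul, map_pow, map_zero] at key
  calc _ = ∑ k ∈ Finset.range (C.b i j + 1), C.serreCoeff i j k •
        (inl φ (uE φ i) ^ (C.b i j - k) * inl φ (uE φ j) * inl φ (uE φ i) ^ k) *
          (inr φ (uKt φ (-1) i) ^ C.b i j * inr φ (uKt φ (-1) j)) := by
        refine Finset.sum_congr rfl fun k hk => ?_
        rw [serre_monomial (hc i i) (hc i j) (hc j i) hg
          (by have := Finset.mem_range.mp hk; omega)]
        simp only [one_pow, mul_one, one_smul, smul_mul_assoc]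
    _ = 0 := by rw [← Finset.sum_mul, key, zero_mul]

theorem serreSum_ctmul_F (i j : I) (h : i ≠ j) : serreSum C i j
    (ctmul φ (uJt φ 1 i * uKt φ 1 i) (uF φ i)) (ctmul φ (uJt φ 1 j * uKt φ 1 j) (uF φ j)) = 0 := by
  have hc : ∀ a b : I, inl φ (uJt φ 1 a * uKt φ 1 a) * inr φ (uF φ b) =
      (1 : Coeff) • (inr φ (uF φ b) * inl φ (uJt φ 1 a * uKt φ 1 a)) := fun a b => by
    rw [inr_mul_inl (hasParity_F φ b) (hasParity_JK φ a)]; simp [piPow_even]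
  have hg : inl φ (uJt φ 1 i * uKt φ 1 i) * inl φ (uJt φ 1 j * uKt φ 1 j) =
      inl φ (uJt φ 1 j * uKt φ 1 j) * inl φ (uJt φ 1 i * uKt φ 1 i) := by
    rw [← map_mul, (commute_JK_JK φ i j).eq, map_mul]
  have hs := fun a => (hc a a).trans (one_smul _ _)
  rw [← inl_mul_inr, ← inl_mul_inr, hs, hs, serreSum]
  have key := congrArg (inr φ) (F_serre φ i j h)
  simp only [map_sum, map_smul, map_mul, map_pow, map_zero] at key
  calc _ = ∑ k ∈ Finset.range (C.b i j + 1), C.serreCoeff i j k •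
        (inr φ (uF φ i) ^ (C.b i j - k) * inr φ (uF φ j) * inr φ (uF φ i) ^ k) *
          (inl φ (uJt φ 1 i * uKt φ 1 i) ^ C.b i j * inl φ (uJt φ 1 j * uKt φ 1 j)) := by
        refine Finset.sum_congr rfl fun k hk => ?_
        rw [serre_monomial (hc i i) (hc i j) (hc j i) hg
          (by have := Finset.mem_range.mp hk; omega)]
        simp only [one_pow, mul_one, one_smul, smul_mul_assoc]
    _ = 0 := by rw [← Finset.sum_mul, key, zero_mul]

theorem qc_val (C : SuperCartanDatum I) (i j : I) :
    (C.qc i j : Coeff) = piPow (C.p i * C.p j) * vPow (C.d i * C.a i j) := rfl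

theorem vPow_add (a b : ℤ) : vPow (a + b) = vPow a * vPow b := by simp [vPow, zpow_add]

theorem vPow_zero : vPow 0 = 1 := by simp [vPow]

theorem piPow_zero : piPow 0 = 1 := by simp [piPow]

/-- The $\pi$-part of $q_{ij}$ comes from the sign rule, the $v$-part from moving $E_i$ past $\tilde
K_{-j}$ in the second leg. This is what makes `serreSum_add` applicable. -/
theorem ctmul_E_comm (i j : I) : ctmul φ 1 (uE φ i) * ctmul φ (uE φ j) (uKt φ (-1) j) =
    (C.qc i j : Coeff) • (ctmul φ (uE φ j) (uKt φ (-1) j) * ctmul φ 1 (uE φ i)) := by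
  rw [ctmul_mul _ _ (hasParity_E φ i) (hasParity_E φ j),
    ctmul_mul_of_even_left _ _ (hasParity_K φ _) (hasParityU_one φ), Kt_E, ctmul_smul_right,
    smul_smul, qc_val, C.d_mul_a_symm i j, mul_assoc, ← vPow_add, neg_one_mul, add_neg_cancel,
    vPow_zero, mul_one, one_mul, mul_one]

theorem ctmul_F_comm (i j : I) : ctmul φ (uF φ j) 1 * ctmul φ (uJt φ 1 i * uKt φ 1 i) (uF φ i) =
    (C.qc i j : Coeff) • (ctmul φ (uJt φ 1 i * uKt φ 1 i) (uF φ i) * ctmul φ (uF φ j) 1) := by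
  rw [ctmul_mul _ _ (hasParity_F φ i) (hasParity_F φ j),
    ctmul_mul_of_even_left _ _ (hasParityU_one φ) (hasParity_JK φ _), JK_F, ctmul_smul_left,
    smul_smul, smul_smul, qc_val, mul_right_comm (piPow _), piPow_self, one_mul, one_mul,
    ← vPow_add, add_neg_cancel, vPow_zero, one_smul, mul_one]

theorem serreSum_coprod_E (i j : I) (h : i ≠ j) :
    serreSum C i j (coprodGen φ (Gen.E i)) (coprodGen φ (Gen.E j)) = 0 := by
  refine serreSum_add h (ctmul_E_comm i i) (ctmul_E_comm i j) ?_ (serreSum_ctmul_E i j h) ?_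
  · rw [ctmul_E_comm, C.qc_symm]
  · have key := congrArg (inr φ) (E_serre φ i j h)
    simp only [map_sum, map_smul, map_mul, map_pow, map_zero] at key
    exact key

theorem serreSum_coprod_F (i j : I) (h : i ≠ j) :
    serreSum C i j (coprodGen φ (Gen.F i)) (coprodGen φ (Gen.F j)) = 0 := by
  simp only [coprodGen]
  -- For $F$ the $q$-commutation runs in the opposite direction, so the summand $F\otimes1$ must
  -- take the role of the added element.
  rw [add_comm, add_comm (ctmul φ (uF φ j) 1)]
  refine serreSum_add h (ctmul_F_comm i i) ?_ (ctmul_F_comm i j) (serreSum_ctmul_F i j h) ?_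
  · rw [ctmul_F_comm, C.qc_symm]
  · have key := congrArg (inl φ) (F_serre φ i j h)
    simp only [map_sum, map_smul, map_mul, map_pow, map_zero] at key
    exact key

variable (φ)

theorem coprod_rel ⦃x y : FreeAlgebra Coeff (Gen I Y)⦄ (h : Rel φ x y) :
    FreeAlgebra.lift Coeff (coprodGen φ) x = FreeAlgebra.lift Coeff (coprodGen φ) y := by
  have cK : ∀ μ, coprodGen φ (Gen.K μ) = ctmul φ (uK φ μ) (uK φ μ) := fun _ => rfl
  have cJ : ∀ μ, coprodGen φ (Gen.J μ) = ctmul φ (uJ φ μ) (uJ φ μ) := fun _ => rfl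
  have cT : ∀ μ, coprodGen φ (Gen.T μ) = ctmul φ (uT φ μ) (uT φ μ) := fun _ => rfl
  have cU : ∀ μ, coprodGen φ (Gen.Ups μ) = ctmul φ (uUps φ μ) (uUps φ μ) := fun _ => rfl
  have hK := hasParity_K φ
  have hJ := hasParity_J φ
  have hT := hasParity_T φ
  have hU := hasParity_Ups φ
  induction h with
  | E_serre i j hij =>
    simp only [map_mul, map_smul, map_sum, map_pow, map_zero, FreeAlgebra.lift_ι_apply]
    exact serreSum_coprod_E i j hij
  | F_serre i j hij =>
    simp only [map_mul, map_smul, map_sum, map_pow, map_zero, FreeAlgebra.lift_ι_apply]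
    exact serreSum_coprod_F i j hij
  | E_F_self i =>
    simp only [map_mul, map_smul, map_sub, FreeAlgebra.lift_ι_apply]
    rw [coprod_E_F, E_F_self, cJ, cK, cK, ctmul_even (hJ _) (hK _), ctmul_smul_left,
      ctmul_smul_right, ← smul_add, ctmul_sub_left, ctmul_sub_right, sub_add_sub_cancel']
  | E_F i j hij =>
    simp only [map_mul, map_smul, map_sub, map_zero, FreeAlgebra.lift_ι_apply]
    rw [coprod_E_F, E_F φ i j hij, ctmul_zero_left, ctmul_zero_right, add_zero]
  | J_E μ i =>
    simp only [map_mul, map_smul, FreeAlgebra.lift_ι_apply, cJ]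
    exact coprod_torus_E (hJ _) (J_E φ μ i) (J_K φ _ _)
  | K_E μ i =>
    simp only [map_mul, map_smul, FreeAlgebra.lift_ι_apply, cK]
    exact coprod_torus_E (hK _) (K_E φ μ i) (K_K φ _ _)
  | T_E μ i =>
    simp only [map_mul, map_smul, FreeAlgebra.lift_ι_apply, cT]
    exact coprod_torus_E (hT _) (T_E φ μ i) (T_K φ _ _)
  | Ups_E μ i =>
    simp only [map_mul, map_smul, FreeAlgebra.lift_ι_apply, cU]
    exact coprod_torus_E (hU _) (Ups_E φ μ i) (Ups_K φ _ _)
  | J_F μ i =>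
    simp only [map_mul, map_smul, FreeAlgebra.lift_ι_apply, cJ]
    exact coprod_torus_F (hJ _) (J_F φ μ i) (commute_JK_J φ _ _)
  | K_F μ i =>
    simp only [map_mul, map_smul, FreeAlgebra.lift_ι_apply, cK]
    exact coprod_torus_F (hK _) (K_F φ μ i) (commute_JK_K φ _ _)
  | T_F μ i =>
    simp only [map_mul, map_smul, FreeAlgebra.lift_ι_apply, cT]
    exact coprod_torus_F (hT _) (T_F φ μ i) (Commute.mul_right (T_J φ _ _) (T_K φ _ _))
  | Ups_F μ i =>
    simp only [map_mul, map_smul, FreeAlgebra.lift_ι_apply, cU]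
    exact coprod_torus_F (hU _) (Ups_F φ μ i) (Commute.mul_right (Ups_J φ _ _) (Ups_K φ _ _))
  | _ =>
    simp only [map_mul, map_pow, map_one, FreeAlgebra.lift_ι_apply, cK, cJ, cT, cU,
      ctmul_even (hK _) (hK _), ctmul_even (hJ _) (hJ _), ctmul_even (hT _) (hT _),
      ctmul_even (hU _) (hU _), ctmul_even (hJ _) (hK _), ctmul_even (hK _) (hJ _),
      ctmul_even (hT _) (hU _), ctmul_even (hU _) (hT _), ctmul_even (hT _) (hK _),
      ctmul_even (hK _) (hT _), ctmul_even (hT _) (hJ _), ctmul_even (hJ _) (hT _),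
      ctmul_even (hU _) (hK _), ctmul_even (hK _) (hU _), ctmul_even (hU _) (hJ _),
      ctmul_even (hJ _) (hU _), ctmul_even_pow (hJ _), ctmul_even_pow (hT _),
      ctmul_even_pow (hU _), J_add, K_add, K_zero,
      J_zero, J_sq, J_K, T_add, Ups_add, T_zero, Ups_zero, T_four, Ups_four, T_Ups, T_K, T_J,
      Ups_K, Ups_J, ctmul_one_one]

/-- The coproduct as an algebra map to the twisted tensor product. -/
def coprod : EnhU φ →ₐ[Coeff] CovTensor φ := liftU φ (coprodGen φ) (coprod_rel φ)

theorem coprod_gen (g : Gen I Y) : coprod φ (gen φ g) = coprodGen φ g := liftU_gen φ _ _ g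

theorem isCoproduct_coprod : IsCoproduct φ (coprod φ).toLinearMap where
  map_one := map_one (coprod φ)
  map_mul := map_mul (coprod φ)
  map_E i := coprod_gen φ (Gen.E i)
  map_F i := coprod_gen φ (Gen.F i)
  map_K i := coprod_gen φ (Gen.K i)
  map_J i := coprod_gen φ (Gen.J i)
  map_T i := coprod_gen φ (Gen.T i)
  map_Ups i := coprod_gen φ (Gen.Ups i)

/-- Multiplicativity for `covMul` makes $\Delta$ an algebra map into `CovTensor`, and such a map is
determined on generators. -/
theorem IsCoproduct.eq_coprod {Δ : EnhU φ →ₗ[Coeff] EnhU φ ⊗[Coeff] EnhU φ}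
    (h : IsCoproduct φ Δ) : Δ = (coprod φ).toLinearMap := by
  let Δ' : EnhU φ →ₐ[Coeff] CovTensor φ := AlgHom.ofLinearMap Δ h.map_one h.map_mul
  have : Δ' = coprod φ := by
    apply algHom_ext
    intro g
    rw [coprod_gen]
    cases g with
    | E i => exact h.map_E i
    | F i => exact h.map_F i
    | K i => exact h.map_K i
    | J i => exact h.map_J i
    | T i => exact h.map_T i
    | Ups i => exact h.map_Ups i
  exact congrArg AlgHom.toLinearMap this

theorem existsUnique_coproduct : ∃! Δ, IsCoproduct φ Δ :=
  ⟨_, isCoproduct_coprod φ, fun _ h => h.eq_coprod⟩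

end Coproduct

/-! ## The semilinear structure: `v ↦ t⁻¹ v`, `π ↦ -π` -/

/-- `t` as a unit. -/
def tU : Coeffˣ := Units.map (algebraMap GaussQ Coeff).toMonoidHom (Units.mk0 tt tt_ne_zero)

theorem tPow_eq (n : ℤ) : tPow n = ((tU ^ n : Coeffˣ) : Coeff) := by
  rw [tU, ← map_zpow, Units.coe_map, Units.val_zpow_eq_zpow_val]
  rfl

theorem vU_val : (vU : Coeff) = algebraMap (RatFunc GaussQ) Coeff RatFunc.X := rfl

/-- Lets the sign in $\pi\mapsto-\pi$ be recorded as a power of $\mathbf t$, so that `sigma` scales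
each monomial in $\pi,v$ by a single power of $\mathbf t$. -/
theorem tU_sq : ((tU ^ (2 : ℤ) : Coeffˣ) : Coeff) = -1 := by
  rw [← tPow_eq, tPow]
  have : tt ^ (2 : ℤ) = -1 := by exact_mod_cast tt_sq
  rw [this, map_neg, map_one]

/-- Two ring homomorphisms out of the coefficient ring agree if they agree on `ℚ(t)`, `v`, `π`. -/
theorem coeff_ringHom_ext {B : Type*} [Ring B] {f g : Coeff →+* B}
    (ht : ∀ c : GaussQ, f (algebraMap GaussQ Coeff c) = g (algebraMap GaussQ Coeff c))
    (hv : f (vPow 1) = g (vPow 1)) (hp : f piElt = g piElt) : f = g := by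
  have hv' : f (algebraMap (RatFunc GaussQ) Coeff RatFunc.X) =
      g (algebraMap (RatFunc GaussQ) Coeff RatFunc.X) := by
    simpa [vPow, vU_val] using hv
  let f' := (f.comp (algebraMap (RatFunc GaussQ) Coeff))
  let g' := (g.comp (algebraMap (RatFunc GaussQ) Coeff))
  have hpoly : f'.comp (algebraMap GaussQ[X] (RatFunc GaussQ)) =
      g'.comp (algebraMap GaussQ[X] (RatFunc GaussQ)) := by
    apply Polynomial.ringHom_ext
    · intro a
      rw [RingHom.comp_apply, RingHom.comp_apply, RatFunc.algebraMap_C]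
      exact ht a
    · rw [RingHom.comp_apply, RingHom.comp_apply, RatFunc.algebraMap_X]
      exact hv'
  have hrat : f' = g' := by
    ext x
    induction x using RatFunc.induction_on with
    | f p q hq =>
      have hq' : algebraMap GaussQ[X] (RatFunc GaussQ) q ≠ 0 := RatFunc.algebraMap_ne_zero hq
      have h1 : ∀ r, f' (algebraMap _ _ r) = g' (algebraMap _ _ r) := fun r => RingHom.congr_fun hpoly r
      -- The target may be noncommutative, so equality of the images of $q^{-1}$ is obtained by
      -- comparing a left inverse with a right inverse.
      have h2 : f' (algebraMap _ _ q)⁻¹ = g' (algebraMap _ _ q)⁻¹ := by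
        apply left_inv_eq_right_inv (a := f' (algebraMap GaussQ[X] (RatFunc GaussQ) q))
        · rw [← map_mul, inv_mul_cancel₀ hq', map_one]
        · rw [h1, ← map_mul, mul_inv_cancel₀ hq', map_one]
      rw [div_eq_mul_inv, map_mul, map_mul, h1, h2]
  have hmk : f.comp (AdjoinRoot.mk (X ^ 2 - 1 : (RatFunc GaussQ)[X])) =
      g.comp (AdjoinRoot.mk (X ^ 2 - 1 : (RatFunc GaussQ)[X])) := by
    apply Polynomial.ringHom_ext
    · intro a
      exact RingHom.congr_fun hrat a
    · exact hp
  ext x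
  induction x using AdjoinRoot.induction_on with
  | ih p => exact RingHom.congr_fun hmk p

/-- The automorphism `v ↦ t⁻¹ v` of `ℚ(t)(v)`. -/
def sigmaRat : RatFunc GaussQ →+* RatFunc GaussQ :=
  letI : Invertible (tt⁻¹ : GaussQ) := invertibleOfNonzero (inv_ne_zero tt_ne_zero)
  IsFractionRing.lift (A := GaussQ[X])
    (g := (algebraMap GaussQ[X] (RatFunc GaussQ)).comp
      (Polynomial.algEquivCMulXAddC (tt⁻¹ : GaussQ) 0 : GaussQ[X] →+* GaussQ[X]))
    ((RatFunc.algebraMap_injective GaussQ).comp (AlgEquiv.injective _))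

theorem sigmaRat_C (c : GaussQ) : sigmaRat (RatFunc.C c) = RatFunc.C c := by
  rw [← RatFunc.algebraMap_C, sigmaRat, IsFractionRing.lift_algebraMap]
  simp

theorem sigmaRat_X : sigmaRat RatFunc.X = RatFunc.C tt⁻¹ * RatFunc.X := by
  rw [← RatFunc.algebraMap_X, sigmaRat, IsFractionRing.lift_algebraMap]
  simp

/-- The automorphism of the coefficient ring with `v ↦ t⁻¹ v` and `π ↦ -π`. -/
def sigma : Coeff →+* Coeff :=
  AdjoinRoot.lift ((algebraMap (RatFunc GaussQ) Coeff).comp sigmaRat) (-piElt) (by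
    simp only [eval₂_sub, eval₂_X_pow, eval₂_one]
    rw [neg_sq, pow_two, piElt_mul_self, sub_self])

theorem sigma_algebraMap_rat (r : RatFunc GaussQ) : sigma (algebraMap (RatFunc GaussQ) Coeff r) =
    algebraMap (RatFunc GaussQ) Coeff (sigmaRat r) := AdjoinRoot.lift_of _

theorem sigma_algebraMap (c : GaussQ) :
    sigma (algebraMap GaussQ Coeff c) = algebraMap GaussQ Coeff c := by
  change sigma (algebraMap (RatFunc GaussQ) Coeff (RatFunc.C c)) = _
  rw [sigma_algebraMap_rat, sigmaRat_C]
  rfl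

theorem sigma_piElt : sigma piElt = -piElt := AdjoinRoot.lift_root _

theorem map_sigma_vU : Units.map sigma.toMonoidHom vU = tU⁻¹ * vU := by
  apply Units.ext
  change sigma (algebraMap (RatFunc GaussQ) Coeff RatFunc.X) = _
  rw [sigma_algebraMap_rat, sigmaRat_X, map_mul]
  rfl

theorem map_sigma_piU : Units.map sigma.toMonoidHom piU = tU ^ (2 : ℤ) * piU := by
  apply Units.ext
  rw [Units.val_mul, tU_sq, neg_one_mul]
  exact sigma_piElt

theorem sigma_unit (u : Coeffˣ) : sigma (u : Coeff) = (Units.map sigma.toMonoidHom u : Coeffˣ) := rfl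

theorem sigma_tPow (n : ℤ) : sigma (tPow n) = tPow n := sigma_algebraMap _

theorem sigma_vPow (n : ℤ) : sigma (vPow n) = tPow (-n) * vPow n := by
  rw [vPow, sigma_unit, map_zpow, map_sigma_vU, mul_zpow, Units.val_mul, inv_zpow', tPow_eq]

theorem sigma_piPow (n : ℤ) : sigma (piPow n) = tPow (2 * n) * piPow n := by
  rw [piPow, sigma_unit, map_zpow, map_sigma_piU, mul_zpow, Units.val_mul, ← zpow_mul, tPow_eq]

/-! ### Effect of `sigma` on the structure constants -/

namespace SuperCartanDatum

variable {I : Type*} (C : SuperCartanDatum I)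

/-- Both $\pi v$ and $v^{-1}$ are multiplied by $\mathbf t$, so the two terms of the quantum integer
scale together. -/
theorem sigma_qnum (i : I) (l : ℤ) : sigma (C.qnum i l) = tPow (C.d i * l) * C.qnum i l := by
  rw [qnum, map_sub, sigma_unit, sigma_unit, map_zpow, map_zpow, map_mul, map_sigma_vU,
    map_sigma_piU, mul_sub, tPow_eq, ← Units.val_mul, ← Units.val_mul]
  congr 2
  · rw [← mul_zpow]; congr 1; rw [mul_mul_mul_comm, zpow_two, mul_inv_cancel_right]
  · rw [mul_zpow, inv_zpow', neg_neg]

theorem sigma_inverse_qnum (i : I) : sigma (Ring.inverse (C.qnum i 1)) =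
    tPow (-C.d i) * Ring.inverse (C.qnum i 1) := by
  have h := C.isUnit_qnum i one_ne_zero
  rw [← (h.map sigma).mul_left_inj, ← map_mul, Ring.inverse_mul_cancel _ h, map_one, sigma_qnum,
    mul_mul_mul_comm, ← tPow_add, Ring.inverse_mul_cancel _ h]
  simp [tPow_zero]

theorem map_sigma_qc (i j : I) : Units.map sigma.toMonoidHom (C.qc i j) =
    tU ^ (2 * ((C.p i : ℤ) * C.p j) - C.d i * C.a i j) * C.qc i j := by
  rw [qc, map_mul, map_zpow, map_zpow, map_sigma_vU, map_sigma_piU, mul_zpow, mul_zpow, ← zpow_mul,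
    inv_zpow', mul_mul_mul_comm, ← zpow_add]
  rfl

theorem two_p_sub_two_d (i : I) : 2 * (C.p i : ℤ) ≡ 2 * C.d i [ZMOD 4] := by
  have := C.d_emod_two i
  rw [Int.ModEq]; omega

/-- The scaling factor is $\mathbf t^{2p(i)-2d_i}$, trivial by bar-consistency. Consequently every
Gaussian binomial in this parameter is fixed by `sigma`. -/
theorem sigma_qc_self (i : I) : sigma (C.qc i i : Coeff) = C.qc i i := by
  rw [sigma_unit, map_sigma_qc, Units.val_mul, ← tPow_eq, d_mul_a_self, p_mul_self,
    tPow_congr (b := 0), tPow_zero, one_mul]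
  simpa using (C.two_p_sub_two_d i).sub_right (2 * C.d i)

end SuperCartanDatum

theorem map_gauss {R S : Type*} [CommRing R] [CommRing S] (f : R →+* S) (q : R) :
    ∀ n k : ℕ, f (gauss q n k) = gauss (f q) n k
  | n, 0 => by simp [gauss_zero_right]
  | 0, k + 1 => by simp [gauss]
  | n + 1, k + 1 => by simp [gauss_succ, map_gauss f q n]

/-- In the Gaussian form of the coefficient only the factor $q_{ij}^k$ is moved, hence a power of
$\mathbf t$ linear in $k$. -/
theorem SuperCartanDatum.sigma_serreCoeff {I : Type*} (C : SuperCartanDatum I) {i j : I}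
    (h : i ≠ j) {k : ℕ} (hk : k ≤ C.b i j) : sigma (C.serreCoeff i j k) =
      tPow (k * (2 * ((C.p i : ℤ) * C.p j) - C.d i * C.a i j)) * C.serreCoeff i j k := by
  rw [C.serreCoeff_eq_left h hk]
  simp only [map_mul, map_pow, map_neg, map_one, map_gauss, C.sigma_qc_self]
  rw [sigma_unit, C.map_sigma_qc, Units.val_mul, mul_pow, ← Units.val_pow_eq_pow_val (tU ^ _),
    ← zpow_natCast (tU ^ _), ← zpow_mul, mul_comm (2 * _ - _) (k : ℤ), ← tPow_eq]
  ring

/-! ## The twistor -/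

section Twistor

variable {I Y X : Type*} [AddCommGroup Y] [AddCommGroup X] {C : SuperCartanDatum I}
  {D : RootDatum C Y X} (φ : Enhancer D)

/-- The ring `Û` with the scalars acting through `sigma`. -/
def TwU : Type _ := EnhU φ

instance : Ring (TwU φ) := inferInstanceAs (Ring (EnhU φ))

/-- With scalars acting through `sigma`, a semilinear map into $\widehat{\mathbf U}$ becomes a
linear one, and the universal property of the presentation applies. -/
instance : Algebra Coeff (TwU φ) :=
  ((algebraMap Coeff (EnhU φ)).comp sigma).toAlgebra' fun c x =>
    Algebra.commutes (A := EnhU φ) (sigma c) x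

theorem phi_single_neg (i : I) (l : X) :
    φ.phi (Finsupp.single i (-1)) l ≡ -φ.phi (Finsupp.single i 1) l [ZMOD 4] := by
  rw [Finsupp.single_neg]; exact phi_neg φ _ _

/-- The torus element `T̃_i Υ_i`. -/
def twE (i : I) : EnhU φ := uTt φ 1 i * uUpsi φ 1 i

theorem twE_E (i j : I) : twE φ i * uE φ j =
    tPow (C.d i * C.a i j + φ.phi (Finsupp.single i 1) (D.root j)) • (uE φ j * twE φ i) := by
  rw [twE, mul_assoc, Ups_E, mul_smul_comm, ← mul_assoc (uTt φ 1 i), T_E, smul_mul_assoc, smul_smul,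
    ← tPow_add, pairing_til, one_mul, mul_assoc (uE φ j), add_comm]

theorem twE_F (i j : I) : twE φ i * uF φ j =
    tPow (-(C.d i * C.a i j + φ.phi (Finsupp.single i 1) (D.root j))) • (uF φ j * twE φ i) := by
  rw [twE, mul_assoc, Ups_F, mul_smul_comm, ← mul_assoc (uTt φ 1 i), T_F, smul_mul_assoc, smul_smul,
    ← tPow_add, pairing_til, one_mul, mul_assoc (uF φ j), neg_add, add_comm]

theorem Upsi_neg_E (i j : I) : uUpsi φ (-1) i * uE φ j =
    tPow (-φ.phi (Finsupp.single i 1) (D.root j)) • (uE φ j * uUpsi φ (-1) i) := by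
  rw [Ups_E, tPow_congr (phi_single_neg φ i _)]

theorem Upsi_neg_F (i j : I) : uUpsi φ (-1) i * uF φ j =
    tPow (φ.phi (Finsupp.single i 1) (D.root j)) • (uF φ j * uUpsi φ (-1) i) := by
  rw [Ups_F, tPow_congr (phi_single_neg φ i _).neg, neg_neg]

theorem T_T (μ ν : Y) : Commute (uT φ μ) (uT φ ν) := by
  rw [Commute, SemiconjBy, T_add, T_add, add_comm]

theorem Ups_Ups (μ ν : I →₀ ℤ) : Commute (uUps φ μ) (uUps φ ν) := by
  rw [Commute, SemiconjBy, Ups_add, Ups_add, add_comm]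

theorem Ups_T (μ : I →₀ ℤ) (ν : Y) : Commute (uUps φ μ) (uT φ ν) := (T_Ups φ ν μ).symm

open Gen in
/-- The values of the twistor on generators. -/
def twistorGen : Gen I Y → EnhU φ
  | E i => tPow (2 * C.d i) • (uE φ i * twE φ i)
  | F i => uF φ i * uUpsi φ (-1) i
  | K μ => uT φ (-μ) * uK φ μ
  | J μ => uT φ (2 • μ) * uJ φ μ
  | T μ => uT φ μ
  | Ups ν => uUps φ ν

/-- The twistor on the free algebra, a semilinear map. -/
def twistorFree : FreeAlgebra Coeff (Gen I Y) →+* EnhU φ :=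
  (FreeAlgebra.lift Coeff (A := TwU φ) (twistorGen φ)).toRingHom

theorem twistorFree_fg (g : Gen I Y) : twistorFree φ (fg g) = twistorGen φ g :=
  FreeAlgebra.lift_ι_apply (A := TwU φ) _ _

theorem twistorFree_smul (c : Coeff) (x : FreeAlgebra Coeff (Gen I Y)) :
    twistorFree φ (c • x) = sigma c • twistorFree φ x := by
  have h1 : twistorFree φ (c • x) = c • (FreeAlgebra.lift Coeff (A := TwU φ) (twistorGen φ)) x :=
    map_smul (FreeAlgebra.lift Coeff (A := TwU φ) (twistorGen φ)) c x
  rw [h1, Algebra.smul_def, Algebra.smul_def]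
  rfl

variable {φ}

theorem mul_swap_smul {g e h : EnhU φ} {s : Coeff} (he : g * e = s • (e * g)) (hh : g * h = h * g) :
    g * (e * h) = s • (e * h * g) := by
  rw [← mul_assoc, he, smul_mul_assoc, mul_assoc, mul_assoc, hh]

theorem mul_swap_smul_left {g h e : EnhU φ} {r s : Coeff} (hg : g * e = r • (e * g))
    (hh : h * e = s • (e * h)) : g * h * e = (r * s) • (e * (g * h)) := by
  rw [mul_assoc, hh, mul_smul_comm, ← mul_assoc, hg, smul_mul_assoc, smul_smul, mul_assoc,
    mul_comm s]

variable (φ)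

/-- The twisted supercommutator is the original one times a torus element, up to a power of $\mathbf
t$; this handles $i=j$ and $i\ne j$ together. -/
theorem twistor_E_F (i j : I) :
    twistorGen φ (Gen.E i) * twistorGen φ (Gen.F j) -
      sigma (piPow (C.p i * C.p j)) • (twistorGen φ (Gen.F j) * twistorGen φ (Gen.E i)) =
    tPow (2 * C.d i - (C.d i * C.a i j + φ.phi (Finsupp.single i 1) (D.root j))) •
      ((uE φ i * uF φ j - piPow (C.p i * C.p j) • (uF φ j * uE φ i)) *
        (twE φ i * uUpsi φ (-1) j)) := by
  have hc : twE φ i * uUpsi φ (-1) j = uUpsi φ (-1) j * twE φ i :=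
    (Commute.mul_right (Ups_T φ _ _) (Ups_Ups φ _ _)).eq.symm
  have h1 : twistorGen φ (Gen.E i) * twistorGen φ (Gen.F j) =
      tPow (2 * C.d i - (C.d i * C.a i j + φ.phi (Finsupp.single i 1) (D.root j))) •
        (uE φ i * uF φ j * (twE φ i * uUpsi φ (-1) j)) := by
    simp only [twistorGen]
    rw [smul_mul_assoc, mul_assoc, ← mul_assoc (twE φ i), twE_F, smul_mul_assoc, mul_smul_comm,
      smul_smul, ← tPow_add, ← sub_eq_add_neg]
    simp only [mul_assoc]
  have h2 : twistorGen φ (Gen.F j) * twistorGen φ (Gen.E i) =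
      tPow (2 * C.d i - φ.phi (Finsupp.single j 1) (D.root i)) •
        (uF φ j * uE φ i * (twE φ i * uUpsi φ (-1) j)) := by
    simp only [twistorGen]
    rw [mul_smul_comm, mul_assoc, ← mul_assoc (uUpsi φ (-1) j), Upsi_neg_E, smul_mul_assoc,
      mul_smul_comm, smul_smul, ← tPow_add, ← sub_eq_add_neg, hc]
    simp only [mul_assoc]
  -- For $i\ne j$ this is the skew condition on $\phi$, the sign of $i\cdot j$ being immaterial
  -- modulo $4$ because $i\cdot j$ is even. For $i=j$ it says $2p(i)+2d_i\equiv0$.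
  have h3 : 2 * ((C.p i : ℤ) * C.p j) + (2 * C.d i - φ.phi (Finsupp.single j 1) (D.root i)) ≡
      2 * C.d i - (C.d i * C.a i j + φ.phi (Finsupp.single i 1) (D.root j)) [ZMOD 4] := by
    rcases eq_or_ne i j with rfl | h
    · have := φ.self i
      have h4 := C.two_p_sub_two_d i
      rw [C.p_mul_self, C.d_mul_a_self]
      unfold Int.ModEq at *
      omega
    · have := φ.skew i j h
      rw [← C.d_mul_a i j h] at this
      have he := C.even_d_mul_a i j
      rw [Int.even_iff] at he
      rw [show 2 * (C.p i : ℤ) * C.p j = 2 * ((C.p i : ℤ) * C.p j) by ring] at this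
      unfold Int.ModEq at *
      omega
  rw [h1, h2, sigma_piPow, smul_smul, mul_right_comm, ← tPow_add, tPow_congr h3, ← smul_smul,
    ← smul_sub, sub_mul, smul_mul_assoc]

/-- The $n$-dependence of the factor produced by `sigma` cancels that of the torus commutations, so
the twisted sum is the original Serre sum times a scalar and a torus element. The parameter $m$
covers both cases: $i\cdot j$ for $E$, where $\tilde T$ also contributes, and $0$ for $F$. -/
theorem twistor_serre (i j : I) (h : i ≠ j) (x z g k : EnhU φ) (s : Coeff) (m : ℤ)
    (hgx : g * x = s • (x * g))
    (hgz : g * z = tPow (m + φ.phi (Finsupp.single i 1) (D.root j)) • (z * g))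
    (hkx : k * x = tPow (m + φ.phi (Finsupp.single j 1) (D.root i)) • (x * k))
    (hgk : g * k = k * g) (hs : serreSum C i j x z = 0) :
    ∑ n ∈ Finset.range (C.b i j + 1), sigma (C.serreCoeff i j n) •
      ((x * g) ^ (C.b i j - n) * (z * k) * (x * g) ^ n) = 0 := by
  have key : ∀ n ∈ Finset.range (C.b i j + 1), sigma (C.serreCoeff i j n) •
      ((x * g) ^ (C.b i j - n) * (z * k) * (x * g) ^ n) =
      ((s ^ (C.b i j).choose 2 *
        tPow (C.b i j * (m + φ.phi (Finsupp.single i 1) (D.root j)))) •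
      (C.serreCoeff i j n • (x ^ (C.b i j - n) * z * x ^ n))) * (g ^ C.b i j * k) := by
    intro n hn
    have hn' : n ≤ C.b i j := by have := Finset.mem_range.mp hn; omega
    have hpow : ∀ (a : ℤ) (q : ℕ), tPow a ^ q = tPow (q * a) := fun a q => by
      rw [tPow_eq, tPow_eq, ← Units.val_pow_eq_pow_val, ← zpow_natCast, ← zpow_mul, mul_comm]
    rw [serre_monomial hgx hgz hkx hgk hn', C.sigma_serreCoeff h hn', smul_smul, smul_mul_assoc,
      smul_mul_assoc, smul_smul, hpow, hpow]
    congr 1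
    have h2 : tPow (n * (2 * ((C.p i : ℤ) * C.p j) - C.d i * C.a i j)) *
        (tPow (↑(C.b i j - n) * (m + φ.phi (Finsupp.single i 1) (D.root j))) *
          tPow (n * (m + φ.phi (Finsupp.single j 1) (D.root i)))) =
        tPow (C.b i j * (m + φ.phi (Finsupp.single i 1) (D.root j))) := by
      rw [← tPow_add, ← tPow_add]
      apply tPow_congr
      have hsk := φ.skew i j h
      rw [← C.d_mul_a i j h] at hsk
      obtain ⟨e, he⟩ := C.even_d_mul_a i j
      obtain ⟨c, hc⟩ := hsk.dvd
      rw [he] at hc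
      rw [he, Nat.cast_sub hn']
      -- Here $i\cdot j=2e$, and $c$ is the quotient in the skew congruence; the remaining
      -- discrepancy $2n\,(i\cdot j)$ is the multiple $4ne$.
      refine Int.modEq_iff_dvd.mpr ⟨n * (e - c), ?_⟩
      linear_combination (-(n : ℤ)) * hc
    rw [← h2]
    ring
  rw [Finset.sum_congr rfl key, ← Finset.sum_mul, ← Finset.smul_sum]
  change (_ • serreSum C i j x z) * _ = 0
  rw [hs, smul_zero, zero_mul]

end Twistor

/-! ### The twistor respects the relations and is invertible -/

section TwistorAut

variable {I Y X : Type*} [AddCommGroup Y] [AddCommGroup X] {C : SuperCartanDatum I}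
  {D : RootDatum C Y X} (φ : Enhancer D)

theorem commute_twE {g : EnhU φ} {i : I} (h1 : Commute g (uTt φ 1 i)) (h2 : Commute g (uUpsi φ 1 i)) :
    g * twE φ i = twE φ i * g := (h1.mul_right h2).eq

theorem twistor_torus_E {g : EnhU φ} {i : I} {s : Coeff} (hE : g * uE φ i = s • (uE φ i * g))
    (hT : Commute g (uTt φ 1 i)) (hU : Commute g (uUpsi φ 1 i)) :
    g * twistorGen φ (Gen.E i) = s • (twistorGen φ (Gen.E i) * g) := by
  simp only [twistorGen]
  rw [mul_smul_comm, mul_swap_smul hE (commute_twE φ hT hU), smul_mul_assoc, smul_comm]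

theorem twistor_torus_F {g : EnhU φ} {i : I} {s : Coeff} (hF : g * uF φ i = s • (uF φ i * g))
    (hU : Commute g (uUpsi φ (-1) i)) :
    g * twistorGen φ (Gen.F i) = s • (twistorGen φ (Gen.F i) * g) :=
  mul_swap_smul hF hU.eq

theorem T_four_smul (μ : Y) : uT φ ((4 : ℕ) • μ) = 1 := by
  rw [show (4 : ℕ) • μ = μ + μ + μ + μ by simp only [succ_nsmul, zero_nsmul]; abel,
    ← T_add, ← T_add, ← T_add, ← T_four φ μ]
  simp only [pow_succ, pow_zero, one_mul]

theorem TJ_mul_E (μ : Y) (i : I) : uT φ (2 • μ) * uJ φ μ * uE φ i =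
    sigma (piPow (D.pairing μ (D.root i))) • (uE φ i * (uT φ (2 • μ) * uJ φ μ)) := by
  rw [mul_swap_smul_left (T_E φ _ i) (J_E φ μ i), sigma_piPow]
  simp

theorem TJ_mul_F (μ : Y) (i : I) : uT φ (2 • μ) * uJ φ μ * uF φ i =
    sigma (piPow (-D.pairing μ (D.root i))) • (uF φ i * (uT φ (2 • μ) * uJ φ μ)) := by
  rw [mul_swap_smul_left (T_F φ _ i) (J_F φ μ i), sigma_piPow]
  simp

theorem TK_mul_E (μ : Y) (i : I) : uT φ (-μ) * uK φ μ * uE φ i =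
    sigma (vPow (D.pairing μ (D.root i))) • (uE φ i * (uT φ (-μ) * uK φ μ)) := by
  rw [mul_swap_smul_left (T_E φ _ i) (K_E φ μ i), sigma_vPow]
  simp

theorem TK_mul_F (μ : Y) (i : I) : uT φ (-μ) * uK φ μ * uF φ i =
    sigma (vPow (-D.pairing μ (D.root i))) • (uF φ i * (uT φ (-μ) * uK φ μ)) := by
  rw [mul_swap_smul_left (T_F φ _ i) (K_F φ μ i), sigma_vPow]
  simp

theorem TT_til (i : I) : twE φ i * uUpsi φ (-1) i = uTt φ 1 i := by
  rw [twE, mul_assoc, Ups_add, ← Finsupp.single_add, add_neg_cancel, Finsupp.single_zero, Ups_zero,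
    mul_one]

theorem twistor_rel ⦃x y : FreeAlgebra Coeff (Gen I Y)⦄ (h : Rel φ x y) :
    twistorFree φ x = twistorFree φ y := by
  have hK : ∀ μ, twistorGen φ (Gen.K μ) = uT φ (-μ) * uK φ μ := fun _ => rfl
  have hJ : ∀ μ, twistorGen φ (Gen.J μ) = uT φ (2 • μ) * uJ φ μ := fun _ => rfl
  have hT : ∀ μ, twistorGen φ (Gen.T μ) = uT φ μ := fun _ => rfl
  have hU : ∀ μ, twistorGen φ (Gen.Ups μ) = uUps φ μ := fun _ => rfl
  have hmix : ∀ {a b c d : EnhU φ}, Commute b c → a * b * (c * d) = a * c * (b * d) := by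
    intro a b c d h
    rw [mul_assoc, ← mul_assoc b, h.eq, mul_assoc c, ← mul_assoc]
  induction h with
  | J_add μ ν =>
    simp only [map_mul, twistorFree_fg, hJ]
    rw [hmix (T_J φ _ _).symm, T_add, J_add, smul_add]
  | K_add μ ν =>
    simp only [map_mul, twistorFree_fg, hK]
    rw [hmix (T_K φ _ _).symm, T_add, K_add, neg_add]
  | K_zero => simp only [map_one, twistorFree_fg, hK, neg_zero, K_zero, T_zero, mul_one]
  | J_zero => simp only [map_one, twistorFree_fg, hJ, smul_zero, J_zero, T_zero, mul_one]
  | J_sq μ =>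
    simp only [map_pow, map_one, twistorFree_fg, hJ]
    rw [Commute.mul_pow (T_J φ _ _), J_sq, mul_one, pow_two, T_add, ← add_nsmul]
    exact T_four_smul φ μ
  | J_K μ ν =>
    simp only [map_mul, twistorFree_fg, hK, hJ]
    exact Commute.mul_left (Commute.mul_right (T_T φ _ _) (T_K φ _ _))
      (Commute.mul_right (T_J φ _ _).symm (J_K φ _ _))
  | J_E μ i =>
    simp only [map_mul, twistorFree_smul, twistorFree_fg, hJ]
    exact twistor_torus_E φ (TJ_mul_E φ μ i) (Commute.mul_left (T_T φ _ _) (T_J φ _ _).symm)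
      (Commute.mul_left (T_Ups φ _ _) (Ups_J φ _ _).symm)
  | J_F μ i =>
    simp only [map_mul, twistorFree_smul, twistorFree_fg, hJ]
    exact twistor_torus_F φ (TJ_mul_F φ μ i) (Commute.mul_left (T_Ups φ _ _) (Ups_J φ _ _).symm)
  | K_E μ i =>
    simp only [map_mul, twistorFree_smul, twistorFree_fg, hK]
    exact twistor_torus_E φ (TK_mul_E φ μ i) (Commute.mul_left (T_T φ _ _) (T_K φ _ _).symm)
      (Commute.mul_left (T_Ups φ _ _) (Ups_K φ _ _).symm)
  | K_F μ i =>
    simp only [map_mul, twistorFree_smul, twistorFree_fg, hK]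
    exact twistor_torus_F φ (TK_mul_F φ μ i) (Commute.mul_left (T_Ups φ _ _) (Ups_K φ _ _).symm)
  | E_F_self i =>
    simp only [map_mul, twistorFree_smul, map_sub, twistorFree_fg]
    rw [twistor_E_F, E_F_self, TT_til, hJ, hK, hK, C.sigma_inverse_qnum, smul_mul_assoc, smul_smul]
    congr 1
    · congr 1
      apply tPow_congr
      -- Both scalars are $\mathbf t_i^{-1}$: one from the denominator $\pi_iv_i-v_i^{-1}$, the
      -- other from $\phi(i,i')\equiv d_i$.
      have := φ.self i
      rw [C.d_mul_a_self]
      unfold Int.ModEq at *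
      omega
    -- The surviving torus factor is $\tilde T_i$, which is what the images of $\tilde J_i\tilde
    -- K_i$ and of $\tilde K_{-i}$ both carry.
    · rw [sub_mul, hmix (T_J φ _ _).symm, T_add, til_neg, neg_neg,
        show (2 : ℕ) • D.til 1 i + -D.til 1 i = D.til 1 i by rw [two_nsmul]; abel]
      exact congrArg₂ _ (Commute.mul_right (T_J φ _ _) (T_K φ _ _)).eq.symm
        (by rw [uKt, til_neg]; exact (T_K φ _ _).symm)
  | E_F i j hij =>
    simp only [map_mul, twistorFree_smul, map_sub, map_zero, twistorFree_fg]
    rw [twistor_E_F, E_F φ i j hij, zero_mul, smul_zero]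
  | E_serre i j hij =>
    simp only [map_mul, twistorFree_smul, map_sum, map_pow, map_zero, twistorFree_fg, twistorGen]
    -- Every term has the same degree in $E_i$ and $E_j$, so the scalars $\mathbf t_i^2$ and
    -- $\mathbf t_j^2$ factor out.
    apply sign_serre
    refine twistor_serre φ i j hij _ _ _ _ _ (C.d i * C.a i j) (twE_E φ i i) (twE_E φ i j) ?_
      ?_ (E_serre φ i j hij)
    · rw [twE_E, C.d_mul_a_symm j i]
    · exact (commute_twE φ (Commute.mul_left (T_T φ _ _) (Ups_T φ _ _))
        (Commute.mul_left (T_Ups φ _ _) (Ups_Ups φ _ _)))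
  | F_serre i j hij =>
    simp only [map_mul, twistorFree_smul, map_sum, map_pow, map_zero, twistorFree_fg, twistorGen]
    refine twistor_serre φ i j hij _ _ _ _ _ 0 (Upsi_neg_F φ i i) ?_ ?_
      (Ups_Ups φ _ _) (F_serre φ i j hij)
    · rw [Upsi_neg_F, zero_add]
    · rw [Upsi_neg_F, zero_add]
  | T_add μ ν => simp only [map_mul, twistorFree_fg, hT, T_add]
  | Ups_add μ ν => simp only [map_mul, twistorFree_fg, hU, Ups_add]
  | T_zero => simp only [map_one, twistorFree_fg, hT, T_zero]
  | Ups_zero => simp only [map_one, twistorFree_fg, hU, Ups_zero]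
  | T_four μ => simp only [map_pow, map_one, twistorFree_fg, hT, T_four]
  | Ups_four ν => simp only [map_pow, map_one, twistorFree_fg, hU, Ups_four]
  | T_Ups μ ν => simp only [map_mul, twistorFree_fg, hT, hU, T_Ups]
  | T_K μ ν =>
    simp only [map_mul, twistorFree_fg, hT, hK]
    exact Commute.mul_right (T_T φ _ _) (T_K φ _ _)
  | T_J μ ν =>
    simp only [map_mul, twistorFree_fg, hT, hJ]
    exact Commute.mul_right (T_T φ _ _) (T_J φ _ _)
  | Ups_K μ ν =>
    simp only [map_mul, twistorFree_fg, hU, hK]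
    exact Commute.mul_right (Ups_T φ _ _) (Ups_K φ _ _)
  | Ups_J μ ν =>
    simp only [map_mul, twistorFree_fg, hU, hJ]
    exact Commute.mul_right (Ups_T φ _ _) (Ups_J φ _ _)
  | T_E μ i =>
    simp only [map_mul, twistorFree_smul, twistorFree_fg, hT, sigma_tPow]
    exact twistor_torus_E φ (T_E φ μ i) (T_T φ _ _) (T_Ups φ _ _)
  | T_F μ i =>
    simp only [map_mul, twistorFree_smul, twistorFree_fg, hT, sigma_tPow]
    exact twistor_torus_F φ (T_F φ μ i) (T_Ups φ _ _)
  | Ups_E ν i =>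
    simp only [map_mul, twistorFree_smul, twistorFree_fg, hU, sigma_tPow]
    exact twistor_torus_E φ (Ups_E φ ν i) (Ups_T φ _ _) (Ups_Ups φ _ _)
  | Ups_F ν i =>
    simp only [map_mul, twistorFree_smul, twistorFree_fg, hU, sigma_tPow]
    exact twistor_torus_F φ (Ups_F φ ν i) (Ups_Ups φ _ _)

/-- The twistor as a semilinear ring endomorphism. -/
def twistorRing : EnhU φ →+* EnhU φ :=
  (liftU φ (A := TwU φ) (twistorGen φ) (twistor_rel φ)).toRingHom

theorem twistorRing_gen (g : Gen I Y) : twistorRing φ (gen φ g) = twistorGen φ g :=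
  liftU_gen φ (A := TwU φ) _ _ g

theorem twistorRing_algebraMap (c : Coeff) : twistorRing φ (algebraMap Coeff (EnhU φ) c) =
    algebraMap Coeff (EnhU φ) (sigma c) :=
  (liftU φ (A := TwU φ) (twistorGen φ) (twistor_rel φ)).commutes c

theorem twistorRing_smul (c : Coeff) (x : EnhU φ) :
    twistorRing φ (c • x) = sigma c • twistorRing φ x := by
  rw [Algebra.smul_def, map_mul, twistorRing_algebraMap, ← Algebra.smul_def]

theorem algebraMap_gauss (c : GaussQ) : algebraMap GaussQ (EnhU φ) c =
    algebraMap Coeff (EnhU φ) (algebraMap GaussQ Coeff c) :=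
  IsScalarTower.algebraMap_apply GaussQ Coeff (EnhU φ) c

/-- The twistor as an endomorphism over `ℚ(t)`. -/
def twistorHom : EnhU φ →ₐ[GaussQ] EnhU φ :=
  { twistorRing φ with
    commutes' := fun c => by
      change twistorRing φ (algebraMap GaussQ (EnhU φ) c) = _
      rw [algebraMap_gauss, twistorRing_algebraMap, sigma_algebraMap] }

variable {φ}

theorem toU_surjective : Function.Surjective (toU φ) := RingQuot.mkAlgHom_surjective _ _

/-- Induction on elements of `Û`. -/
theorem U_induction {P : EnhU φ → Prop} (scalar : ∀ c, P (algebraMap Coeff _ c))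
    (gen : ∀ g, P (gen φ g)) (mul : ∀ x y, P x → P y → P (x * y))
    (add : ∀ x y, P x → P y → P (x + y)) (u : EnhU φ) : P u := by
  obtain ⟨a, rfl⟩ := toU_surjective u
  induction a using FreeAlgebra.induction with
  | grade0 r => rw [AlgHom.commutes]; exact scalar r
  | grade1 x => exact gen x
  | mul a b ha hb => rw [map_mul]; exact mul _ _ ha hb
  | add a b ha hb => rw [map_add]; exact add _ _ ha hb

/-- Two ring homomorphisms out of `Û` agree if they agree on scalars and on generators. -/
theorem U_ringHom_ext {B : Type*} [Ring B] {f g : EnhU φ →+* B}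
    (hc : ∀ c, f (algebraMap Coeff _ c) = g (algebraMap Coeff _ c))
    (hg : ∀ x, f (gen φ x) = g (gen φ x)) : f = g := by
  ext u
  induction u using U_induction with
  | scalar c => exact hc c
  | gen x => exact hg x
  | mul x y hx hy => rw [map_mul, map_mul, hx, hy]
  | add x y hx hy => rw [map_add, map_add, hx, hy]

variable (φ)

theorem sigma_four (c : Coeff) : sigma (sigma (sigma (sigma c))) = c := by
  have : (sigma.comp (sigma.comp (sigma.comp sigma))) = RingHom.id Coeff := by
    apply coeff_ringHom_ext
    · intro c
      simp [sigma_algebraMap]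
    · simp only [RingHom.comp_apply, sigma_vPow, map_mul, sigma_tPow, RingHom.id_apply]
      rw [← mul_assoc, ← mul_assoc, ← mul_assoc, ← tPow_add, ← tPow_add, ← tPow_add,
        tPow_congr (b := 0) (by decide), tPow_zero, one_mul]
    · simp [sigma_piElt]
  exact RingHom.congr_fun this c

theorem twistorRing_twE (i : I) : twistorRing φ (twE φ i) = twE φ i := by
  rw [twE, map_mul, twistorRing_gen, twistorRing_gen]; rfl

theorem twE_four (i : I) : twE φ i * twE φ i * twE φ i * twE φ i = 1 := by
  have h : twE φ i ^ 4 = 1 := by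
    rw [twE, Commute.mul_pow (T_Ups φ _ _), T_four, Ups_four, one_mul]
  rw [← h]
  simp only [pow_succ, pow_zero, one_mul]

/-- Each generator is multiplied by a torus element, fixed by the twistor, whose fourth power is
$1$, and by a power of $\mathbf t$ whose fourth power is $1$. The cube is therefore the inverse. -/
theorem twistorRing_four (u : EnhU φ) :
    twistorRing φ (twistorRing φ (twistorRing φ (twistorRing φ u))) = u := by
  have hK : ∀ μ, twistorRing φ (uK φ μ) = uT φ (-μ) * uK φ μ := fun _ => twistorRing_gen φ _
  have hJ : ∀ μ, twistorRing φ (uJ φ μ) = uT φ (2 • μ) * uJ φ μ := fun _ => twistorRing_gen φ _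
  have hT : ∀ μ, twistorRing φ (uT φ μ) = uT φ μ := fun _ => twistorRing_gen φ _
  have hU : ∀ μ, twistorRing φ (uUps φ μ) = uUps φ μ := fun _ => twistorRing_gen φ _
  have hE : ∀ i, twistorRing φ (uE φ i) = tPow (2 * C.d i) • (uE φ i * twE φ i) :=
    fun _ => twistorRing_gen φ _
  have hF : ∀ i, twistorRing φ (uF φ i) = uF φ i * uUpsi φ (-1) i := fun _ => twistorRing_gen φ _
  have : (twistorRing φ).comp ((twistorRing φ).comp ((twistorRing φ).comp (twistorRing φ))) =
      RingHom.id _ := by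
    apply U_ringHom_ext
    · intro c
      simp only [RingHom.comp_apply, twistorRing_algebraMap, sigma_four, RingHom.id_apply]
    · intro g
      simp only [RingHom.comp_apply, RingHom.id_apply]
      cases g with
      | E i =>
        simp only [hE, twistorRing_smul, map_mul, twistorRing_twE, sigma_tPow, smul_mul_assoc,
          smul_smul, ← tPow_add]
        rw [mul_assoc, mul_assoc, mul_assoc, ← mul_assoc (twE φ i), ← mul_assoc (_ * twE φ i),
          twE_four, mul_one, tPow_congr (b := 0), tPow_zero, one_smul]
        exact Int.modEq_zero_iff_dvd.mpr ⟨2 * C.d i, by ring⟩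
      | F i =>
        simp only [hF, map_mul, hU]
        have := Ups_four φ (Finsupp.single i (-1))
        simp only [pow_succ, pow_zero, one_mul] at this
        rw [mul_assoc, mul_assoc, mul_assoc, ← mul_assoc (uUpsi φ (-1) i),
          ← mul_assoc (_ * uUpsi φ (-1) i), this, mul_one]
      | K μ =>
        simp only [hK, map_mul, hT]
        rw [← mul_assoc, ← mul_assoc, ← mul_assoc]
        have := T_four φ (-μ)
        simp only [pow_succ, pow_zero, one_mul] at this
        rw [this, one_mul]
      | J μ =>
        simp only [hJ, map_mul, hT]
        rw [← mul_assoc, ← mul_assoc, ← mul_assoc]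
        have := T_four φ (2 • μ)
        simp only [pow_succ, pow_zero, one_mul] at this
        rw [this, one_mul]
      | T μ => simp only [hT]
      | Ups ν => simp only [hU]
  exact RingHom.congr_fun this u

/-- The twistor. -/
def twistor : EnhU φ ≃ₐ[GaussQ] EnhU φ :=
  AlgEquiv.ofAlgHom (twistorHom φ) ((twistorHom φ).comp ((twistorHom φ).comp (twistorHom φ)))
    (AlgHom.ext fun u => twistorRing_four φ u) (AlgHom.ext fun u => twistorRing_four φ u)

theorem twistor_apply (u : EnhU φ) : twistor φ u = twistorRing φ u := rfl

theorem isTwistor_twistor : IsTwistor φ (twistor φ) where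
  map_E i := by rw [twistor_apply, twistorRing_gen, twistorGen, twE, mul_assoc]
  map_F i := twistorRing_gen φ _
  map_K i := twistorRing_gen φ _
  map_J i := twistorRing_gen φ _
  map_T i := twistorRing_gen φ _
  map_Ups i := twistorRing_gen φ _
  map_v := by rw [twistor_apply, twistorRing_algebraMap, sigma_vPow]
  map_pi := by rw [twistor_apply, twistorRing_algebraMap, sigma_piElt]

/-- Semilinearity over `sigma` is not part of the hypothesis; it follows from the values at $v$ and
$\pi$ together with $\mathbb Q(\mathbf t)$-linearity, by `coeff_ringHom_ext`. -/
theorem IsTwistor.eq_twistor {𝔛 : EnhU φ ≃ₐ[GaussQ] EnhU φ} (h : IsTwistor φ 𝔛) :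
    𝔛 = twistor φ := by
  have hs : ((𝔛 : EnhU φ →ₐ[GaussQ] EnhU φ) : EnhU φ →+* EnhU φ) = twistorRing φ := by
    apply U_ringHom_ext
    · intro c
      have : (((𝔛 : EnhU φ →ₐ[GaussQ] EnhU φ) : EnhU φ →+* EnhU φ).comp
          (algebraMap Coeff (EnhU φ))) = (twistorRing φ).comp (algebraMap Coeff (EnhU φ)) := by
        apply coeff_ringHom_ext
        · intro c
          rw [RingHom.comp_apply, RingHom.comp_apply, twistorRing_algebraMap, sigma_algebraMap,
            ← algebraMap_gauss]
          exact 𝔛.commutes c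
        · rw [RingHom.comp_apply, RingHom.comp_apply, twistorRing_algebraMap, sigma_vPow]
          exact h.map_v
        · rw [RingHom.comp_apply, RingHom.comp_apply, twistorRing_algebraMap, sigma_piElt]
          exact h.map_pi
      exact RingHom.congr_fun this c
    · intro g
      rw [twistorRing_gen]
      cases g with
      | E i => rw [twistorGen, twE, ← mul_assoc]; exact h.map_E i
      | F i => exact h.map_F i
      | K i => exact h.map_K i
      | J i => exact h.map_J i
      | T i => exact h.map_T i
      | Ups i => exact h.map_Ups i
  exact AlgEquiv.ext fun u => RingHom.congr_fun hs u

theorem existsUnique_twistor : ∃! 𝔛, IsTwistor φ 𝔛 :=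
  ⟨_, isTwistor_twistor φ, fun _ h => h.eq_twistor⟩

end TwistorAut

/-! ## Module twistors -/

section ModuleTwistors

variable {I Y X : Type*} [AddCommGroup Y] [AddCommGroup X] {C : SuperCartanDatum I}
  {D : RootDatum C Y X} (φ : Enhancer D)

theorem mk_eq_smul_eta (l : X) (u : EnhU φ) :
    (Submodule.Quotient.mk u : EnhU φ ⧸ highestIdeal φ l) = u • eta φ l := by
  change _ = Submodule.Quotient.mk (u • (1 : EnhU φ))
  rw [smul_eq_mul, mul_one]

theorem mem_highestIdeal_iff (l : X) (u : EnhU φ) : u ∈ highestIdeal φ l ↔ u • eta φ l = 0 := by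
  rw [← mk_eq_smul_eta]
  exact (Submodule.Quotient.mk_eq_zero _).symm

theorem exists_smul_eta (l : X) (m : HighV φ l) : ∃ u : EnhU φ, u • eta φ l = m := by
  obtain ⟨u, rfl⟩ := Submodule.Quotient.mk_surjective (highestIdeal φ l) m
  exact ⟨u, (mk_eq_smul_eta φ l u).symm⟩

theorem rel_smul_eta (l : X) {u : EnhU φ} (h : u ∈ highestRels φ l) : u • eta φ l = 0 :=
  (mem_highestIdeal_iff φ l u).mp (Submodule.subset_span h)

theorem sub_smul_eta (l : X) {u : EnhU φ} {c : Coeff}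
    (h : u - algebraMap Coeff _ c ∈ highestRels φ l) : u • eta φ l = c • eta φ l := by
  have := rel_smul_eta φ l h
  rwa [sub_smul, algebraMap_smul, sub_eq_zero] at this

theorem E_eta (l : X) (i : I) : uE φ i • eta φ l = 0 :=
  rel_smul_eta φ l (Or.inl (Or.inl (Or.inl (Or.inl (Or.inl ⟨i, rfl⟩)))))

theorem F_pow_eta (l : X) (i : I) :
    uF φ i ^ ((D.pairing (D.coroot i) l).toNat + 1) • eta φ l = 0 :=
  rel_smul_eta φ l (Or.inl (Or.inl (Or.inl (Or.inl (Or.inr ⟨i, rfl⟩)))))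

theorem K_eta (l : X) (μ : Y) : uK φ μ • eta φ l = vPow (D.pairing μ l) • eta φ l :=
  sub_smul_eta φ l (Or.inl (Or.inl (Or.inl (Or.inr ⟨μ, rfl⟩))))

theorem J_eta (l : X) (μ : Y) : uJ φ μ • eta φ l = piPow (D.pairing μ l) • eta φ l :=
  sub_smul_eta φ l (Or.inl (Or.inl (Or.inr ⟨μ, rfl⟩)))

theorem T_eta (l : X) (μ : Y) : uT φ μ • eta φ l = tPow (D.pairing μ l) • eta φ l :=
  sub_smul_eta φ l (Or.inl (Or.inr ⟨μ, rfl⟩))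

theorem Ups_eta (l : X) (ν : I →₀ ℤ) : uUps φ ν • eta φ l = tPow (φ.phi ν l) • eta φ l :=
  sub_smul_eta φ l (Or.inr ⟨ν, rfl⟩)

/-- A semilinear endomorphism of `Û` which agrees with the twistor up to powers of `t`. -/
structure TwistorLike (ψ : EnhU φ →+* EnhU φ) : Prop where
  map_scalar : ∀ c, ψ (algebraMap Coeff _ c) = algebraMap Coeff _ (sigma c)
  map_E : ∀ i, ∃ c : Coeff, ψ (uE φ i) = c • (uE φ i * twE φ i)
  map_F : ∀ i, ∃ c : Coeff, ψ (uF φ i) = c • (uF φ i * uUpsi φ (-1) i)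
  map_K : ∀ μ, ψ (uK φ μ) = uT φ (-μ) * uK φ μ
  map_J : ∀ μ, ψ (uJ φ μ) = uT φ (2 • μ) * uJ φ μ
  map_T : ∀ μ, ψ (uT φ μ) = uT φ μ
  map_Ups : ∀ ν, ψ (uUps φ ν) = uUps φ ν

theorem smul_smul_comm' {M : Type*} [AddCommGroup M] [Module Coeff M] [Module (EnhU φ) M]
    [IsScalarTower Coeff (EnhU φ) M] (u : EnhU φ) (c : Coeff) (m : M) :
    u • c • m = c • u • m := by
  rw [← algebraMap_smul (EnhU φ) c m, ← algebraMap_smul (EnhU φ) c (u • m), smul_smul, smul_smul,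
    Algebra.commutes]

variable {φ}

theorem pow_smul_eq {M : Type*} [AddCommGroup M] [Module Coeff M] [Module (EnhU φ) M]
    [IsScalarTower Coeff (EnhU φ) M] {g : EnhU φ} {c : Coeff} {m : M} (h : g • m = c • m) (n : ℕ) :
    g ^ n • m = c ^ n • m := by
  induction n with
  | zero => simp
  | succ n ih => rw [pow_succ', mul_smul, ih, smul_smul_comm', h, smul_smul, pow_succ]

/-- The torus scalars on $\eta_\lambda$ change under `sigma` exactly as the torus generators change
under $\psi$, and the factors attached to $E_i$ and $F_i$ act on $\eta_\lambda$ by scalars. -/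
theorem TwistorLike.mem_highestIdeal {ψ : EnhU φ →+* EnhU φ} (h : TwistorLike φ ψ) (l : X)
    {u : EnhU φ} (hu : u ∈ highestIdeal φ l) : ψ u ∈ highestIdeal φ l := by
  induction hu using Submodule.span_induction with
  | zero => rw [map_zero]; exact Submodule.zero_mem _
  | add x y _ _ hx hy => rw [map_add]; exact Submodule.add_mem _ hx hy
  | smul a x _ hx => rw [smul_eq_mul, map_mul]; exact Submodule.smul_mem _ _ hx
  | mem x hx =>
    rw [mem_highestIdeal_iff]
    rcases hx with ((((⟨i, rfl⟩ | ⟨i, rfl⟩) | ⟨μ, rfl⟩) | ⟨μ, rfl⟩) | ⟨μ, rfl⟩) | ⟨μ, rfl⟩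
    · obtain ⟨c, hc⟩ := h.map_E i
      simp only [hc, twE]
      rw [smul_assoc, mul_smul, mul_smul, Ups_eta, smul_smul_comm', T_eta, smul_smul_comm',
        smul_smul_comm', E_eta, smul_zero, smul_zero, smul_zero]
    · obtain ⟨c, hc⟩ := h.map_F i
      simp only [map_pow, hc]
      -- Collect the $\Upsilon_{-i}$ on the right of $F_i^n$, where they reach $\eta_\lambda$ and
      -- become a scalar.
      rw [_root_.smul_pow, smul_assoc, mul_pow_smul (Upsi_neg_F φ i i), smul_assoc, mul_smul,
        pow_smul_eq (Ups_eta φ l _), smul_smul_comm', F_pow_eta, smul_zero, smul_zero, smul_zero]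
    · simp only [map_sub, h.map_K, h.map_scalar]
      rw [sub_smul, algebraMap_smul, mul_smul, K_eta, smul_smul_comm', T_eta, smul_smul, sigma_vPow,
        map_neg, LinearMap.neg_apply, mul_comm, sub_self]
    · simp only [map_sub, h.map_J, h.map_scalar]
      rw [sub_smul, algebraMap_smul, mul_smul, J_eta, smul_smul_comm', T_eta, smul_smul,
        sigma_piPow, map_nsmul, LinearMap.smul_apply, mul_comm, nsmul_eq_mul, Nat.cast_ofNat,
        sub_self]
    · simp only [map_sub, h.map_T, h.map_scalar, sigma_tPow]
      rw [sub_smul, algebraMap_smul, T_eta, sub_self]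
    · simp only [map_sub, h.map_Ups, h.map_scalar, sigma_tPow]
      rw [sub_smul, algebraMap_smul, Ups_eta, sub_self]

/-- A ring endomorphism as a semilinear endomorphism of the regular module. -/
def semilinearSelf (ψ : EnhU φ →+* EnhU φ) : EnhU φ →ₛₗ[ψ] EnhU φ where
  toFun := ψ
  map_add' := map_add ψ
  map_smul' := map_mul ψ

/-- The semilinear endomorphism of `V(λ)[t]` induced by an endomorphism of `Û`. -/
def inducedV {ψ : EnhU φ →+* EnhU φ} (h : TwistorLike φ ψ) (l : X) : HighV φ l →ₛₗ[ψ] HighV φ l :=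
  Submodule.mapQ (highestIdeal φ l) (highestIdeal φ l) (semilinearSelf ψ)
    fun _ hu => h.mem_highestIdeal l hu

theorem inducedV_eta {ψ : EnhU φ →+* EnhU φ} (h : TwistorLike φ ψ) (l : X) :
    inducedV h l (eta φ l) = eta φ l := by
  have : inducedV h l (eta φ l) = (Submodule.Quotient.mk (ψ 1) : EnhU φ ⧸ highestIdeal φ l) := rfl
  rw [this, map_one]
  rfl

theorem inducedV_smul {ψ : EnhU φ →+* EnhU φ} (h : TwistorLike φ ψ) (l : X) (u : EnhU φ)
    (m : HighV φ l) : inducedV h l (u • m) = ψ u • inducedV h l m :=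
  (inducedV h l).map_smulₛₗ u m

theorem gauss_smul {M : Type*} [AddCommGroup M] [Module Coeff M] [Module (EnhU φ) M]
    [IsScalarTower Coeff (EnhU φ) M] [Module GaussQ M] [IsScalarTower GaussQ Coeff M]
    (c : GaussQ) (m : M) : c • m = algebraMap Coeff (EnhU φ) (algebraMap GaussQ Coeff c) • m := by
  rw [algebraMap_smul, algebraMap_smul]

/-- `inducedV` as a `ℚ(t)`-linear map. -/
def inducedGauss {ψ : EnhU φ →+* EnhU φ} (h : TwistorLike φ ψ) (l : X) :
    HighV φ l →ₗ[GaussQ] HighV φ l where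
  toFun := inducedV h l
  map_add' := map_add _
  map_smul' c m := by
    rw [gauss_smul (φ := φ) c m, inducedV_smul, h.map_scalar, sigma_algebraMap, ← gauss_smul]
    rfl

variable (φ)

theorem twistorLike_twistor : TwistorLike φ (twistorRing φ) where
  map_scalar := twistorRing_algebraMap φ
  map_E _ := ⟨_, twistorRing_gen φ _⟩
  map_F i := ⟨1, by rw [one_smul]; exact twistorRing_gen φ (Gen.F i)⟩
  map_K _ := twistorRing_gen φ _
  map_J _ := twistorRing_gen φ _
  map_T _ := twistorRing_gen φ _
  map_Ups _ := twistorRing_gen φ _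

theorem existsUnique_highTwistor {𝔛 : EnhU φ ≃ₐ[GaussQ] EnhU φ} (h𝔛 : IsTwistor φ 𝔛) (l : X) :
    ∃! f, IsHighTwistor φ 𝔛 l f := by
  obtain rfl := h𝔛.eq_twistor
  refine ⟨inducedGauss (twistorLike_twistor φ) l,
    ⟨inducedV_eta (twistorLike_twistor φ) l, inducedV_smul (twistorLike_twistor φ) l⟩, fun f hf => ?_⟩
  ext m
  obtain ⟨u, rfl⟩ := exists_smul_eta φ l m
  rw [hf.map_smul, hf.map_eta]
  change _ = inducedV (twistorLike_twistor φ) l (u • eta φ l)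
  rw [inducedV_smul, inducedV_eta]
  rfl

/-! ### The twistor on the lowest weight module -/

/-- The conjugate of `rescale` by `ω`. -/
def rescaleConj (l : X) : EnhU φ →ₐ[Coeff] EnhU φ :=
  (omega φ).toAlgHom.comp ((rescale φ l).comp (omega φ).symm.toAlgHom)

theorem rescaleConj_omega (l : X) (u : EnhU φ) :
    rescaleConj φ l (omega φ u) = omega φ (rescale φ l u) := by
  change omega φ (rescale φ l ((omega φ).symm (omega φ u))) = _
  rw [AlgEquiv.symm_apply_apply]

theorem omega_cElt (i : I) : omega φ (cElt φ i) = cElt φ i := omegaHom_cElt φ i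

theorem rescale_cElt (l : X) (i : I) : rescale φ l (cElt φ i) = cElt φ i := by
  rw [cElt, map_smul, rescale_gen, rescaleGen]; intro ν h; cases h

theorem rescale_fix (l : X) (g : Gen I Y) (hg : ∀ ν, g ≠ Gen.Ups ν) :
    rescale φ l (gen φ g) = gen φ g := by
  rw [rescale_gen, rescaleGen]; exact fun ν h => hg ν h

theorem rescaleConj_gen (l : X) (g : Gen I Y) (hg : ∀ ν, g ≠ Gen.Ups ν) :
    rescaleConj φ l (gen φ g) = gen φ g := by
  have key : ∀ u, rescale φ l u = u → rescaleConj φ l (omega φ u) = omega φ u := fun u hu => by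
    rw [rescaleConj_omega, hu]
  cases g with
  | E i =>
    -- $E_i$ is not the image of a generator under $\omega$; the involution $\pi_i\tilde J_i$
    -- corrects this.
    have h1 : omega φ (cElt φ i * uF φ i) = uE φ i := by
      rw [map_mul, omega_cElt, omega_gen, omegaGen_F, ← mul_assoc, cElt_sq, one_mul]
    have := key (cElt φ i * uF φ i) (by rw [map_mul, rescale_cElt, rescale_fix]; simp)
    rwa [h1] at this
  | F i =>
    have := key (uE φ i) (rescale_fix φ l _ (by simp))
    rwa [omega_gen] at this
  | K μ =>
    have := key (uK φ (-μ)) (rescale_fix φ l _ (by simp))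
    rwa [omega_gen, omegaGen, neg_neg] at this
  | J μ =>
    have := key (uJ φ μ) (rescale_fix φ l _ (by simp))
    rwa [omega_gen] at this
  | T μ =>
    have := key (uT φ (-μ)) (rescale_fix φ l _ (by simp))
    rwa [omega_gen, omegaGen, neg_neg] at this
  | Ups ν => exact absurd rfl (hg ν)

theorem rescaleConj_Ups (l : X) (ν : I →₀ ℤ) :
    rescaleConj φ l (uUps φ ν) = tPow (shiftExp φ l (-ν)) • uUps φ ν := by
  have : uUps φ ν = omega φ (uUps φ (-ν)) := by rw [omega_gen, omegaGen, neg_neg]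
  rw [this, rescaleConj_omega, rescale_gen, rescaleGen, map_smul]

/-- Only powers of $\mathbf t$ are introduced, so the order divides $4$ and the cube can serve as
the inverse in `twistorConj`. -/
theorem rescaleConj_four (l : X) (u : EnhU φ) :
    rescaleConj φ l (rescaleConj φ l (rescaleConj φ l (rescaleConj φ l u))) = u := by
  have : (rescaleConj φ l).comp ((rescaleConj φ l).comp
      ((rescaleConj φ l).comp (rescaleConj φ l))) = AlgHom.id _ _ := by
    apply algHom_ext
    intro g
    simp only [AlgHom.comp_apply, AlgHom.id_apply]
    by_cases hg : ∃ ν, g = Gen.Ups ν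
    · obtain ⟨ν, rfl⟩ := hg
      simp only [rescaleConj_Ups, map_smul, smul_smul, ← tPow_add]
      rw [tPow_congr (b := 0), tPow_zero, one_smul]
      exact Int.modEq_zero_iff_dvd.mpr ⟨shiftExp φ l (-ν), by ring⟩
    · simp only [rescaleConj_gen φ l g fun ν h => hg ⟨ν, h⟩]
  exact DFunLike.congr_fun this u

/-- The conjugate of the twistor by `rescaleConj`. -/
def twistorConj (l : X) : EnhU φ →+* EnhU φ :=
  (rescaleConj φ l : EnhU φ →+* EnhU φ).comp ((twistorRing φ).comp
    ((rescaleConj φ l : EnhU φ →+* EnhU φ).comp ((rescaleConj φ l : EnhU φ →+* EnhU φ).comp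
      (rescaleConj φ l : EnhU φ →+* EnhU φ))))

theorem twistorConj_apply (l : X) (u : EnhU φ) : twistorConj φ l u =
    rescaleConj φ l (twistorRing φ (rescaleConj φ l (rescaleConj φ l (rescaleConj φ l u)))) := rfl

/-- Conjugation affects only the $\Upsilon$-factor in the images of $E_i$ and $F_i$, hence changes
them by a scalar; this is why `TwistorLike` leaves those scalars free. -/
theorem twistorLike_conj (l : X) : TwistorLike φ (twistorConj φ l) where
  map_scalar c := by simp only [twistorConj_apply, AlgHom.commutes, twistorRing_algebraMap]
  map_E i := by
    refine ⟨tPow (shiftExp φ l (-Finsupp.single i 1)) * tPow (2 * C.d i), ?_⟩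
    simp only [twistorConj_apply, rescaleConj_gen φ l (Gen.E i) (by simp)]
    rw [twistorRing_gen, twistorGen, map_smul, map_mul, twE, map_mul,
      rescaleConj_gen φ l (Gen.E i) (by simp), rescaleConj_gen φ l (Gen.T _) (by simp),
      rescaleConj_Ups, mul_smul_comm, mul_smul_comm, smul_smul, mul_comm]
  map_F i := by
    refine ⟨tPow (shiftExp φ l (-Finsupp.single i (-1))), ?_⟩
    simp only [twistorConj_apply, rescaleConj_gen φ l (Gen.F i) (by simp)]
    rw [twistorRing_gen, twistorGen, map_mul, rescaleConj_gen φ l (Gen.F i) (by simp),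
      rescaleConj_Ups, mul_smul_comm]
  map_K μ := by
    simp only [twistorConj_apply, rescaleConj_gen φ l (Gen.K μ) (by simp)]
    rw [twistorRing_gen, twistorGen, map_mul, rescaleConj_gen φ l (Gen.K _) (by simp),
      rescaleConj_gen φ l (Gen.T _) (by simp)]
  map_J μ := by
    simp only [twistorConj_apply, rescaleConj_gen φ l (Gen.J μ) (by simp)]
    rw [twistorRing_gen, twistorGen, map_mul, rescaleConj_gen φ l (Gen.J _) (by simp),
      rescaleConj_gen φ l (Gen.T _) (by simp)]
  map_T μ := by
    simp only [twistorConj_apply, rescaleConj_gen φ l (Gen.T μ) (by simp)]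
    rw [twistorRing_gen, twistorGen, rescaleConj_gen φ l (Gen.T _) (by simp)]
  map_Ups ν := by
    have h : twistorRing φ (uUps φ ν) = uUps φ ν := twistorRing_gen φ _
    simp only [twistorConj_apply, rescaleConj_Ups, map_smul, twistorRing_smul, sigma_tPow, h,
      smul_smul, ← tPow_add]
    rw [tPow_congr (b := 0), tPow_zero, one_smul]
    exact Int.modEq_zero_iff_dvd.mpr ⟨shiftExp φ l (-ν), by ring⟩

theorem twistorPrime_apply (u : EnhU φ) :
    twistorPrime φ (twistor φ) u = (omega φ).symm (twistorRing φ (omega φ u)) := rfl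

/-- The generators act on the lowest weight module through $\omega$ followed by `rescaleConj`. The
conjugated twistor is the one for which semilinearity on the underlying space reads as semilinearity
over $\mathfrak X'$. -/
theorem twistorConj_omega (l : X) (u : EnhU φ) : twistorConj φ l (omega φ (rescale φ l u)) =
    omega φ (rescale φ l (twistorPrime φ (twistor φ) u)) := by
  rw [← rescaleConj_omega, twistorConj_apply, rescaleConj_four, ← rescaleConj_omega,
    twistorPrime_apply, AlgEquiv.apply_symm_apply]

theorem exists_smul_xi (l : X) (m : LowV φ l) : ∃ u : EnhU φ, u • xi φ l = m := by
  obtain ⟨m, rfl⟩ := (toLow φ l).surjective m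
  obtain ⟨w, rfl⟩ := exists_smul_eta φ l m
  refine ⟨(omega φ).symm (rescaleConj φ l (rescaleConj φ l (rescaleConj φ l w))), ?_⟩
  rw [xi, low_smul, ← rescaleConj_omega, AlgEquiv.apply_symm_apply, rescaleConj_four]

theorem existsUnique_lowTwistor {𝔛 : EnhU φ ≃ₐ[GaussQ] EnhU φ} (h𝔛 : IsTwistor φ 𝔛) (l : X) :
    ∃! f, IsLowTwistor φ 𝔛 l f := by
  obtain rfl := h𝔛.eq_twistor
  let f : LowV φ l →ₗ[GaussQ] LowV φ l := inducedGauss (twistorLike_conj φ l) l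
  have h1 : f (xi φ l) = xi φ l := inducedV_eta (twistorLike_conj φ l) l
  have h2 : ∀ (u : EnhU φ) (m : LowV φ l),
      f (u • m) = twistorPrime φ (twistor φ) u • f m := by
    intro u m
    have := inducedV_smul (twistorLike_conj φ l) l (omega φ (rescale φ l u)) m
    rw [twistorConj_omega] at this
    exact this
  refine ⟨f, ⟨h1, h2⟩, fun g hg => ?_⟩
  ext m
  obtain ⟨u, rfl⟩ := exists_smul_xi φ l m
  rw [hg.map_smul, hg.map_xi, h2, h1]

end ModuleTwistors

/-! ## Weight spaces -/

theorem RatFunc_X_zpow_ne_one {n : ℤ} (hn : n ≠ 0) : (RatFunc.X : RatFunc GaussQ) ^ n ≠ 1 := by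
  intro h
  have hpow : ∀ m : ℕ, RatFunc.intDegree ((RatFunc.X : RatFunc GaussQ) ^ m) = m := by
    intro m
    rw [← RatFunc.algebraMap_X, ← map_pow, RatFunc.intDegree_polynomial]
    simp
  have h' := congrArg RatFunc.intDegree h
  rcases Int.eq_nat_or_neg n with ⟨m, rfl | rfl⟩
  · rw [zpow_natCast, hpow, RatFunc.intDegree_one] at h'
    exact hn h'
  · rw [zpow_neg, zpow_natCast, RatFunc.intDegree_inv, hpow, RatFunc.intDegree_one] at h'
    exact hn h'

theorem vPow_eq_algebraMap (n : ℤ) :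
    vPow n = algebraMap (RatFunc GaussQ) Coeff (RatFunc.X ^ n) := by
  simp only [vPow, vU, ← map_zpow, Units.coe_map]
  rw [Units.val_zpow_eq_zpow_val]
  rfl

/-- The coefficient ring has zero divisors, as $(1-\pi)(1+\pi)=0$, so separating eigenvalues
requires a unit. The difference is a nonzero element of the field $\mathbb Q(\mathbf t)(v)$. -/
theorem isUnit_vPow_sub {a b : ℤ} (h : a ≠ b) : IsUnit (vPow a - vPow b) := by
  rw [vPow_eq_algebraMap, vPow_eq_algebraMap, ← map_sub]
  refine (IsUnit.mk0 _ fun h0 => ?_).map _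
  refine RatFunc_X_zpow_ne_one (sub_ne_zero.mpr h) ?_
  rw [zpow_sub₀ RatFunc.X_ne_zero, sub_eq_zero.mp h0, div_self]
  exact zpow_ne_zero _ RatFunc.X_ne_zero

section Weights

variable {I Y X : Type*} [AddCommGroup Y] [AddCommGroup X] {C : SuperCartanDatum I}
  {D : RootDatum C Y X} (φ : Enhancer D)

section Generic

variable (M : Type*) [AddCommGroup M] [Module Coeff M] [Module (EnhU φ) M]
  [IsScalarTower Coeff (EnhU φ) M]

/-- The weight space of weight `z`. -/
def weightSpace (z : X) : Submodule Coeff M where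
  carrier := {m | HasWeight φ m z}
  zero_mem' := fun μ ν => by rw [smul_zero, smul_zero]
  add_mem' := fun ha hb μ ν => by rw [smul_add, smul_add, ha μ ν, hb μ ν]
  smul_mem' := fun c m hm μ ν => by
    rw [smul_smul_comm', hm μ ν, smul_smul_comm']

variable {M φ}

theorem mem_weightSpace {m : M} {z : X} : m ∈ weightSpace φ M z ↔ HasWeight φ m z := Iff.rfl

theorem HasWeight.K_smul {m : M} {z : X} (h : HasWeight φ m z) (μ : Y) :
    uK φ μ • m = vPow (D.pairing μ z) • m := by
  have := h 0 μ
  rwa [J_zero, one_mul, map_zero, LinearMap.zero_apply, piPow_zero, one_mul, algebraMap_smul] at this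

theorem HasWeight.J_smul {m : M} {z : X} (h : HasWeight φ m z) (μ : Y) :
    uJ φ μ • m = piPow (D.pairing μ z) • m := by
  have := h μ 0
  rwa [K_zero, mul_one, map_zero, LinearMap.zero_apply, vPow_zero, mul_one, algebraMap_smul] at this

theorem hasWeight_of_smul {m : M} {z : X} (hK : ∀ μ, uK φ μ • m = vPow (D.pairing μ z) • m)
    (hJ : ∀ μ, uJ φ μ • m = piPow (D.pairing μ z) • m) : HasWeight φ m z := by
  intro μ ν
  rw [algebraMap_smul, mul_smul, hK, smul_smul_comm', hJ, smul_smul, mul_comm]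

theorem smul_gen_smul {g e : EnhU φ} {s c : Coeff} {m : M} (he : g * e = s • (e * g))
    (hm : g • m = c • m) : g • e • m = (s * c) • e • m := by
  rw [← mul_smul, he, smul_assoc, mul_smul, hm, smul_smul_comm', smul_smul]

theorem HasWeight.E_smul {m : M} {z : X} (h : HasWeight φ m z) (i : I) :
    HasWeight φ (uE φ i • m) (z + D.root i) := by
  refine hasWeight_of_smul (fun μ => ?_) fun μ => ?_
  · rw [smul_gen_smul (K_E φ μ i) (h.K_smul μ), ← vPow_add, map_add, add_comm]
  · rw [smul_gen_smul (J_E φ μ i) (h.J_smul μ), ← piPow_add, map_add, add_comm]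

theorem HasWeight.F_smul {m : M} {z : X} (h : HasWeight φ m z) (i : I) :
    HasWeight φ (uF φ i • m) (z - D.root i) := by
  refine hasWeight_of_smul (fun μ => ?_) fun μ => ?_
  · rw [smul_gen_smul (K_F φ μ i) (h.K_smul μ), ← vPow_add, map_sub, neg_add_eq_sub]
  · rw [smul_gen_smul (J_F φ μ i) (h.J_smul μ), ← piPow_add, map_sub, neg_add_eq_sub]

theorem exists_pairing_ne {z z' : X} (h : z ≠ z') : ∃ μ : Y, D.pairing μ z ≠ D.pairing μ z' := by
  by_contra! hc
  have hinj : Function.Injective D.pairing.flip :=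
    (LinearMap.IsPerfPair.bijective_right D.pairing (self := D.perfect)).1
  exact h (hinj (LinearMap.ext hc))

/-- The usual elimination for eigenvectors with distinct eigenvalues, done with the $K_\mu$ alone.
-/
theorem eq_zero_of_add_sum_eq_zero (t : Finset X) : ∀ (a : X) (x : M) (w : X → M), a ∉ t →
    HasWeight φ x a → (∀ z ∈ t, HasWeight φ (w z) z) → x + ∑ z ∈ t, w z = 0 → x = 0 := by
  classical
  induction t using Finset.induction_on with
  | empty => intro a x w _ _ _ h; simpa using h
  | insert b t hb ih =>
    intro a x w ha hx hw h
    have hab : a ≠ b := fun h => ha (by rw [h]; exact Finset.mem_insert_self _ _)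
    obtain ⟨μ, hμ⟩ := exists_pairing_ne (D := D) hab
    have hwz : ∀ z ∈ t, uK φ μ • w z = vPow (D.pairing μ z) • w z := fun z hz =>
      (hw z (Finset.mem_insert_of_mem hz)).K_smul μ
    -- Applying $K_\mu-v^{\langle\mu,b\rangle}$ removes the component of weight $b$ and multiplies
    -- $x$ by a unit.
    have h1 := congrArg (fun m => uK φ μ • m - vPow (D.pairing μ b) • m) h
    simp only [smul_add, smul_zero, sub_zero, Finset.sum_insert hb, Finset.smul_sum] at h1
    rw [hx.K_smul, (hw b (Finset.mem_insert_self _ _)).K_smul, Finset.sum_congr rfl hwz,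
      ← add_assoc, ← add_assoc, add_sub_add_comm, add_sub_add_right_eq_sub, ← sub_smul,
      ← Finset.sum_sub_distrib] at h1
    simp only [← sub_smul] at h1
    have h2 := ih a ((vPow (D.pairing μ a) - vPow (D.pairing μ b)) • x)
      (fun z => (vPow (D.pairing μ z) - vPow (D.pairing μ b)) • w z)
      (fun h => ha (Finset.mem_insert_of_mem h)) ((weightSpace φ M a).smul_mem _ hx)
      (fun z hz => (weightSpace φ M z).smul_mem _ (hw z (Finset.mem_insert_of_mem hz))) h1
    obtain ⟨u, hu⟩ := isUnit_vPow_sub hμ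
    rw [← hu] at h2
    rw [← one_smul Coeff x, ← Units.inv_mul u, mul_smul, h2, smul_zero]

variable (φ M) in
theorem iSupIndep_weightSpace : iSupIndep (weightSpace φ M) := by
  rw [iSupIndep_iff_finsetSum_eq_zero_imp_eq_zero]
  intro t w hw h a ha
  classical
  refine eq_zero_of_add_sum_eq_zero (φ := φ) (t.erase a) a (w a) w (Finset.notMem_erase a t)
    (hw a ha) (fun z hz => hw z (Finset.mem_of_mem_erase hz)) ?_
  rwa [Finset.add_sum_erase _ _ ha]

end Generic

/-- By the modular law, a family that spans and lies inside an independent family has no room to be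
smaller. -/
theorem eq_of_le_of_iSupIndep {ι R M : Type*} [Ring R] [AddCommGroup M] [Module R M]
    {V W : ι → Submodule R M} (hW : iSupIndep W) (hle : ∀ i, V i ≤ W i) (htop : ⨆ i, V i = ⊤)
    (i : ι) : V i = W i := by
  refine le_antisymm (hle i) ?_
  have h1 : (⊤ : Submodule R M) = V i ⊔ ⨆ j ≠ i, V j := by
    rw [← htop]
    exact iSup_split_single V i
  have h2 : W i ⊓ ⨆ j ≠ i, V j = ⊥ := by
    rw [eq_bot_iff, ← (hW i).eq_bot]
    exact inf_le_inf_left _ (iSup₂_mono fun j _ => hle j)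
  calc W i = (V i ⊔ ⨆ j ≠ i, V j) ⊓ W i := by rw [← h1, top_inf_eq]
    _ = V i ⊔ (⨆ j ≠ i, V j) ⊓ W i := (sup_inf_assoc_of_le _ (hle i))
    _ ≤ V i := by rw [inf_comm, h2, sup_bot_eq]

variable (D) in
theorem wtN_eq_wt (ν : I →₀ ℕ) : D.wtN ν = D.wt (ν.mapRange (Nat.cast : ℕ → ℤ) rfl) := by
  rw [RootDatum.wtN, RootDatum.wt, Finsupp.linearCombination_apply,
    Finsupp.linearCombination_apply, Finsupp.sum_mapRange_index (by simp)]
  simp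

variable (D) in
theorem wtN_injective : Function.Injective D.wtN := by
  intro ν μ hνμ
  rw [wtN_eq_wt, wtN_eq_wt] at hνμ
  exact Finsupp.mapRange_injective _ _ Nat.cast_injective (D.regularX hνμ)

variable (D) in
theorem wtN_zero : D.wtN 0 = 0 := map_zero (Finsupp.linearCombination ℕ D.root)

variable (D) in
theorem wtN_add (ν μ : I →₀ ℕ) : D.wtN (ν + μ) = D.wtN ν + D.wtN μ :=
  map_add (Finsupp.linearCombination ℕ D.root) ν μ

variable (D) in
theorem wtN_single (i : I) : D.wtN (Finsupp.single i 1) = D.root i := by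
  simp [RootDatum.wtN]

theorem wt_single (i : I) : D.wt (Finsupp.single i 1) = D.root i := by
  simp [RootDatum.wt]

theorem phi_add_root (ν : I →₀ ℤ) (z : X) (i : I) :
    φ.phi ν (z + D.root i) ≡ φ.phi ν z + φ.phi ν (D.root i) [ZMOD 4] := by
  have := φ.add_right ν z (Finsupp.single i 1)
  rwa [wt_single, add_comm (φ.phi ν (D.root i))] at this

theorem phi_sub_root (ν : I →₀ ℤ) (z : X) (i : I) :
    φ.phi ν (z - D.root i) ≡ φ.phi ν z - φ.phi ν (D.root i) [ZMOD 4] := by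
  have := phi_add_root φ ν (z - D.root i) i
  rw [sub_add_cancel] at this
  simpa using (this.sub_right (φ.phi ν (D.root i))).symm

theorem parity_add (ν μ : I →₀ ℕ) : C.parity (ν + μ) = C.parity ν + C.parity μ :=
  Finsupp.sum_add_index' (by simp) fun i a b => add_mul a b _

theorem parity_single (i : I) : C.parity (Finsupp.single i 1) = C.p i := by
  simp [SuperCartanDatum.parity]

/-! ### Monomials in the $F_i$ and the weight spaces they span -/

/-- The vector `F_{i₁} ⋯ F_{iₙ} η_λ`. -/
def monomialV (l : X) : List I → HighV φ l
  | [] => eta φ l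
  | i :: L => uF φ i • monomialV l L

/-- The content of a word. -/
def content : List I → (I →₀ ℕ)
  | [] => 0
  | i :: L => content L + Finsupp.single i 1

/-- All the generators of the torus act on `m` by the weight `z`. -/
structure IsWeightVector {M : Type*} [AddCommGroup M] [Module Coeff M] [Module (EnhU φ) M]
    (m : M) (z : X) : Prop where
  K_smul : ∀ μ, uK φ μ • m = vPow (D.pairing μ z) • m
  J_smul : ∀ μ, uJ φ μ • m = piPow (D.pairing μ z) • m
  T_smul : ∀ μ, uT φ μ • m = tPow (D.pairing μ z) • m
  Ups_smul : ∀ ν, uUps φ ν • m = tPow (φ.phi ν z) • m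

section Generic

variable {M : Type*} [AddCommGroup M] [Module Coeff M] [Module (EnhU φ) M]
  [IsScalarTower Coeff (EnhU φ) M]

variable {φ}

theorem IsWeightVector.hasWeight {m : M} {z : X} (h : IsWeightVector φ m z) : HasWeight φ m z :=
  hasWeight_of_smul h.K_smul h.J_smul

theorem IsWeightVector.F_smul {m : M} {z : X} (h : IsWeightVector φ m z) (i : I) :
    IsWeightVector φ (uF φ i • m) (z - D.root i) where
  K_smul := (h.hasWeight.F_smul i).K_smul
  J_smul := (h.hasWeight.F_smul i).J_smul
  T_smul μ := by
    rw [smul_gen_smul (T_F φ μ i) (h.T_smul μ), ← tPow_add, map_sub, neg_add_eq_sub]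
  Ups_smul ν := by
    rw [smul_gen_smul (Ups_F φ ν i) (h.Ups_smul ν), ← tPow_add, neg_add_eq_sub,
      tPow_congr (phi_sub_root φ ν z i)]

end Generic

theorem isWeightVector_monomial (l : X) (L : List I) :
    IsWeightVector φ (monomialV φ l L) (l - D.wtN (content L)) := by
  induction L with
  | nil =>
    rw [content, wtN_zero, sub_zero]
    exact ⟨K_eta φ l, J_eta φ l, T_eta φ l, Ups_eta φ l⟩
  | cons i L ih =>
    rw [content, wtN_add, wtN_single, ← sub_sub]
    exact ih.F_smul i

/-- The span of the monomials of a given content. -/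
def contentSpace (l : X) (ν : I →₀ ℕ) : Submodule Coeff (HighV φ l) :=
  Submodule.span Coeff {m | ∃ L : List I, content L = ν ∧ monomialV φ l L = m}

variable {φ}

theorem monomial_mem (l : X) (L : List I) : monomialV φ l L ∈ contentSpace φ l (content L) :=
  Submodule.subset_span ⟨L, rfl, rfl⟩

theorem isWeightVector_of_mem {l : X} {ν : I →₀ ℕ} {m : HighV φ l} (hm : m ∈ contentSpace φ l ν) :
    IsWeightVector φ m (l - D.wtN ν) := by
  induction hm using Submodule.span_induction with
  | mem x hx => obtain ⟨L, rfl, rfl⟩ := hx; exact isWeightVector_monomial φ l L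
  | zero => constructor <;> intro <;> simp only [smul_zero]
  | add x y _ _ hx hy =>
    constructor <;> intro μ <;> rw [smul_add, smul_add]
    · rw [hx.K_smul, hy.K_smul]
    · rw [hx.J_smul, hy.J_smul]
    · rw [hx.T_smul, hy.T_smul]
    · rw [hx.Ups_smul, hy.Ups_smul]
  | smul c x _ hx =>
    constructor <;> intro μ <;> rw [smul_smul_comm', smul_comm _ c]
    · rw [hx.K_smul]
    · rw [hx.J_smul]
    · rw [hx.T_smul]
    · rw [hx.Ups_smul]

theorem F_smul_mem {l : X} {ν : I →₀ ℕ} {m : HighV φ l} (hm : m ∈ contentSpace φ l ν) (i : I) :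
    uF φ i • m ∈ contentSpace φ l (ν + Finsupp.single i 1) := by
  induction hm using Submodule.span_induction with
  | mem x hx => obtain ⟨L, rfl, rfl⟩ := hx; exact monomial_mem l (i :: L)
  | zero => rw [smul_zero]; exact zero_mem _
  | add x y _ _ hx hy => rw [smul_add]; exact add_mem hx hy
  | smul c x _ hx => rw [smul_smul_comm']; exact Submodule.smul_mem _ _ hx

/-- On a weight vector the torus part of the commutator is a scalar $c$. Its value never matters,
only its vanishing for $i\ne j$. -/
theorem E_F_smul {M : Type*} [AddCommGroup M] [Module Coeff M] [Module (EnhU φ) M]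
    [IsScalarTower Coeff (EnhU φ) M] {m : M} {z : X} (hm : IsWeightVector φ m z) (i j : I) :
    ∃ c : Coeff, (i ≠ j → c = 0) ∧
      uE φ i • uF φ j • m = piPow (C.p i * C.p j) • uF φ j • uE φ i • m + c • m := by
  rcases eq_or_ne i j with rfl | h
  · have h1 := congrArg (· • m) (E_F_self φ i)
    simp only [sub_smul, smul_assoc, mul_smul (uE φ i), mul_smul (uF φ i), mul_smul (uJt φ 1 i),
      hm.K_smul, hm.J_smul, smul_smul_comm'] at h1
    rw [sub_eq_iff_eq_add', smul_smul (vPow _), ← sub_smul, smul_smul (Ring.inverse _)] at h1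
    exact ⟨_, fun h => absurd rfl h, h1⟩
  · have h1 := congrArg (· • m) (E_F φ i j h)
    simp only [sub_smul, smul_assoc, mul_smul, zero_smul] at h1
    exact ⟨0, fun _ => rfl, by rw [zero_smul, add_zero]; exact sub_eq_zero.mp h1⟩

/-- The span of the monomials whose content becomes `ν` when `i` is added. -/
def lowerSpace (φ : Enhancer D) (l : X) (i : I) (ν : I →₀ ℕ) : Submodule Coeff (HighV φ l) :=
  Submodule.span Coeff
    {m | ∃ L : List I, content L + Finsupp.single i 1 = ν ∧ monomialV φ l L = m}

theorem F_smul_mem_lowerSpace {l : X} {i : I} {ν : I →₀ ℕ} {m : HighV φ l}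
    (hm : m ∈ lowerSpace φ l i ν) (j : I) :
    uF φ j • m ∈ lowerSpace φ l i (ν + Finsupp.single j 1) := by
  induction hm using Submodule.span_induction with
  | mem x hx =>
    obtain ⟨L, rfl, rfl⟩ := hx
    exact Submodule.subset_span ⟨j :: L, add_right_comm _ _ _, rfl⟩
  | zero => rw [smul_zero]; exact zero_mem _
  | add x y _ _ hx hy => rw [smul_add]; exact add_mem hx hy
  | smul c x _ hx => rw [smul_smul_comm']; exact Submodule.smul_mem _ _ hx

/-- Commute $E_i$ to the right until it kills $\eta_\lambda$; each correction deletes one letter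
$i$. `lowerSpace` expresses the deletion without subtracting in $\mathbb N[I]$ and is zero when
there is no $i$ to delete. -/
theorem E_smul_monomial (l : X) (i : I) (L : List I) :
    uE φ i • monomialV φ l L ∈ lowerSpace φ l i (content L) := by
  induction L with
  | nil => rw [monomialV, E_eta]; exact zero_mem _
  | cons j L ih =>
    obtain ⟨c, hc0, hc⟩ := E_F_smul (isWeightVector_monomial φ l L) i j
    rw [monomialV, hc]
    refine add_mem (Submodule.smul_mem _ _ (F_smul_mem_lowerSpace ih j)) ?_
    rcases eq_or_ne i j with rfl | h
    · exact Submodule.smul_mem _ _ (Submodule.subset_span ⟨L, rfl, rfl⟩)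
    · rw [hc0 h, zero_smul]; exact zero_mem _

theorem E_smul_mem_lowerSpace {l : X} {ν : I →₀ ℕ} {m : HighV φ l}
    (hm : m ∈ contentSpace φ l ν) (i : I) : uE φ i • m ∈ lowerSpace φ l i ν := by
  induction hm using Submodule.span_induction with
  | mem x hx => obtain ⟨L, rfl, rfl⟩ := hx; exact E_smul_monomial l i L
  | zero => rw [smul_zero]; exact zero_mem _
  | add x y _ _ hx hy => rw [smul_add]; exact add_mem hx hy
  | smul c x _ hx => rw [smul_smul_comm']; exact Submodule.smul_mem _ _ hx

theorem lowerSpace_eq_contentSpace (l : X) (i : I) (ν : I →₀ ℕ) :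
    lowerSpace φ l i (ν + Finsupp.single i 1) = contentSpace φ l ν := by
  simp only [lowerSpace, contentSpace, add_left_inj]

theorem lowerSpace_eq_bot (l : X) (i : I) {ν : I →₀ ℕ} (h : ν i = 0) :
    lowerSpace φ l i ν = ⊥ := by
  rw [lowerSpace, Submodule.span_eq_bot]
  rintro _ ⟨L, rfl, _⟩
  simp at h

theorem exists_add_single (ν : I →₀ ℕ) (i : I) :
    ν i = 0 ∨ ∃ ν', ν = ν' + Finsupp.single i 1 := by
  rcases Nat.eq_zero_or_pos (ν i) with h | h
  · exact Or.inl h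
  · refine Or.inr ⟨ν - Finsupp.single i 1, (tsub_add_cancel_of_le ?_).symm⟩
    exact Finsupp.single_le_iff.mpr h

/-- The sum of the content spaces is stable under all generators and contains $\eta_\lambda$. -/
theorem iSup_contentSpace (l : X) : ⨆ ν, contentSpace φ l ν = ⊤ := by
  have hle : ∀ ν, contentSpace φ l ν ≤ ⨆ ν, contentSpace φ l ν := le_iSup _
  have key : ∀ u : EnhU φ, ∀ m ∈ ⨆ ν, contentSpace φ l ν, u • m ∈ ⨆ ν, contentSpace φ l ν := by
    intro u
    induction u using U_induction with
    | scalar c => intro m hm; rw [algebraMap_smul]; exact Submodule.smul_mem _ _ hm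
    | mul x y hx hy => intro m hm; rw [mul_smul]; exact hx _ (hy _ hm)
    | add x y hx hy => intro m hm; rw [add_smul]; exact add_mem (hx _ hm) (hy _ hm)
    | gen g =>
      intro m hm
      induction hm using Submodule.iSup_induction' with
      | zero => rw [smul_zero]; exact zero_mem _
      | add x y _ _ hx hy => rw [smul_add]; exact add_mem hx hy
      | mem ν x hx =>
        have hw := isWeightVector_of_mem hx
        cases g with
        | E i =>
          have h1 := E_smul_mem_lowerSpace hx i
          rcases exists_add_single ν i with h | ⟨ν', rfl⟩
          · rw [lowerSpace_eq_bot l i h, Submodule.mem_bot] at h1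
            rw [h1]; exact zero_mem _
          · rw [lowerSpace_eq_contentSpace] at h1
            exact hle _ h1
        | F i => exact hle _ (F_smul_mem hx i)
        | K μ => rw [hw.K_smul]; exact Submodule.smul_mem _ _ (hle _ hx)
        | J μ => rw [hw.J_smul]; exact Submodule.smul_mem _ _ (hle _ hx)
        | T μ => rw [hw.T_smul]; exact Submodule.smul_mem _ _ (hle _ hx)
        | Ups μ => rw [hw.Ups_smul]; exact Submodule.smul_mem _ _ (hle _ hx)
  rw [eq_top_iff]
  rintro m -
  obtain ⟨u, rfl⟩ := exists_smul_eta φ l m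
  exact key u _ (hle 0 (monomial_mem l []))

theorem iSupIndep_highWeight (l : X) :
    iSupIndep fun ν : I →₀ ℕ => weightSpace φ (HighV φ l) (l - D.wtN ν) :=
  (iSupIndep_weightSpace φ (HighV φ l)).comp
    (f := fun ν : I →₀ ℕ => l - D.wtN ν) fun _ _ h => wtN_injective D (sub_right_injective h)

/-- `HasWeight` mentions only $J$ and $K$. Through this equality a vector of weight $\lambda-\nu'$
also acquires its $T$- and $\Upsilon$-eigenvalues and its parity. -/
theorem contentSpace_eq_weightSpace (l : X) (ν : I →₀ ℕ) :
    contentSpace φ l ν = weightSpace φ (HighV φ l) (l - D.wtN ν) :=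
  eq_of_le_of_iSupIndep (iSupIndep_highWeight l)
    (fun _ _ hm => (isWeightVector_of_mem hm).hasWeight) (iSup_contentSpace l) ν

theorem mem_contentSpace_iff {l : X} {ν : I →₀ ℕ} {m : HighV φ l} :
    m ∈ contentSpace φ l ν ↔ HasWeight φ m (l - D.wtN ν) := by
  rw [contentSpace_eq_weightSpace]; rfl

theorem signV_smul (l : X) (u : EnhU φ) (m : HighV φ l) :
    signV φ l (u • m) = signU φ u • signV φ l m := by
  obtain ⟨w, rfl⟩ := exists_smul_eta φ l m
  rw [← mul_smul, signV_smul_eta, map_mul, mul_smul, signV_smul_eta]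

theorem hasParity_of_mem {l : X} {ν : I →₀ ℕ} {m : HighV φ l} (hm : m ∈ contentSpace φ l ν) :
    HasParity (signV φ l) (C.parity ν) m := by
  induction hm using Submodule.span_induction with
  | mem x hx =>
    obtain ⟨L, rfl, rfl⟩ := hx
    induction L with
    | nil =>
      have := signV_smul_eta φ l 1
      rw [one_smul, map_one, one_smul] at this
      simp [HasParity, monomialV, content, SuperCartanDatum.parity, this]
    | cons i L ih =>
      rw [HasParity] at *
      rw [monomialV, signV_smul, ih, signU_gen, signGen, smul_assoc, smul_smul_comm', smul_smul,
        content, parity_add, parity_single, pow_add, mul_comm]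
  | zero => simp [HasParity]
  | add x y _ _ hx hy => rw [HasParity] at *; rw [map_add, hx, hy, smul_add]
  | smul c x _ hx => exact hx.smul c

end Weights

/-! ## The phase -/

section Phase

variable {I Y X : Type*} [AddCommGroup Y] [AddCommGroup X] {C : SuperCartanDatum I}
  {D : RootDatum C Y X} (φ : Enhancer D)

theorem finsupp_nat_induction {P : (I →₀ ℕ) → Prop} (zero : P 0)
    (add : ∀ ν i, P ν → P (ν + Finsupp.single i 1)) (ν : I →₀ ℕ) : P ν := by
  have key : ∀ ν μ : I →₀ ℕ, P μ → P (μ + ν) := by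
    intro ν
    induction ν using Finsupp.induction_linear with
    | zero => intro μ h; rwa [add_zero]
    | add a b ha hb => intro μ h; rw [← add_assoc]; exact hb _ (ha _ h)
    | single i n =>
      induction n with
      | zero => intro μ h; rwa [Finsupp.single_zero, add_zero]
      | succ n ih =>
        intro μ h
        rw [Finsupp.single_add, ← add_assoc]
        exact add _ _ (ih _ h)
  have := key ν 0 zero
  rwa [zero_add] at this

/-- The inclusion `ℕ[I] → ℤ[I]`. -/
def natInt (ν : I →₀ ℕ) : I →₀ ℤ := ν.mapRange (Nat.cast : ℕ → ℤ) rfl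

theorem natInt_zero : natInt (0 : I →₀ ℕ) = 0 := Finsupp.mapRange_zero

theorem natInt_add_single (ν : I →₀ ℕ) (i : I) :
    natInt (ν + Finsupp.single i 1) = natInt ν + Finsupp.single i 1 := by
  rw [natInt, Finsupp.mapRange_add (by simp), Finsupp.mapRange_single]
  rfl

theorem phi_zero_right (ν : I →₀ ℤ) : φ.phi ν 0 ≡ 0 [ZMOD 4] := by
  have h := φ.add_right ν 0 0
  rw [show D.wt 0 = 0 from map_zero (Finsupp.linearCombination ℤ D.root), add_zero] at h
  simpa using (h.sub_right (φ.phi ν 0)).symm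

theorem phi_add_wtN (ν : I →₀ ℤ) (z : X) (μ : I →₀ ℕ) :
    φ.phi ν (z + D.wtN μ) ≡ φ.phi ν z + φ.phi ν (D.wtN μ) [ZMOD 4] := by
  rw [wtN_eq_wt, add_comm (φ.phi ν z)]
  exact φ.add_right ν z _

theorem phi_sub_wtN (ν : I →₀ ℤ) (z : X) (μ : I →₀ ℕ) :
    φ.phi ν (z - D.wtN μ) ≡ φ.phi ν z - φ.phi ν (D.wtN μ) [ZMOD 4] := by
  have := phi_add_wtN φ ν (z - D.wtN μ) μ
  rw [sub_add_cancel] at this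
  simpa using (this.sub_right (φ.phi ν (D.wtN μ))).symm

/-- The skew condition extended from pairs of simple indices to all $\nu$ by additivity. It is the
compatibility between the two recursions for the phase. -/
theorem phi_natInt_root (ν : I →₀ ℕ) (i : I) :
    φ.phi (natInt ν) (D.root i) ≡ φ.phi (Finsupp.single i 1) (D.wtN ν) +
      D.pairing (D.til 1 i) (D.wtN ν) + 2 * C.parity ν * C.p i [ZMOD 4] := by
  induction ν using finsupp_nat_induction with
  | zero =>
    rw [natInt_zero, wtN_zero, map_zero]
    have h1 := phi_zero φ (D.root i)
    have h2 := phi_zero_right φ (Finsupp.single i 1)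
    have h3 : C.parity 0 = 0 := by simp [SuperCartanDatum.parity]
    rw [h3]
    simpa using h1.trans h2.symm
  | add ν j ih =>
    have h1 := φ.add_left (natInt ν) (Finsupp.single j 1) (D.root i)
    have h2 := phi_add_root φ (Finsupp.single i 1) (D.wtN ν) j
    have h3 : D.pairing (D.til 1 i) (D.wtN (ν + Finsupp.single j 1)) =
        D.pairing (D.til 1 i) (D.wtN ν) + C.d i * C.a i j := by
      rw [wtN_add, wtN_single, map_add, pairing_til, one_mul]
    have h4 : 2 * (C.parity (ν + Finsupp.single j 1) : ℤ) * C.p i =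
        2 * C.parity ν * C.p i + 2 * (C.p j * C.p i) := by
      rw [parity_add, parity_single]; push_cast; ring
    -- For $i=j$ the extra terms are $2d_i+2p(i)\equiv0$.
    have h5 : φ.phi (Finsupp.single j 1) (D.root i) ≡ φ.phi (Finsupp.single i 1) (D.root j) +
        C.d i * C.a i j + 2 * (C.p j * C.p i) [ZMOD 4] := by
      rcases eq_or_ne i j with rfl | h
      · have := C.two_p_sub_two_d i
        rw [C.p_mul_self, C.d_mul_a_self]
        unfold Int.ModEq at *
        omega
      · have := φ.skew j i h.symm
        rw [C.form_symm, ← C.d_mul_a i j h, mul_assoc] at this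
        unfold Int.ModEq at *
        omega
    rw [natInt_add_single, h3, h4]
    rw [wtN_add, wtN_single]
    unfold Int.ModEq at *
    omega

variable (D) in
/-- The map `ν ↦ ∑ ν_i d_i i ∈ Y`. -/
def tilN : (I →₀ ℕ) →ₗ[ℕ] Y := Finsupp.linearCombination ℕ (D.til 1)

variable (D) in
theorem tilN_add_single (μ : I →₀ ℕ) (i : I) :
    tilN D (μ + Finsupp.single i 1) = tilN D μ + D.til 1 i := by
  rw [map_add]; simp [tilN]

variable (D) in
theorem pairing_tilN_root (μ : I →₀ ℕ) (i : I) :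
    D.pairing (tilN D μ) (D.root i) = D.pairing (D.til 1 i) (D.wtN μ) := by
  induction μ using finsupp_nat_induction with
  | zero => rw [map_zero, map_zero, wtN_zero, map_zero, LinearMap.zero_apply]
  | add μ j ih =>
    rw [tilN_add_single, map_add, LinearMap.add_apply, ih, wtN_add, wtN_single, map_add,
      pairing_til, pairing_til, C.d_mul_a_symm]

variable (D) in
/-- A function of `μ` with increments `2 d_i + d_i ⟨i, z + μ'⟩`. -/
def quadPhase (z : X) (μ : I →₀ ℕ) : ℤ :=
  D.pairing (tilN D μ) (D.wtN μ) / 2 + Finsupp.linearCombination ℕ C.d μ +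
    D.pairing (tilN D μ) z

/-- Half of the quadratic form grows by $d_i\langle i,\mu'\rangle+d_i$; the linear term in $d$
supplies the second $d_i$. -/
theorem quadPhase_add (z : X) (μ : I →₀ ℕ) (i : I) :
    quadPhase D z (μ + Finsupp.single i 1) =
      quadPhase D z μ + 2 * C.d i + D.pairing (D.til 1 i) (z + D.wtN μ) := by
  have h1 : D.pairing (tilN D (μ + Finsupp.single i 1)) (D.wtN (μ + Finsupp.single i 1)) =
      D.pairing (tilN D μ) (D.wtN μ) + (D.pairing (D.til 1 i) (D.wtN μ) + C.d i) * 2 := by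
    rw [tilN_add_single, wtN_add, wtN_single]
    simp only [map_add, LinearMap.add_apply]
    rw [pairing_tilN_root, pairing_til, C.d_mul_a_self]
    ring
  -- The increment is a multiple of $2$, so it passes through integer division without any appeal to
  -- the parity of the form itself.
  rw [quadPhase, h1, Int.add_mul_ediv_right _ _ two_ne_zero, quadPhase, tilN_add_single]
  simp only [map_add, LinearMap.add_apply, Finsupp.linearCombination_single, one_smul]
  ring

/-- The phase as a function on `ℕ[I] × ℕ[I]`. -/
def phaseN (l l' : X) (ν μ : I →₀ ℕ) : ℤ :=
  -φ.phi (natInt ν) (D.wtN μ - l') + φ.phi (natInt μ) l + quadPhase D (l - l') μ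

/-- The formula `phaseN` solves the rule in $\nu$ by additivity of $\phi$. Its change in $\mu$
contains $-\phi(\nu,i')$ where the rule asks for $-\phi(i,\nu')$, and `phi_natInt_root` accounts for
the difference. -/
theorem exists_phase (l l' : X) : ∃ κ, IsPhase φ l l' κ := by
  have h1 : Function.Injective fun ν : I →₀ ℕ => l - D.wtN ν :=
    fun _ _ h => wtN_injective D (sub_right_injective h)
  have h2 : Function.Injective fun μ : I →₀ ℕ => D.wtN μ - l' :=
    fun _ _ h => wtN_injective D (sub_left_injective h)
  -- $X$-regularity makes $\nu$ and $\mu$ recoverable from the weights; other pairs of weights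
  -- receive irrelevant values.
  let κ : X → X → ℤ := fun z z' =>
    phaseN φ l l' (Function.invFun (fun ν : I →₀ ℕ => l - D.wtN ν) z)
      (Function.invFun (fun μ : I →₀ ℕ => D.wtN μ - l') z')
  have hκ : ∀ ν μ : I →₀ ℕ, κ (l - D.wtN ν) (D.wtN μ - l') = phaseN φ l l' ν μ := fun ν μ =>
    congrArg₂ (phaseN φ l l') (Function.leftInverse_invFun h1 ν) (Function.leftInverse_invFun h2 μ)
  refine ⟨κ, ?_, ?_, ?_⟩
  · intro ν μ i
    rw [sub_sub, ← wtN_single D i, ← wtN_add, hκ, hκ, phaseN, phaseN, natInt_add_single]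
    have := φ.add_left (natInt ν) (Finsupp.single i 1) (D.wtN μ - l')
    unfold Int.ModEq at *
    omega
  · intro ν μ i
    have e1 : D.wtN μ - l' + D.root i = D.wtN (μ + Finsupp.single i 1) - l' := by
      rw [wtN_add, wtN_single]; abel
    have e2 := phi_add_root φ (natInt ν) (D.wtN μ - l') i
    have e3 := φ.add_left (natInt μ) (Finsupp.single i 1) l
    have e4 := phi_sub_wtN φ (Finsupp.single i 1) l ν
    have e5 := phi_natInt_root φ ν i
    have e6 := quadPhase_add (D := D) (l - l') μ i
    have e7 : D.pairing (D.til 1 i) (l - D.wtN ν + (D.wtN μ - l')) =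
        D.pairing (D.til 1 i) (l - l' + D.wtN μ) - D.pairing (D.til 1 i) (D.wtN ν) := by
      rw [← map_sub]; congr 1; abel
    -- The terms $2p(\nu)p(i)$ appear with opposite signs on the two sides.
    have e8 : (4 : ℤ) ∣ 4 * (C.parity ν * C.p i) := dvd_mul_right _ _
    rw [e1, hκ, hκ, phaseN, phaseN, natInt_add_single, e6, e7, ← e1]
    rw [mul_assoc] at e5 ⊢
    unfold Int.ModEq at *
    omega
  · have := hκ 0 0
    rw [wtN_zero, sub_zero, zero_sub] at this
    rw [this, phaseN, natInt_zero]
    have e1 := phi_zero φ (D.wtN 0 - l')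
    have e2 := phi_zero φ l
    have e3 : quadPhase D (l - l') 0 = 0 := by
      simp [quadPhase]
    rw [e3]
    unfold Int.ModEq at *
    omega

end Phase

/-! ## Weights of `^ωV(λ)[t]` -/

section LowWeights

variable {I Y X : Type*} [AddCommGroup Y] [AddCommGroup X] {C : SuperCartanDatum I}
  {D : RootDatum C Y X} {φ : Enhancer D}

theorem low_gen_smul (l : X) (g : Gen I Y) (hg : ∀ ν, g ≠ Gen.Ups ν) (m : HighV φ l) :
    gen φ g • toLow φ l m = toLow φ l (omegaGen φ g • m) := by
  rw [low_smul, rescale_fix φ l g hg, omega_gen]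

theorem low_K_smul (l : X) (μ : Y) (m : HighV φ l) :
    uK φ μ • toLow φ l m = toLow φ l (uK φ (-μ) • m) := low_gen_smul l (Gen.K μ) (by simp) m

theorem low_J_smul (l : X) (μ : Y) (m : HighV φ l) :
    uJ φ μ • toLow φ l m = toLow φ l (uJ φ μ • m) := low_gen_smul l (Gen.J μ) (by simp) m

theorem low_T_smul (l : X) (μ : Y) (m : HighV φ l) :
    uT φ μ • toLow φ l m = toLow φ l (uT φ (-μ) • m) := low_gen_smul l (Gen.T μ) (by simp) m

theorem low_F_smul (l : X) (i : I) (m : HighV φ l) :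
    uF φ i • toLow φ l m = toLow φ l (cElt φ i • uE φ i • m) := by
  rw [← mul_smul, ← omegaGen_F]
  exact low_gen_smul l (Gen.F i) (by simp) m

theorem low_Ups_smul (l : X) (ν : I →₀ ℤ) (m : HighV φ l) : uUps φ ν • toLow φ l m =
    tPow (shiftExp φ l ν) • toLow φ l (uUps φ (-ν) • m) := by
  rw [low_smul, rescale_gen, rescaleGen, map_smul (omega φ), omega_gen, omegaGen, smul_assoc,
    map_smul (toLow φ l)]

theorem piPow_neg (n : ℤ) : piPow (-n) = piPow n := piPow_congr (by omega)

theorem low_hasWeight_iff (l : X) (m : HighV φ l) (z : X) :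
    HasWeight φ (toLow φ l m) z ↔ HasWeight φ m (-z) := by
  constructor
  · intro h
    refine hasWeight_of_smul (fun μ => ?_) fun μ => ?_
    · have := h.K_smul (-μ)
      rw [low_K_smul, neg_neg, ← map_smul (toLow φ l)] at this
      rw [(toLow φ l).injective this]
      simp
    · have := h.J_smul μ
      rw [low_J_smul, ← map_smul (toLow φ l)] at this
      rw [(toLow φ l).injective this, map_neg, piPow_neg]
  · intro h
    refine hasWeight_of_smul (fun μ => ?_) fun μ => ?_
    · rw [low_K_smul, h.K_smul, map_smul (toLow φ l)]
      simp
    · rw [low_J_smul, h.J_smul, map_smul (toLow φ l), map_neg, piPow_neg]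

theorem exists_toLow_of_hasWeight {l : X} {μ : I →₀ ℕ} {w : LowV φ l}
    (h : HasWeight φ w (D.wtN μ - l)) : ∃ m ∈ contentSpace φ l μ, toLow φ l m = w := by
  obtain ⟨m, rfl⟩ := (toLow φ l).surjective w
  rw [low_hasWeight_iff, neg_sub] at h
  exact ⟨m, mem_contentSpace_iff.mpr h, rfl⟩

/-- Without the rescaling, $\Upsilon_\nu$ would act by $\mathbf t^{-\phi(\nu,\lambda-\mu')}$; the
constant $\phi(\nu,\lambda)+\phi(\nu,-\lambda)$ turns the exponent into $\phi(\nu,\mu'-\lambda)$. -/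
theorem low_isWeightVector {l : X} {μ : I →₀ ℕ} {w : LowV φ l}
    (h : HasWeight φ w (D.wtN μ - l)) : IsWeightVector φ w (D.wtN μ - l) := by
  obtain ⟨m, hm, rfl⟩ := exists_toLow_of_hasWeight h
  have hw := isWeightVector_of_mem hm
  refine ⟨h.K_smul, h.J_smul, fun ν => ?_, fun ν => ?_⟩
  · rw [low_T_smul, hw.T_smul, map_smul (toLow φ l), ← neg_sub l]
    simp only [map_neg, LinearMap.neg_apply]
  · rw [low_Ups_smul, hw.Ups_smul, map_smul (toLow φ l), smul_smul, ← tPow_add]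
    congr 1
    apply tPow_congr
    have e1 := phi_neg φ ν (l - D.wtN μ)
    have e2 := phi_sub_wtN φ ν l μ
    have e3 := phi_add_wtN φ ν (-l) μ
    rw [neg_add_eq_sub] at e3
    rw [shiftExp]
    unfold Int.ModEq at *
    omega

theorem high_isWeightVector {l : X} {ν : I →₀ ℕ} {w : HighV φ l}
    (h : HasWeight φ w (l - D.wtN ν)) : IsWeightVector φ w (l - D.wtN ν) :=
  isWeightVector_of_mem (mem_contentSpace_iff.mpr h)

theorem low_F_smul_eq_zero {l : X} {μ : I →₀ ℕ} {w : LowV φ l}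
    (h : HasWeight φ w (D.wtN μ - l)) {i : I} (hi : μ i = 0) : uF φ i • w = 0 := by
  obtain ⟨m, hm, rfl⟩ := exists_toLow_of_hasWeight h
  have h1 := E_smul_mem_lowerSpace hm i
  rw [lowerSpace_eq_bot l i hi, Submodule.mem_bot] at h1
  rw [low_F_smul, h1, smul_zero, map_zero]

theorem high_E_smul_eq_zero {l : X} {ν : I →₀ ℕ} {w : HighV φ l}
    (h : HasWeight φ w (l - D.wtN ν)) {i : I} (hi : ν i = 0) : uE φ i • w = 0 := by
  have h1 := E_smul_mem_lowerSpace (mem_contentSpace_iff.mpr h) i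
  rwa [lowerSpace_eq_bot l i hi, Submodule.mem_bot] at h1

theorem iSup_highWeight (l : X) : ⨆ ν, weightSpace φ (HighV φ l) (l - D.wtN ν) = ⊤ := by
  simp only [← contentSpace_eq_weightSpace, iSup_contentSpace]

theorem iSup_lowWeight (l : X) : ⨆ μ, weightSpace φ (LowV φ l) (D.wtN μ - l) = ⊤ := by
  rw [eq_top_iff]
  rintro w -
  obtain ⟨m, rfl⟩ := (toLow φ l).surjective w
  have hm : m ∈ ⨆ ν, weightSpace φ (HighV φ l) (l - D.wtN ν) := by
    rw [iSup_highWeight]; trivial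
  induction hm using Submodule.iSup_induction' with
  | zero => rw [map_zero]; exact zero_mem _
  | add x y _ _ hx hy => rw [map_add]; exact add_mem hx hy
  | mem ν x hx =>
    refine Submodule.mem_iSup_of_mem ν ?_
    rw [mem_weightSpace, low_hasWeight_iff, neg_sub]
    exact hx

theorem iSupIndep_lowWeight (l : X) :
    iSupIndep fun μ : I →₀ ℕ => weightSpace φ (LowV φ l) (D.wtN μ - l) :=
  (iSupIndep_weightSpace φ (LowV φ l)).comp
    (f := fun μ : I →₀ ℕ => D.wtN μ - l) fun _ _ h => wtN_injective D (sub_left_injective h)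

end LowWeights

/-! ## The tensor product twistor -/

section TensorTwistor

variable {I Y X : Type*} [AddCommGroup Y] [AddCommGroup X] {C : SuperCartanDatum I}
  {D : RootDatum C Y X} {φ : Enhancer D}

theorem tensN_induction {l l' : X} {P : TensN φ l l' → Prop}
    (weight : ∀ (ν μ : I →₀ ℕ) (w : HighV φ l) (w' : LowV φ l'), HasWeight φ w (l - D.wtN ν) →
      HasWeight φ w' (D.wtN μ - l') → P (w ⊗ₜ w'))
    (add : ∀ m n, P m → P n → P (m + n)) (n : TensN φ l l') : P n := by
  have zero : P 0 := by
    have := weight 0 0 0 0 (weightSpace φ _ _).zero_mem (weightSpace φ _ _).zero_mem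
    rwa [zero_tmul] at this
  induction n using TensorProduct.induction_on with
  | zero => exact zero
  | add m n hm hn => exact add m n hm hn
  | tmul w w' =>
    have hw : w ∈ ⨆ ν, weightSpace φ (HighV φ l) (l - D.wtN ν) := by
      rw [iSup_highWeight]; trivial
    have hw' : w' ∈ ⨆ μ, weightSpace φ (LowV φ l') (D.wtN μ - l') := by
      rw [iSup_lowWeight]; trivial
    induction hw using Submodule.iSup_induction' with
    | zero => rwa [zero_tmul]
    | add x y _ _ hx hy => rw [add_tmul]; exact add _ _ hx hy
    | mem ν x hx =>
      induction hw' using Submodule.iSup_induction' with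
      | zero => rwa [tmul_zero]
      | add x y _ _ hx hy => rw [tmul_add]; exact add _ _ hx hy
      | mem μ y hy => exact weight ν μ x y hx hy

open Classical in
/-- The diagonal operator on `N(λ,λ')[t]` with prescribed eigenvalues on the tensor products of
weight spaces. -/
theorem exists_diagonal (l l' : X) (k : (I →₀ ℕ) → (I →₀ ℕ) → Coeff) :
    ∃ f : TensN φ l l' →ₗ[Coeff] TensN φ l l', ∀ (ν μ : I →₀ ℕ) (w : HighV φ l) (w' : LowV φ l'),
      HasWeight φ w (l - D.wtN ν) → HasWeight φ w' (D.wtN μ - l') →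
      f (w ⊗ₜ w') = k ν μ • (w ⊗ₜ[Coeff] w') := by
  let W := fun ν : I →₀ ℕ => weightSpace φ (HighV φ l) (l - D.wtN ν)
  let W' := fun μ : I →₀ ℕ => weightSpace φ (LowV φ l') (D.wtN μ - l')
  have hW : DirectSum.IsInternal W :=
    DirectSum.isInternal_submodule_of_iSupIndep_of_iSup_eq_top (iSupIndep_highWeight l)
      (iSup_highWeight l)
  have hW' : DirectSum.IsInternal W' :=
    DirectSum.isInternal_submodule_of_iSupIndep_of_iSup_eq_top (iSupIndep_lowWeight l')
      (iSup_lowWeight l')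
  let e := LinearEquiv.ofBijective (DirectSum.coeLinearMap W) hW
  let e' := LinearEquiv.ofBijective (DirectSum.coeLinearMap W') hW'
  let g := DirectSum.toModule Coeff ((I →₀ ℕ) × (I →₀ ℕ)) (TensN φ l l')
    fun p => k p.1 p.2 • TensorProduct.map (W p.1).subtype (W' p.2).subtype
  refine ⟨g ∘ₗ (TensorProduct.directSum Coeff Coeff (fun ν => W ν) (fun μ => W' μ)).toLinearMap ∘ₗ
    (TensorProduct.congr e.symm e'.symm).toLinearMap, fun ν μ w w' hw hw' => ?_⟩
  have h1 : e.symm w = DirectSum.lof Coeff _ (fun ν => W ν) ν ⟨w, hw⟩ := by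
    rw [LinearEquiv.symm_apply_eq]
    exact (DirectSum.coeLinearMap_lof W ν ⟨w, hw⟩).symm
  have h2 : e'.symm w' = DirectSum.lof Coeff _ (fun μ => W' μ) μ ⟨w', hw'⟩ := by
    rw [LinearEquiv.symm_apply_eq]
    exact (DirectSum.coeLinearMap_lof W' μ ⟨w', hw'⟩).symm
  simp only [LinearMap.comp_apply, LinearEquiv.coe_coe, TensorProduct.congr_tmul, h1, h2]
  rw [TensorProduct.directSum_lof_tmul_lof, DirectSum.toModule_lof]
  rfl

/-- `f` is semilinear over the automorphism `sigma`. -/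
def IsSigmaLinear {M : Type*} [AddCommGroup M] [Module Coeff M] (f : M → M) : Prop :=
  ∀ (c : Coeff) (m : M), f (c • m) = sigma c • f m

/-- Compose the semilinear tensor product of $f_1,f_2$ with the diagonal operator of the phases.
Powers of $\mathbf t$ are fixed by `sigma`, so they come out unchanged. -/
theorem exists_tensorTwistor {l l' : X} (κ : X → X → ℤ) (f₁ : HighV φ l →ₗ[GaussQ] HighV φ l)
    (f₂ : LowV φ l' →ₗ[GaussQ] LowV φ l') (h₁ : IsSigmaLinear f₁) (h₂ : IsSigmaLinear f₂) :
    ∃ f, IsTensorTwistor φ l l' κ f₁ f₂ f ∧ IsSigmaLinear f := by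
  obtain ⟨d, hd⟩ := exists_diagonal (φ := φ) l l' fun ν μ => tPow (κ (l - D.wtN ν) (D.wtN μ - l'))
  let g₁ : HighV φ l →ₛₗ[sigma] HighV φ l := { f₁ with map_smul' := h₁ }
  let g₂ : LowV φ l' →ₛₗ[sigma] LowV φ l' := { f₂ with map_smul' := h₂ }
  let g : TensN φ l l' →ₛₗ[sigma] TensN φ l l' := (TensorProduct.map g₁ g₂).comp d
  have hg : ∀ (c : Coeff) n, g (c • n) = sigma c • g n := fun c n => g.map_smulₛₗ c n
  refine ⟨{ g with map_smul' := fun c n => ?_ }, fun ν μ w w' hw hw' => ?_, hg⟩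
  · change g (c • n) = c • g n
    rw [← algebraMap_smul Coeff c n, hg, sigma_algebraMap, algebraMap_smul]
  · change TensorProduct.map g₁ g₂ (d (w ⊗ₜ w')) = _
    rw [hd ν μ w w' hw hw', map_smulₛₗ, sigma_tPow, TensorProduct.map_tmul]
    rfl

theorem IsTensorTwistor.unique {l l' : X} {κ : X → X → ℤ} {f₁ : HighV φ l →ₗ[GaussQ] HighV φ l}
    {f₂ : LowV φ l' →ₗ[GaussQ] LowV φ l'} {f g : TensN φ l l' →ₗ[GaussQ] TensN φ l l'}
    (hf : IsTensorTwistor φ l l' κ f₁ f₂ f) (hg : IsTensorTwistor φ l l' κ f₁ f₂ g) : f = g := by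
  refine LinearMap.ext fun n => ?_
  induction n using tensN_induction with
  | weight ν μ w w' hw hw' => rw [hf ν μ w w' hw hw', hg ν μ w w' hw hw']
  | add m n hm hn => rw [map_add, map_add, hm, hn]

/-! ### The action of `Û ⊗ Û` -/

theorem covAct_tmul {l l' : X} {a b : ℕ} (x : EnhU φ) {y : EnhU φ} {w : HighV φ l}
    (w' : LowV φ l') (hy : HasParityU φ a y) (hw : HasParity (signV φ l) b w) :
    covAct φ l l' (x ⊗ₜ y) (w ⊗ₜ w') = piPow (a * b) • ((x • w) ⊗ₜ (y • w')) := by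
  have h := twisted_apply hy hw
    (LinearMap.mk₂ Coeff (fun y w => plainAct φ l l' (x ⊗ₜ[Coeff] y) (w ⊗ₜ[Coeff] w'))
      (fun y y' z => by rw [tmul_add, map_add, LinearMap.add_apply])
      (fun c y z => by rw [tmul_smul, map_smul, LinearMap.smul_apply])
      (fun y z z' => by rw [add_tmul, map_add])
      (fun c y z => by rw [← smul_tmul', map_smul]))
  simp only [LinearMap.mk₂_apply, plainAct_tmul] at h
  rw [← h]
  simp only [covAct, LinearMap.lTensor_tmul, LinearMap.rTensor_tmul, plainAct_tmul]

theorem covAct_add_left {l l' : X} (a b : EnhU φ ⊗[Coeff] EnhU φ) (n : TensN φ l l') :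
    covAct φ l l' (a + b) n = covAct φ l l' a n + covAct φ l l' b n := by
  simp only [covAct, map_add, LinearMap.add_apply]; abel

theorem covAct_add_right {l l' : X} (a : EnhU φ ⊗[Coeff] EnhU φ) (m n : TensN φ l l') :
    covAct φ l l' a (m + n) = covAct φ l l' a m + covAct φ l l' a n := by
  simp only [covAct, map_add]; abel

theorem covAct_smul_left {l l' : X} (c : Coeff) (a : EnhU φ ⊗[Coeff] EnhU φ) (n : TensN φ l l') :
    covAct φ l l' (c • a) n = c • covAct φ l l' a n := by
  simp only [covAct, map_smul, LinearMap.smul_apply, smul_add]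

theorem covAct_smul_right {l l' : X} (c : Coeff) (a : EnhU φ ⊗[Coeff] EnhU φ) (n : TensN φ l l') :
    covAct φ l l' a (c • n) = c • covAct φ l l' a n := by
  simp only [covAct, map_smul, smul_add]

theorem covAct_zero_left {l l' : X} (n : TensN φ l l') : covAct φ l l' 0 n = 0 := by
  simp [covAct]

theorem covAct_zero_right {l l' : X} (a : EnhU φ ⊗[Coeff] EnhU φ) :
    covAct φ l l' a 0 = 0 := by
  simp [covAct]

theorem HasParity.smulV {l : X} {a b : ℕ} {x : EnhU φ} {w : HighV φ l} (hx : HasParityU φ a x)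
    (hw : HasParity (signV φ l) b w) : HasParity (signV φ l) (a + b) (x • w) := by
  simp only [HasParity, AlgHom.toLinearMap_apply] at *
  rw [signV_smul, hx, hw, smul_assoc, smul_smul_comm', smul_smul, pow_add]

/-- The same exponent count as for associativity of `covMul`, with a weight vector as the last
factor. It reduces the intertwining property to generators. -/
theorem covAct_covMul {l l' : X} (a b : EnhU φ ⊗[Coeff] EnhU φ) (n : TensN φ l l') :
    covAct φ l l' (covMul φ a b) n = covAct φ l l' a (covAct φ l l' b n) := by
  have hs := signU_signU φ
  refine tensor_parity_induction (P := fun a => covAct φ l l' (covMul φ a b) n =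
    covAct φ l l' a (covAct φ l l' b n)) hs hs ?_ (fun a₁ a₂ x y hx hy => ?_) ?_ a
  · simp only [covMul_zero_left, covAct_zero_left]
  · refine tensor_parity_induction (P := fun b => covAct φ l l' (covMul φ (x ⊗ₜ y) b) n =
      covAct φ l l' (x ⊗ₜ y) (covAct φ l l' b n)) hs hs ?_ (fun b₁ b₂ z u hz hu => ?_) ?_ b
    · simp only [covMul_zero_right, covAct_zero_left, covAct_zero_right]
    · induction n using tensN_induction with
      | weight ν μ w w' hw hw' =>
        have hp := hasParity_of_mem (mem_contentSpace_iff.mpr hw)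
        rw [covMul_tmul _ _ hy hz, covAct_tmul _ _ hu hp, covAct_smul_left, covAct_smul_right,
          covAct_tmul _ _ (HasParityU.mul hy hu) hp, covAct_tmul _ _ hy (HasParity.smulV hz hp),
          smul_smul, smul_smul, ← piPow_add, ← piPow_add, mul_smul, mul_smul]
        congr 2
        push_cast
        ring
      | add m n hm hn => rw [covAct_add_right, hm, hn, covAct_add_right, covAct_add_right]
    · intro m n hm hn
      simp only [covMul_add_right, covAct_add_left, covAct_add_right, hm, hn]
  · intro m n hm hn; simp only [covMul_add_left, covAct_add_left, hm, hn]

theorem covAct_one {l l' : X} (n : TensN φ l l') : covAct φ l l' (1 ⊗ₜ 1) n = n := by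
  induction n using tensN_induction with
  | weight ν μ w w' hw hw' =>
    rw [covAct_tmul _ _ (hasParityU_one φ) (hasParity_of_mem (mem_contentSpace_iff.mpr hw))]
    simp [piPow_zero]
  | add m n hm hn => rw [covAct_add_right, hm, hn]

/-- The action of `Û` on `N(λ,λ')[t]` through the coproduct. -/
def coAct (φ : Enhancer D) (l l' : X) (u : EnhU φ) (n : TensN φ l l') : TensN φ l l' :=
  covAct φ l l' (coprod φ u) n

theorem coAct_mul {l l' : X} (u v : EnhU φ) (n : TensN φ l l') :
    coAct φ l l' (u * v) n = coAct φ l l' u (coAct φ l l' v n) := by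
  rw [coAct, map_mul]
  exact covAct_covMul _ _ _

theorem coAct_add_left {l l' : X} (u v : EnhU φ) (n : TensN φ l l') :
    coAct φ l l' (u + v) n = coAct φ l l' u n + coAct φ l l' v n := by
  rw [coAct, map_add]
  exact covAct_add_left _ _ _

theorem coAct_smul_left {l l' : X} (c : Coeff) (u : EnhU φ) (n : TensN φ l l') :
    coAct φ l l' (c • u) n = c • coAct φ l l' u n := by
  rw [coAct, map_smul]
  exact covAct_smul_left _ _ _

theorem coAct_add_right {l l' : X} (u : EnhU φ) (m n : TensN φ l l') :
    coAct φ l l' u (m + n) = coAct φ l l' u m + coAct φ l l' u n := covAct_add_right _ _ _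

theorem coAct_smul_right {l l' : X} (c : Coeff) (u : EnhU φ) (n : TensN φ l l') :
    coAct φ l l' u (c • n) = c • coAct φ l l' u n := covAct_smul_right _ _ _

theorem coAct_scalar {l l' : X} (c : Coeff) (n : TensN φ l l') :
    coAct φ l l' (algebraMap Coeff _ c) n = c • n := by
  rw [Algebra.algebraMap_eq_smul_one, coAct_smul_left, coAct, map_one]
  congr 1
  exact covAct_one n

theorem coAct_grouplike {l l' : X} {g : EnhU φ} (hg : coprod φ g = ctmul φ g g)
    (hp : HasParityU φ 0 g) {ν : I →₀ ℕ} {w : HighV φ l} {w' : LowV φ l'}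
    (hw : HasWeight φ w (l - D.wtN ν)) {c c' : Coeff} (hc : g • w = c • w)
    (hc' : g • w' = c' • w') :
    coAct φ l l' g (w ⊗ₜ w') = (c * c') • (w ⊗ₜ[Coeff] w') := by
  rw [coAct, hg]
  refine (covAct_tmul _ _ hp (hasParity_of_mem (mem_contentSpace_iff.mpr hw))).trans ?_
  rw [hc, hc', tmul_smul, ← smul_tmul', smul_smul, smul_smul, Nat.cast_zero, zero_mul, piPow_zero,
    one_mul, mul_comm]

theorem coAct_E {l l' : X} (i : I) {ν : I →₀ ℕ} {w : HighV φ l} {w' : LowV φ l'}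
    (hw : HasWeight φ w (l - D.wtN ν)) :
    coAct φ l l' (uE φ i) (w ⊗ₜ w') = (uE φ i • w) ⊗ₜ[Coeff] (uKt φ (-1) i • w') +
      piPow (C.p i * C.parity ν) • (w ⊗ₜ[Coeff] (uE φ i • w')) := by
  have hp := hasParity_of_mem (mem_contentSpace_iff.mpr hw)
  rw [coAct, coprod_gen]
  refine (covAct_add_left _ _ _).trans ?_
  congr 1
  · refine (covAct_tmul _ _ (hasParity_K φ _) hp).trans ?_
    rw [Nat.cast_zero, zero_mul, piPow_zero, one_smul]
  · refine (covAct_tmul _ _ (hasParity_E φ i) hp).trans ?_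
    rw [one_smul]

theorem coAct_F {l l' : X} (i : I) {ν : I →₀ ℕ} {w : HighV φ l} {w' : LowV φ l'}
    (hw : HasWeight φ w (l - D.wtN ν)) :
    coAct φ l l' (uF φ i) (w ⊗ₜ w') = (uF φ i • w) ⊗ₜ[Coeff] w' +
      piPow (C.p i * C.parity ν) •
        (((uJt φ 1 i * uKt φ 1 i) • w) ⊗ₜ[Coeff] (uF φ i • w')) := by
  have hp := hasParity_of_mem (mem_contentSpace_iff.mpr hw)
  rw [coAct, coprod_gen]
  refine (covAct_add_left _ _ _).trans ?_
  congr 1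
  · refine (covAct_tmul _ _ (hasParityU_one φ) hp).trans ?_
    rw [Nat.cast_zero, zero_mul, piPow_zero, one_smul, one_smul]
  · exact covAct_tmul _ _ (hasParity_F φ i) hp

end TensorTwistor

/-! ## Compatibility of the twistors -/

section Compatibility

variable {I Y X : Type*} [AddCommGroup Y] [AddCommGroup X] {C : SuperCartanDatum I}
  {D : RootDatum C Y X} {φ : Enhancer D}

/-- A map which is semilinear over `sigma` and has the values of the twistor on the torus. -/
structure TorusLike (ψ : EnhU φ → EnhU φ) : Prop where
  map_scalar : ∀ c, ψ (algebraMap Coeff _ c) = algebraMap Coeff _ (sigma c)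
  map_K : ∀ μ, ψ (uK φ μ) = uT φ (-μ) * uK φ μ
  map_J : ∀ μ, ψ (uJ φ μ) = uT φ (2 • μ) * uJ φ μ
  map_T : ∀ μ, ψ (uT φ μ) = uT φ μ
  map_Ups : ∀ ν, ψ (uUps φ ν) = uUps φ ν

theorem torusLike_twistor : TorusLike (twistor φ) where
  map_scalar := twistorRing_algebraMap φ
  map_K _ := twistorRing_gen φ _
  map_J _ := twistorRing_gen φ _
  map_T _ := twistorRing_gen φ _
  map_Ups _ := twistorRing_gen φ _

theorem twistorPrime_eq {u x : EnhU φ} (h : twistorRing φ (omega φ u) = omega φ x) :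
    twistorPrime φ (twistor φ) u = x := by
  rw [twistorPrime_apply, h, AlgEquiv.symm_apply_apply]

theorem T_neg_two_nsmul (μ : Y) : uT φ (-(2 • μ)) = uT φ (2 • μ) := by
  have h : uT φ (2 • μ + 2 • μ) = 1 := by
    rw [← T_four_smul φ μ]; congr 2; rw [← add_nsmul]
  rw [← mul_one (uT φ (-(2 • μ))), ← h, T_add, neg_add_cancel_left]

theorem torusLike_twistorPrime : TorusLike (twistorPrime φ (twistor φ)) where
  map_scalar c := twistorPrime_eq (by
    rw [AlgEquiv.commutes, AlgEquiv.commutes, twistorRing_algebraMap])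
  map_K μ := twistorPrime_eq (by
    rw [map_mul, omega_gen, omega_gen, omegaGen, omegaGen, twistorRing_gen, twistorGen])
  map_J μ := twistorPrime_eq (by
    rw [map_mul, omega_gen, omega_gen, omegaGen, omegaGen, twistorRing_gen, twistorGen,
      T_neg_two_nsmul])
  map_T μ := twistorPrime_eq (by rw [omega_gen, omegaGen, twistorRing_gen, twistorGen])
  map_Ups ν := twistorPrime_eq (by rw [omega_gen, omegaGen, twistorRing_gen, twistorGen])

theorem twistorPrime_E (i : I) :
    twistorPrime φ (twistor φ) (uE φ i) = uE φ i * uUpsi φ 1 i := twistorPrime_eq (by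
  rw [map_mul, omega_gen, omega_gen, omegaGen, omegaGen, twistorRing_gen, twistorGen,
    ← Finsupp.single_neg])

theorem twistorRing_cElt (i : I) : twistorRing φ (cElt φ i) =
    tPow (2 * C.d i) • (uT φ (2 • D.til 1 i) * cElt φ i) := by
  rw [cElt, twistorRing_smul, twistorRing_gen, twistorGen, sigma_piPow, mul_smul_comm, smul_smul]

/-- The scalar $\mathbf t_i^2$ in $\mathfrak X(E_i)$ cancels the one produced by `sigma` on the
$\pi_i$ in $\omega(F_i)$, leaving only torus elements. -/
theorem twistorPrime_F (i : I) : twistorPrime φ (twistor φ) (uF φ i) =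
    uT φ (2 • D.til 1 i) * (uF φ i * (uT φ (-D.til 1 i) * uUpsi φ (-1) i)) := twistorPrime_eq (by
  rw [← T_neg_two_nsmul]
  simp only [map_mul, omega_gen]
  rw [omegaGen_F, map_mul, twistorRing_cElt, twistorRing_gen, twistorGen, twE, smul_mul_smul_comm,
    ← tPow_add, tPow_congr (b := 0), tPow_zero, one_smul]
  · simp only [omegaGen, neg_neg, cElt, mul_assoc, Finsupp.single_neg]
  · exact Int.modEq_zero_iff_dvd.mpr ⟨C.d i, by ring⟩)

theorem IsWeightVector.Upsi_neg_smul {M : Type*} [AddCommGroup M] [Module Coeff M]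
    [Module (EnhU φ) M] {m : M} {z : X} (hm : IsWeightVector φ m z) (i : I) :
    uUpsi φ (-1) i • m = tPow (-φ.phi (Finsupp.single i 1) z) • m := by
  rw [hm.Ups_smul, tPow_congr (phi_single_neg φ i z)]

section Generic

variable {M : Type*} [AddCommGroup M] [Module Coeff M] [Module (EnhU φ) M]
  [IsScalarTower Coeff (EnhU φ) M] {ψ : EnhU φ → EnhU φ} {f : M → M}

theorem TorusLike.isSigmaLinear (hψ : TorusLike ψ) (hf : ∀ u m, f (u • m) = ψ u • f m) :
    IsSigmaLinear f := by
  intro c m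
  rw [← algebraMap_smul (EnhU φ) c m, hf, hψ.map_scalar, algebraMap_smul]

/-- The $\mathbf t$-power produced by `sigma` on the eigenvalue of $K_\mu$ or $J_\mu$ is undone by
the $T$ in the image of that generator, so weights are preserved. -/
theorem TorusLike.isWeightVector (hψ : TorusLike ψ) (hf : ∀ u m, f (u • m) = ψ u • f m)
    {m : M} {z : X} (hm : IsWeightVector φ m z) : IsWeightVector φ (f m) z := by
  have hs := hψ.isSigmaLinear hf
  have hT : ∀ μ, uT φ μ • f m = tPow (D.pairing μ z) • f m := fun μ => by
    rw [← hψ.map_T, ← hf, hm.T_smul, hs, sigma_tPow]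
  refine ⟨fun μ => ?_, fun μ => ?_, hT, fun ν => ?_⟩
  · have h := hf (uK φ μ) m
    rw [hm.K_smul, hs, hψ.map_K, mul_smul] at h
    have h' := congrArg (uT φ μ • ·) h
    simp only [← mul_smul (uT φ μ), T_add, add_neg_cancel, T_zero, one_smul] at h'
    rw [← h', smul_smul_comm', hT, smul_smul, sigma_vPow, mul_right_comm, ← tPow_add,
      neg_add_cancel, tPow_zero, one_mul]
  · have h := hf (uJ φ μ) m
    rw [hm.J_smul, hs, hψ.map_J, mul_smul] at h
    have h' := congrArg (uT φ (-(2 • μ)) • ·) h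
    simp only [← mul_smul (uT φ (-(2 • μ))), T_add, neg_add_cancel, T_zero, one_smul] at h'
    rw [← h', smul_smul_comm', hT, smul_smul, sigma_piPow, mul_right_comm, ← tPow_add,
      tPow_congr (b := 0), tPow_zero, one_mul]
    simp
  · rw [← hψ.map_Ups, ← hf, hm.Ups_smul, hs, sigma_tPow]

theorem IsWeightVector.twE_smul {m : M} {z : X} (hm : IsWeightVector φ m z) (i : I) :
    twE φ i • m =
      tPow (D.pairing (D.til 1 i) z + φ.phi (Finsupp.single i 1) z) • m := by
  rw [twE, mul_smul, hm.Ups_smul, smul_smul_comm', hm.T_smul, smul_smul, ← tPow_add, add_comm]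

end Generic

section HighLow

variable {l l' : X} {f₁ : HighV φ l →ₗ[GaussQ] HighV φ l} {f₂ : LowV φ l' →ₗ[GaussQ] LowV φ l'}

theorem IsHighTwistor.E_smul (h₁ : IsHighTwistor φ (twistor φ) l f₁) {w : HighV φ l} {z : X}
    (hw : IsWeightVector φ (f₁ w) z) (i : I) : f₁ (uE φ i • w) =
      tPow (2 * C.d i + D.pairing (D.til 1 i) z + φ.phi (Finsupp.single i 1) z) •
        uE φ i • f₁ w := by
  rw [h₁.map_smul, twistor_apply, twistorRing_gen, twistorGen, smul_assoc, mul_smul, hw.twE_smul,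
    smul_smul_comm', smul_smul, ← tPow_add, add_assoc]

theorem IsHighTwistor.F_smul (h₁ : IsHighTwistor φ (twistor φ) l f₁) {w : HighV φ l} {z : X}
    (hw : IsWeightVector φ (f₁ w) z) (i : I) : f₁ (uF φ i • w) =
      tPow (-φ.phi (Finsupp.single i 1) z) • uF φ i • f₁ w := by
  rw [h₁.map_smul, twistor_apply, twistorRing_gen, twistorGen, mul_smul, hw.Upsi_neg_smul,
    smul_smul_comm']

theorem IsLowTwistor.E_smul (h₂ : IsLowTwistor φ (twistor φ) l' f₂) {w : LowV φ l'} {z : X}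
    (hw : IsWeightVector φ (f₂ w) z) (i : I) : f₂ (uE φ i • w) =
      tPow (φ.phi (Finsupp.single i 1) z) • uE φ i • f₂ w := by
  rw [h₂.map_smul, twistorPrime_E, mul_smul, hw.Ups_smul, smul_smul_comm']

theorem IsLowTwistor.F_smul (h₂ : IsLowTwistor φ (twistor φ) l' f₂) {w : LowV φ l'} {z : X}
    (hw : IsWeightVector φ (f₂ w) z) (i : I) : f₂ (uF φ i • w) =
      tPow (D.pairing (D.til 1 i) z - φ.phi (Finsupp.single i 1) z) • uF φ i • f₂ w := by
  rw [h₂.map_smul, twistorPrime_F]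
  simp only [mul_smul, hw.Upsi_neg_smul, hw.T_smul, (hw.F_smul i).T_smul, smul_smul_comm',
    smul_smul, ← tPow_add]
  congr 1
  apply tPow_congr
  -- The outer torus element $T_{2d_ii}$ acts after $F_i$ has lowered the weight; the resulting
  -- shift is $4d_i\equiv0$.
  have h : D.pairing (D.til 1 i) (D.root i) = 2 * C.d i := by
    rw [pairing_til, C.d_mul_a_self, one_mul]
  simp only [map_nsmul, map_neg, map_sub, LinearMap.neg_apply, LinearMap.smul_apply, h, nsmul_eq_mul]
  unfold Int.ModEq
  push_cast
  omega

variable {κ : X → X → ℤ} {f : TensN φ l l' →ₗ[GaussQ] TensN φ l l'}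

theorem IsHighTwistor.isWeightVector (h₁ : IsHighTwistor φ (twistor φ) l f₁) {ν : I →₀ ℕ}
    {w : HighV φ l} (hw : HasWeight φ w (l - D.wtN ν)) : IsWeightVector φ (f₁ w) (l - D.wtN ν) :=
  torusLike_twistor.isWeightVector h₁.map_smul (high_isWeightVector hw)

theorem IsLowTwistor.isWeightVector (h₂ : IsLowTwistor φ (twistor φ) l' f₂) {μ : I →₀ ℕ}
    {w : LowV φ l'} (hw : HasWeight φ w (D.wtN μ - l')) :
    IsWeightVector φ (f₂ w) (D.wtN μ - l') :=
  torusLike_twistorPrime.isWeightVector h₂.map_smul (low_isWeightVector hw)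

/-! ### Phase count for the summands of $\Delta(E_i)$ and $\Delta(F_i)$ -/

section Steps

variable {ν μ : I →₀ ℕ} {w : HighV φ l} {w' : LowV φ l'}

theorem IsTensorTwistor.E_left (hκ : IsPhase φ l l' κ) (h₁ : IsHighTwistor φ (twistor φ) l f₁)
    (hf : IsTensorTwistor φ l l' κ f₁ f₂ f) (hw : HasWeight φ w (l - D.wtN ν))
    (hw' : HasWeight φ w' (D.wtN μ - l')) (i : I) : f ((uE φ i • w) ⊗ₜ w') =
      tPow (κ (l - D.wtN ν) (D.wtN μ - l') + 2 * C.d i + D.pairing (D.til 1 i) (l - D.wtN ν) +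
        φ.phi (Finsupp.single i 1) (l - D.wtN ν) + φ.phi (Finsupp.single i 1) (D.wtN μ - l')) •
        ((uE φ i • f₁ w) ⊗ₜ[Coeff] f₂ w') := by
  have hz := h₁.isWeightVector hw
  -- The recursion for $\varkappa$ is available only on $\mathbb N[I]$; if $i$ does not occur in
  -- $\nu$, then $E_i$ kills both $w$ and $f_1(w)$.
  rcases exists_add_single ν i with h0 | ⟨ν', rfl⟩
  · rw [high_E_smul_eq_zero hw h0, high_E_smul_eq_zero hz.hasWeight h0, zero_tmul, zero_tmul,
      map_zero, smul_zero]
  · have e : l - D.wtN (ν' + Finsupp.single i 1) + D.root i = l - D.wtN ν' := by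
      rw [wtN_add, wtN_single]; abel
    have hE := hw.E_smul i
    have hk := hκ.sub_root ν' μ i
    rw [sub_sub, ← wtN_single D i, ← wtN_add] at hk
    rw [e] at hE
    rw [hf ν' μ _ _ hE hw', h₁.E_smul hz, ← smul_tmul', smul_smul, ← tPow_add]
    congr 1
    apply tPow_congr
    unfold Int.ModEq at *
    omega

theorem IsTensorTwistor.F_left (hκ : IsPhase φ l l' κ) (h₁ : IsHighTwistor φ (twistor φ) l f₁)
    (hf : IsTensorTwistor φ l l' κ f₁ f₂ f) (hw : HasWeight φ w (l - D.wtN ν))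
    (hw' : HasWeight φ w' (D.wtN μ - l')) (i : I) : f ((uF φ i • w) ⊗ₜ w') =
      tPow (κ (l - D.wtN ν) (D.wtN μ - l') - φ.phi (Finsupp.single i 1) (l - D.wtN ν) -
        φ.phi (Finsupp.single i 1) (D.wtN μ - l')) • ((uF φ i • f₁ w) ⊗ₜ[Coeff] f₂ w') := by
  have hF := hw.F_smul i
  have hk := hκ.sub_root ν μ i
  rw [sub_sub, ← wtN_single D i, ← wtN_add] at hk hF
  rw [hf _ μ _ _ hF hw', h₁.F_smul (h₁.isWeightVector hw), ← smul_tmul', smul_smul, ← tPow_add]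
  congr 1
  apply tPow_congr
  unfold Int.ModEq at *
  omega

/-- The extra $2p(\nu)p(i)$ in the phase will cancel the sign produced by `sigma` on
$\pi^{p(i)p(\nu)}$ in $(1\otimes E_i)(w\otimes w')$. -/
theorem IsTensorTwistor.E_right (hκ : IsPhase φ l l' κ) (h₂ : IsLowTwistor φ (twistor φ) l' f₂)
    (hf : IsTensorTwistor φ l l' κ f₁ f₂ f) (hw : HasWeight φ w (l - D.wtN ν))
    (hw' : HasWeight φ w' (D.wtN μ - l')) (i : I) : f (w ⊗ₜ (uE φ i • w')) =
      tPow (κ (l - D.wtN ν) (D.wtN μ - l') + 2 * C.d i + D.pairing (D.til 1 i) (l - D.wtN ν) +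
        D.pairing (D.til 1 i) (D.wtN μ - l') + φ.phi (Finsupp.single i 1) (l - D.wtN ν) +
        φ.phi (Finsupp.single i 1) (D.wtN μ - l') + 2 * (C.p i * C.parity ν)) •
        (f₁ w ⊗ₜ[Coeff] (uE φ i • f₂ w')) := by
  have e : D.wtN μ - l' + D.root i = D.wtN (μ + Finsupp.single i 1) - l' := by
    rw [wtN_add, wtN_single]; abel
  have hE := hw'.E_smul i
  have hk := hκ.add_root ν μ i
  rw [e] at hk hE
  rw [map_add, mul_assoc, mul_comm (C.parity ν : ℤ)] at hk
  rw [hf ν _ _ _ hw hE, h₂.E_smul (h₂.isWeightVector hw'), tmul_smul, smul_smul, ← tPow_add]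
  congr 1
  apply tPow_congr
  unfold Int.ModEq at *
  omega

theorem IsTensorTwistor.F_right (hκ : IsPhase φ l l' κ) (h₂ : IsLowTwistor φ (twistor φ) l' f₂)
    (hf : IsTensorTwistor φ l l' κ f₁ f₂ f) (hw : HasWeight φ w (l - D.wtN ν))
    (hw' : HasWeight φ w' (D.wtN μ - l')) (i : I) : f (w ⊗ₜ (uF φ i • w')) =
      tPow (κ (l - D.wtN ν) (D.wtN μ - l') - D.pairing (D.til 1 i) (l - D.wtN ν) -
        φ.phi (Finsupp.single i 1) (l - D.wtN ν) -
        φ.phi (Finsupp.single i 1) (D.wtN μ - l') - 2 * (C.p i * C.parity ν)) •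
        (f₁ w ⊗ₜ[Coeff] (uF φ i • f₂ w')) := by
  have hz := h₂.isWeightVector hw'
  -- As on the left factor: either the recursion applies one step below $\mu$, or $F_i$ kills both
  -- $w'$ and $f_2(w')$.
  rcases exists_add_single μ i with h0 | ⟨μ', rfl⟩
  · rw [low_F_smul_eq_zero hw' h0, low_F_smul_eq_zero hz.hasWeight h0, tmul_zero, tmul_zero,
      map_zero, smul_zero]
  · have e : D.wtN (μ' + Finsupp.single i 1) - l' = D.wtN μ' - l' + D.root i := by
      rw [wtN_add, wtN_single]; abel
    have hF := hw'.F_smul i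
    have hk := hκ.add_root ν μ' i
    have h : D.pairing (D.til 1 i) (D.wtN (μ' + Finsupp.single i 1) - l') =
        D.pairing (D.til 1 i) (D.wtN μ' - l') + 2 * C.d i := by
      rw [e, map_add, pairing_til, C.d_mul_a_self, one_mul]
    rw [map_add, mul_assoc, mul_comm (C.parity ν : ℤ), ← e] at hk
    rw [e, add_sub_cancel_right] at hF
    rw [hf ν μ' _ _ hw hF, h₂.F_smul hz, tmul_smul, smul_smul, ← tPow_add]
    congr 1
    apply tPow_congr
    unfold Int.ModEq at *
    omega

end Steps

/-- Both sides are multiplicative and semilinear in $u$, so generators acting on tensors of weight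
vectors suffice. Torus generators work for any phase; $E_i$ and $F_i$ use its recursions. -/
theorem IsTensorTwistor.map_coAct (hκ : IsPhase φ l l' κ)
    (h₁ : IsHighTwistor φ (twistor φ) l f₁) (h₂ : IsLowTwistor φ (twistor φ) l' f₂)
    (hf : IsTensorTwistor φ l l' κ f₁ f₂ f) (hs : IsSigmaLinear f) (u : EnhU φ)
    (n : TensN φ l l') : f (coAct φ l l' u n) = coAct φ l l' (twistor φ u) (f n) := by
  induction u using U_induction generalizing n with
  | scalar c => rw [coAct_scalar, hs, torusLike_twistor.map_scalar, coAct_scalar]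
  | mul x y hx hy => rw [coAct_mul, hx, hy, map_mul, coAct_mul]
  | add x y hx hy => rw [coAct_add_left, map_add, hx, hy, map_add, coAct_add_left]
  | gen g =>
    induction n using tensN_induction with
    | add m n hm hn => rw [coAct_add_right, map_add, hm, hn, map_add, coAct_add_right]
    | weight ν μ w w' hw hw' =>
      have hv := high_isWeightVector hw
      have hv' := low_isWeightVector hw'
      have hz := h₁.isWeightVector hw
      have hz' := h₂.isWeightVector hw'
      have hT : ∀ y, coAct φ l l' (uT φ y) (f₁ w ⊗ₜ f₂ w') = (tPow (D.pairing y (l - D.wtN ν)) *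
          tPow (D.pairing y (D.wtN μ - l'))) • (f₁ w ⊗ₜ[Coeff] f₂ w') := fun y =>
        coAct_grouplike (coprod_gen φ _) (hasParity_T φ y) hz.hasWeight (hz.T_smul y) (hz'.T_smul y)
      have hU : ∀ y, coAct φ l l' (uUps φ y) (f₁ w ⊗ₜ f₂ w') = (tPow (φ.phi y (l - D.wtN ν)) *
          tPow (φ.phi y (D.wtN μ - l'))) • (f₁ w ⊗ₜ[Coeff] f₂ w') := fun y =>
        coAct_grouplike (coprod_gen φ _) (hasParity_Ups φ y) hz.hasWeight (hz.Ups_smul y)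
          (hz'.Ups_smul y)
      cases g with
      | T y =>
        rw [coAct_grouplike (coprod_gen φ _) (hasParity_T φ y) hw (hv.T_smul y) (hv'.T_smul y), hs,
          hf ν μ w w' hw hw', coAct_smul_right, torusLike_twistor.map_T, hT, map_mul, sigma_tPow,
          sigma_tPow, smul_comm]
      | Ups y =>
        rw [coAct_grouplike (coprod_gen φ _) (hasParity_Ups φ y) hw (hv.Ups_smul y)
          (hv'.Ups_smul y), hs, hf ν μ w w' hw hw', coAct_smul_right, torusLike_twistor.map_Ups, hU,
          map_mul, sigma_tPow, sigma_tPow, smul_comm]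
      | K y =>
        rw [coAct_grouplike (coprod_gen φ _) (hasParity_K φ y) hw (hv.K_smul y) (hv'.K_smul y), hs,
          hf ν μ w w' hw hw', coAct_smul_right, torusLike_twistor.map_K, coAct_mul,
          coAct_grouplike (coprod_gen φ _) (hasParity_K φ y) hz.hasWeight (hz.K_smul y)
            (hz'.K_smul y), coAct_smul_right, hT, map_mul, sigma_vPow, sigma_vPow, smul_comm,
          smul_smul (_ * _) (_ * _)]
        simp only [map_neg, LinearMap.neg_apply]
        congr 2
        ring
      | J y =>
        rw [coAct_grouplike (coprod_gen φ _) (hasParity_J φ y) hw (hv.J_smul y) (hv'.J_smul y), hs,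
          hf ν μ w w' hw hw', coAct_smul_right, torusLike_twistor.map_J, coAct_mul,
          coAct_grouplike (coprod_gen φ _) (hasParity_J φ y) hz.hasWeight (hz.J_smul y)
            (hz'.J_smul y), coAct_smul_right, hT, map_mul, sigma_piPow, sigma_piPow, smul_comm,
          smul_smul (_ * _) (_ * _)]
        simp only [map_nsmul, LinearMap.smul_apply, nsmul_eq_mul, Nat.cast_ofNat]
        congr 2
        ring
      | E i =>
        have hK : uKt φ (-1) i • w' = vPow (-D.pairing (D.til 1 i) (D.wtN μ - l')) • w' := by
          rw [hv'.K_smul, til_neg, map_neg, LinearMap.neg_apply]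
        have hK' : uKt φ (-1) i • f₂ w' =
            vPow (-D.pairing (D.til 1 i) (D.wtN μ - l')) • f₂ w' := by
          rw [hz'.K_smul, til_neg, map_neg, LinearMap.neg_apply]
        rw [coAct_E i hw, hK, tmul_smul, map_add, hs, hs, hf.E_left hκ h₁ hw hw',
          hf.E_right hκ h₂ hw hw', hf ν μ w w' hw hw', twistor_apply, twistorRing_gen, twistorGen,
          coAct_smul_left, coAct_mul, twE, coAct_mul, coAct_smul_right, coAct_smul_right,
          coAct_smul_right, hU, coAct_smul_right, hT, coAct_smul_right, coAct_smul_right,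
          coAct_E i hz.hasWeight, hK', tmul_smul (vPow _), smul_add, sigma_vPow, sigma_piPow]
        simp only [smul_add, smul_smul]
        rw [mul_right_comm, ← tPow_add, mul_right_comm, ← tPow_add]
        simp only [← mul_assoc (tPow _), ← tPow_add]
        -- The first summand lacks $d_i\langle i,\zeta'\rangle$, supplied by `sigma` on the scalar
        -- by which $\tilde K_{-i}$ acts on $w'$. The second has $2p(i)p(\nu)$ too much, doubled to
        -- $4p(i)p(\nu)$ by `sigma` on the sign.
        congr 2 <;> refine congrArg (· * _) (tPow_congr ?_) <;> unfold Int.ModEq <;> omega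
      | F i =>
        have hJK : (uJt φ 1 i * uKt φ 1 i) • w =
            (piPow (D.pairing (D.til 1 i) (l - D.wtN ν)) *
              vPow (D.pairing (D.til 1 i) (l - D.wtN ν))) • w := by
          rw [mul_smul, hv.K_smul, smul_smul_comm', hv.J_smul, smul_smul, mul_comm]
        have hJK' : (uJt φ 1 i * uKt φ 1 i) • f₁ w =
            (piPow (D.pairing (D.til 1 i) (l - D.wtN ν)) *
              vPow (D.pairing (D.til 1 i) (l - D.wtN ν))) • f₁ w := by
          rw [mul_smul, hz.K_smul, smul_smul_comm', hz.J_smul, smul_smul, mul_comm]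
        rw [coAct_F i hw, hJK, ← smul_tmul' (piPow _ * vPow _), map_add, hs, hs, hf.F_left hκ h₁ hw hw',
          hf.F_right hκ h₂ hw hw', hf ν μ w w' hw hw', twistor_apply, twistorRing_gen, twistorGen,
          coAct_mul, coAct_smul_right, hU, coAct_smul_right, coAct_smul_right,
          coAct_F i hz.hasWeight, hJK', ← smul_tmul' (piPow _ * vPow _), smul_add]
        have key : ∀ t₁ t₂ t₃ t₄ P Q V : Coeff,
            t₁ * P * (t₂ * Q * (t₃ * V) * t₄) = t₁ * t₂ * t₃ * t₄ * (P * (Q * V)) := by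
          intros; ring
        have hn := fun z => tPow_congr (phi_single_neg φ i z)
        simp only [smul_add, smul_smul, map_mul, sigma_piPow, sigma_vPow, hn, key]
        simp only [← mul_assoc (tPow _), ← tPow_add]
        congr 2
        · congr 1; ring
        -- `sigma` on the sign and on the scalar of $\tilde J_i\tilde K_i$ yields
        -- $2p(i)p(\nu)+(2-1)d_i\langle i,\zeta\rangle$, exactly what the phase subtracts.
        · refine congrArg (· * _) (congrArg (· * _) (congrArg tPow ?_))
          ring

end HighLow

end Compatibility

end

end QCov

theorem mainTheorem11 {I Y X : Type*} [Finite I]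
    [AddCommGroup Y] [Module.Free ℤ Y] [Module.Finite ℤ Y]
    [AddCommGroup X] [Module.Free ℤ X] [Module.Finite ℤ X]
    (C : QCov.SuperCartanDatum I) (D : QCov.RootDatum C Y X) (φ : QCov.Enhancer D)
    (l l' : X) (hl : D.IsDominant l) (hl' : D.IsDominant l') :
    (∃! Δ, QCov.IsCoproduct φ Δ) ∧ (∃! 𝔛, QCov.IsTwistor φ 𝔛) ∧ (∃ κ, QCov.IsPhase φ l l' κ) ∧
    ∀ Δ 𝔛, QCov.IsCoproduct φ Δ → QCov.IsTwistor φ 𝔛 →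
      (∃! f₁, QCov.IsHighTwistor φ 𝔛 l f₁) ∧ (∃! f₂, QCov.IsLowTwistor φ 𝔛 l' f₂) ∧
      ∀ f₁ f₂ κ, QCov.IsHighTwistor φ 𝔛 l f₁ → QCov.IsLowTwistor φ 𝔛 l' f₂ →
        QCov.IsPhase φ l l' κ →
        (∃! f, QCov.IsTensorTwistor φ l l' κ f₁ f₂ f) ∧
        ∀ f, QCov.IsTensorTwistor φ l l' κ f₁ f₂ f →
          ∀ (u : QCov.EnhU φ) (n : QCov.TensN φ l l'),
            f (QCov.covAct φ l l' (Δ u) n) = QCov.covAct φ l l' (Δ (𝔛 u)) (f n) := by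
  refine ⟨QCov.existsUnique_coproduct φ, QCov.existsUnique_twistor φ, QCov.exists_phase φ l l',
    fun Δ 𝔛 hΔ h𝔛 => ⟨QCov.existsUnique_highTwistor φ h𝔛 l, QCov.existsUnique_lowTwistor φ h𝔛 l',
      fun f₁ f₂ κ h₁ h₂ hκ => ?_⟩⟩
  obtain rfl := hΔ.eq_coprod
  obtain rfl := h𝔛.eq_twistor
  -- Semilinearity over `sigma` is not among the defining properties of $f$; it is known for the
  -- constructed map and passes to every other one by uniqueness.
  obtain ⟨f, hf, hs⟩ := QCov.exists_tensorTwistor κ f₁ f₂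
    (QCov.torusLike_twistor.isSigmaLinear h₁.map_smul)
    (QCov.torusLike_twistorPrime.isSigmaLinear h₂.map_smul)
  refine ⟨⟨f, hf, fun g hg => hg.unique hf⟩, fun g hg u n => ?_⟩
  obtain rfl := hg.unique hf
  exact hg.map_coAct hκ h₁ h₂ hs u n
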